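/- **Setting.** Fix disjoint finite relational schemas $\mathbf S$ (source) and $\mathbf T$ (target) and countably infinite sets of constants and of variables; instances are finite sets of tuples of constants. An *annotated bidirectional dependency* (abd) is a sentence $\forall \bar x\,\big(\exists \bar y\,\alpha(\bar x,\bar y)\leftrightarrow\exists\bar z\,\beta(\bar x,\bar z)\big)$, where $\alpha$ is a conjunction of atoms over $\mathbf S$, $\beta$ is a conjunction of atoms over $\mathbf T$ each annotated with an integer, and $\bar x$ consists of the variables shared by $\alpha$ and $\beta$. An *annotated egd* (aegd) is a sentence $\forall\bar x\,(\gamma(\bar x)\to x=y)$, where $\gamma$ is a conjunction of annotated atoms over $\mathbf T$ and $x,y$ occur in $\gamma$. Let $\Sigma$ be a finite set of abds and aegds. The *annotation density* of $\Sigma$ is the maximum, over $R\in\mathbf T$ and integers $i$, of the number of occurrences of $R$ with annotation $i$ in the abds of $\Sigma$. A position of an annotated relation symbol $R^i$ is *affected* if some variable of $\bar z$ of some abd of $\Sigma$ occurs there. An aegd is *safe* if every variable occurring at least twice in its body occurs only at non-affected positions. **Semantics.** Read each $R^i$ as a separate relation symbol $R_i$. For a target instance $J$ and a labelling $\ell$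 of its tuples by non-empty sets of integers let $J_\ell=\{R_i(\bar a): R(\bar a)\in J,\ i\in\ell(R(\bar a))\}$. For a source instance $I$, $\mathrm{Sol}(I,\Sigma)$ is the set of target instances $J$ that have a labelling $\ell$ such that $(I,J_\ell)\models\Sigma$ and every $R_i(\bar a)\in J_\ell$ belongs to some $J'\subseteq J_\ell$ for which there is $I'\subseteq I$ with $(I',J')\models\Sigma$ and $(I',J'')\not\models\Sigma$ for all $J''\subsetneq J'$. The *certain answers* of a query $q$ are $\mathrm{cert}(q,I)=\bigcap_{J\in \mathrm{Sol}(I,\Sigma)}q(J)$ (all tuples of constants if $\mathrm{Sol}(I,\Sigma)=\emptyset$). **Tables.** A *semi-naïve table* $T$ is a finite set of tuples of constants, open nulls and closed nulls; a *global condition* $\varphi^*$ is a conjunction of disjunctions of unequalities between elements of $T$. $\mathrm{Rep}(T,\varphi^*)$ is the set of all $v\big(v_1(T)\cup\dots\cup v_n(T)\big)$, where $n\ge 1$, $v$ assigns constants to the closed nulls, each $v_i$ assigns constants to the open nulls, and every conjunct of $\varphi^*$ contains an unequality $x\ne y$ such that the values of $x$ and $y$ differ under $(v,v_i)$ and $(v,v_j)$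 respectively, for all $i,j\le n$. The pair $(T,\varphi^*)$ is a *universal representative* for $I$ and $\Sigma$ if $\mathrm{Rep}(T,\varphi^*)=\mathrm{Sol}(I,\Sigma)$. **Theorem.** Let $\Sigma$ be a finite set of abds and safe aegds of annotation density $1$, and let $q$ be a union of conjunctive queries with unequalities over $\mathbf T$ with at most one unequality in each disjunct (every variable of the head or of an unequality of a disjunct occurs in a relational atom of that disjunct). Then, with $\Sigma$ and $q$ fixed: 1. There is a polynomial-time algorithm which, given a source instance $I$ and a tuple $\bar t$ of constants, decides whether $\bar t\in \mathrm{cert}(q,I)$. 2. Only the universal representative, if it exists, is needed: there is a polynomial-time algorithm which, given only a semi-naïve table with global condition $(T,\varphi^*)$ and a tuple $\bar t$ of constants, decides whether $\bar t\in\bigcap_{J\in\mathrm{Rep}(T,\varphi^*)}q(J)$; and whenever $(T,\varphi^*)$ is a universal representative for a source instance $I$ and $\Sigma$, this algorithm decides whether $\bar t\in \mathrm{cert}(q,I)$. Here polynomial time is Turing-machine time polynomial in the length of the input, with constants and nulls written in binary. -/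

import Mathlib

namespace ABDExchange

/-! ### Schemas, facts, instances -/

/-- A relational schema: finitely many relation symbols `0, …, size - 1`, each with an arity. -/
structure Schema where
  size : ℕ
  arity : Fin size → ℕ

/-- The countably infinite set of constants. -/
abbrev Cons := ℕ

/-- The countably infinite set of variables. -/
abbrev Var := ℕ

/-- A relational atom `R(u₁, …, u_k)` over the schema `S` with entries in `V`.  With constants as
entries it is a tuple of an instance, with variables it is an atom of a dependency, and so on. -/
structure RelAtom (S : Schema) (V : Type) where
  rel : Fin S.size
  args : Fin (S.arity rel) → V
deriving DecidableEq

/-- Apply a function to every entry. -/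
def RelAtom.map {S : Schema} {V W : Type} (g : V → W) (a : RelAtom S V) : RelAtom S W :=
  ⟨a.rel, fun p => g (a.args p)⟩

/-- The entries of an atom, listed with repetitions. -/
def RelAtom.vals {S : Schema} {V : Type} (a : RelAtom S V) : List V :=
  List.ofFn a.args

/-- A (finite) instance over the schema `S`. -/
abbrev Instance (S : Schema) := Finset (RelAtom S Cons)

/-- An annotated atom or an annotated tuple: the atom together with its integer annotation. -/
abbrev AnnAtom (T : Schema) (V : Type) := RelAtom T V × ℤ

/-! ### Annotated bidirectional dependencies and annotated egds -/

/-- An annotated bidirectional dependency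
`∀ x, (∃ y, α(x, y)) ↔ (∃ z, β(x, z))`, given by the conjunctions `α` (over the source schema) and
`β` (annotated, over the target schema).  The vector `x` consists of the variables that `α` and `β`
share, `y` and `z` of the remaining variables of `α` and of `β`. -/
structure ABD (S T : Schema) where
  body : List (RelAtom S Var)
  head : List (AnnAtom T Var)

/-- The variables of `α`. -/
def ABD.bodyVars {S T : Schema} (ξ : ABD S T) : List Var :=
  ξ.body.flatMap RelAtom.vals

/-- The variables of `β`. -/
def ABD.headVars {S T : Schema} (ξ : ABD S T) : List Var :=
  ξ.head.flatMap fun a => a.1.vals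

/-- The variables of `x`. -/
def ABD.IsShared {S T : Schema} (ξ : ABD S T) (w : Var) : Prop :=
  w ∈ ξ.bodyVars ∧ w ∈ ξ.headVars

/-- An annotated target egd `∀ x, α(x) → lhs = rhs`, where `lhs` and `rhs` are variables of `α`. -/
structure AEGD (T : Schema) where
  body : List (AnnAtom T Var)
  lhs : Var
  rhs : Var
  lhs_mem : lhs ∈ body.flatMap fun a => a.1.vals
  rhs_mem : rhs ∈ body.flatMap fun a => a.1.vals

/-- The variable occurrences in the body of an annotated egd, with repetitions. -/
def AEGD.bodyVars {T : Schema} (ξ : AEGD T) : List Var :=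
  ξ.body.flatMap fun a => a.1.vals

/-- A finite set of annotated bidirectional dependencies and annotated egds. -/
structure Mapping (S T : Schema) where
  abds : List (ABD S T)
  aegds : List (AEGD T)

/-- All occurrences of annotated relation symbols in the abds of `Σ`, with repetitions. -/
def Mapping.annOccurrences {S T : Schema} (M : Mapping S T) : List (Fin T.size × ℤ) :=
  M.abds.flatMap fun ξ => ξ.head.map fun a => (a.1.rel, a.2)

/-- The annotation density of `R`: the maximum, over the annotations `i` used with `R`, of the
number of occurrences of `R` annotated with `i` in the abds. -/
def Mapping.relDensity {S T : Schema} (M : Mapping S T) (R : Fin T.size) : ℕ :=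
  (M.annOccurrences.map Prod.snd).toFinset.sup fun i => M.annOccurrences.count (R, i)

/-- The annotation density: the maximum over all target relation symbols. -/
def Mapping.density {S T : Schema} (M : Mapping S T) : ℕ :=
  Finset.univ.sup M.relDensity

/-- The annotated position `(Rⁱ, p)` is affected: some abd has an existentially quantified head
variable (one that does not occur in its body) at this position. -/
def Mapping.Affected {S T : Schema} (M : Mapping S T) (R : Fin T.size) (i : ℤ)
    (p : Fin (T.arity R)) : Prop :=
  ∃ ξ ∈ M.abds, ∃ u : Fin (T.arity R) → Var, ((⟨R, u⟩ : RelAtom T Var), i) ∈ ξ.head ∧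
    u p ∉ ξ.bodyVars

/-- Every aegd is safe: a variable that occurs at least twice in its body
occurs at no affected position. -/
def Mapping.Safe {S T : Schema} (M : Mapping S T) : Prop :=
  ∀ ξ ∈ M.aegds, ∀ y : Var, 2 ≤ ξ.bodyVars.count y →
    ∀ a ∈ ξ.body, ∀ p, a.1.args p = y → ¬ M.Affected a.1.rel a.2 p

/-! ### The ABD-semantics

An instance over the schema with one relation symbol `R_i` for every target relation symbol `R` and
every annotation `i` is a set of annotated tuples. -/

/-- Satisfaction of an abd (with `Rⁱ` read as `R_i`) in the model-theoretic sense. -/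
def ABD.Holds {S T : Schema} (ξ : ABD S T) (I : Set (RelAtom S Cons)) (K : Set (AnnAtom T Cons)) :
    Prop :=
  ∀ ν : Var → Cons,
    (∃ μ : Var → Cons, (∀ w, ξ.IsShared w → μ w = ν w) ∧ ∀ a ∈ ξ.body, a.map μ ∈ I) ↔
    (∃ μ : Var → Cons, (∀ w, ξ.IsShared w → μ w = ν w) ∧ ∀ a ∈ ξ.head, (a.1.map μ, a.2) ∈ K)

/-- Satisfaction of an annotated egd in the model-theoretic sense. -/
def AEGD.Holds {T : Schema} (ξ : AEGD T) (K : Set (AnnAtom T Cons)) : Prop :=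
  ∀ ν : Var → Cons, (∀ a ∈ ξ.body, (a.1.map ν, a.2) ∈ K) → ν ξ.lhs = ν ξ.rhs

/-- `(I, K) ⊨ Σ`, where the annotated relation symbols are read as distinct relation symbols. -/
def Mapping.Models {S T : Schema} (M : Mapping S T) (I : Set (RelAtom S Cons))
    (K : Set (AnnAtom T Cons)) : Prop :=
  (∀ ξ ∈ M.abds, ξ.Holds I K) ∧ ∀ ξ ∈ M.aegds, ξ.Holds K

/-- The annotated instance `J_ℓ` of an instance `J` with tuple labels `ℓ`. -/
def labelled {T : Schema} (J : Instance T) (l : RelAtom T Cons → Set ℤ) : Set (AnnAtom T Cons) :=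
  {f | f.1 ∈ J ∧ f.2 ∈ l f.1}

/-- `J` with the labelling `ℓ` satisfies `Σ` together with `I`, and every labelled tuple belongs to
a subset-minimal model of `Σ` inside `J_ℓ` for some part of `I`. -/
def Mapping.Inferred {S T : Schema} (M : Mapping S T) (I : Instance S) (J : Instance T)
    (l : RelAtom T Cons → Set ℤ) : Prop :=
  M.Models (I : Set (RelAtom S Cons)) (labelled J l) ∧
  ∀ f ∈ J, ∀ i ∈ l f, ∃ I' : Set (RelAtom S Cons), I' ⊆ (I : Set (RelAtom S Cons)) ∧
    ∃ K' : Set (AnnAtom T Cons), K' ⊆ labelled J l ∧ (f, i) ∈ K' ∧ M.Models I' K' ∧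
      ∀ K'' : Set (AnnAtom T Cons), K'' ⊂ K' → ¬ M.Models I' K''

/-- The ABD-semantics: the target instances whose tuples can be labelled with non-empty sets of
integers such that the labelled instance is inferred from `I` and `Σ`. -/
def Mapping.Sol {S T : Schema} (M : Mapping S T) (I : Instance S) : Set (Instance T) :=
  {J | ∃ l : RelAtom T Cons → Set ℤ, (∀ f ∈ J, (l f).Nonempty) ∧ M.Inferred I J l}

/-! ### Unions of conjunctive queries with unequalities -/

/-- A term of a query: a variable or a constant. -/
inductive Term where
  | var (x : Var)
  | cst (c : Cons)

/-- The value of a term under an assignment. -/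
def Term.eval (ν : Var → Cons) : Term → Cons
  | .var x => ν x
  | .cst c => c

/-- A `k`-ary conjunctive query with unequalities.  As usual, every variable of its head and of its
unequalities occurs in one of its relational atoms. -/
structure CQNeq (T : Schema) (k : ℕ) where
  head : Fin k → Term
  body : List (RelAtom T Term)
  neqs : List (Term × Term)
  head_safe : ∀ p x, head p = .var x → ∃ a ∈ body, Term.var x ∈ a.vals
  neqs_safe : ∀ e ∈ neqs, ∀ x, (e.1 = .var x ∨ e.2 = .var x) → ∃ a ∈ body, Term.var x ∈ a.vals

/-- The set of answers of a conjunctive query with unequalities. -/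
def CQNeq.answers {T : Schema} {k : ℕ} (q : CQNeq T k) (J : Instance T) : Set (Fin k → Cons) :=
  {t | ∃ ν : Var → Cons, (∀ p, (q.head p).eval ν = t p) ∧
    (∀ a ∈ q.body, a.map (Term.eval ν) ∈ J) ∧ ∀ e ∈ q.neqs, e.1.eval ν ≠ e.2.eval ν}

/-- A `k`-ary union of conjunctive queries with unequalities, as the list of its disjuncts. -/
abbrev UCQNeq (T : Schema) (k : ℕ) := List (CQNeq T k)

/-- The set of answers of a union. -/
def UCQNeq.answers {T : Schema} {k : ℕ} (q : UCQNeq T k) (J : Instance T) : Set (Fin k → Cons) :=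
  {t | ∃ d ∈ q, t ∈ d.answers J}

/-- Every disjunct has at most one unequality. -/
def UCQNeq.AtMostOneNeq {T : Schema} {k : ℕ} (q : UCQNeq T k) : Prop :=
  ∀ d ∈ q, d.neqs.length ≤ 1

/-- The certain answers under a set of possible instances. -/
def certainOver {T : Schema} {k : ℕ} (q : UCQNeq T k) (W : Set (Instance T)) :
    Set (Fin k → Cons) :=
  ⋂ J ∈ W, UCQNeq.answers q J

/-! ### Semi-naïve tables with a global condition -/

/-- An entry of a semi-naïve table: a constant, an open null, or a closed null. -/
inductive Val where
  | cst (c : Cons)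
  | openNull (n : ℕ)
  | closedNull (n : ℕ)
deriving DecidableEq

/-- The value of an entry under a valuation `v` of the closed and `w` of the open nulls. -/
def Val.eval (v w : ℕ → Cons) : Val → Cons
  | .cst c => c
  | .openNull n => w n
  | .closedNull n => v n

/-- A semi-naïve table with a global condition `φ*`: a conjunction of disjunctions of
unequalities between elements that occur in the table.  A table and a condition are listed in
some order. -/
structure CondTable (T : Schema) where
  table : List (RelAtom T Val)
  cond : List (List (Val × Val))
  cond_dom : ∀ δ ∈ cond, ∀ e ∈ δ,
    (∃ a ∈ table, e.1 ∈ a.vals) ∧ ∃ a ∈ table, e.2 ∈ a.vals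

/-- `(v, {v₁, …, v_n}) ⊨ x ≠ y`: the values differ, whichever `v_i` is used for `x` if it is an open
null and whichever `v_j` is used for `y` if it is an open null. -/
def SatNeq {n : ℕ} (v : ℕ → Cons) (vs : Fin n → ℕ → Cons) (e : Val × Val) : Prop :=
  ∀ i j : Fin n, e.1.eval v (vs i) ≠ e.2.eval v (vs j)

/-- The set of instances represented by a table with a global condition: all
`v(v₁(T) ∪ … ∪ v_n(T))` with `n ≥ 1` such that `(v, {v₁, …, v_n})` satisfies the condition. -/
def CondTable.Rep {T : Schema} (D : CondTable T) : Set (Instance T) :=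
  {J | ∃ n : ℕ, 1 ≤ n ∧ ∃ (v : ℕ → Cons) (vs : Fin n → ℕ → Cons),
    (∀ δ ∈ D.cond, ∃ e ∈ δ, SatNeq v vs e) ∧
    ∀ f, f ∈ J ↔ ∃ i : Fin n, ∃ a ∈ D.table, a.map (Val.eval v (vs i)) = f}

/-- `(T, φ*)` is a universal representative for `I` and `Σ`. -/
def CondTable.IsUniversalRepresentative {S T : Schema} (D : CondTable T) (M : Mapping S T)
    (I : Instance S) : Prop :=
  D.Rep = M.Sol I

/-! ### Encodings of the inputs and polynomial time -/

/-- The finite alphabet for inputs over a schema with `n` relation symbols. -/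
inductive Sym (n : ℕ) where
  | rel (r : Fin n)
  | bit (b : Bool)
  | cst
  | openNull
  | closedNull
  | clause
  | neq
  | answer

/-- Constants and nulls are written in binary, behind a symbol that tells their kind. -/
def encodeVal {n : ℕ} : Val → List (Sym n)
  | .cst c => Sym.cst :: c.bits.map Sym.bit
  | .openNull m => Sym.openNull :: m.bits.map Sym.bit
  | .closedNull m => Sym.closedNull :: m.bits.map Sym.bit

/-- A fact is written as its relation symbol followed by its entries. -/
def encodeAtom {S : Schema} (a : RelAtom S Val) : List (Sym S.size) :=
  Sym.rel a.rel :: a.vals.flatMap encodeVal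

/-- A tuple of constants is written behind a separator. -/
def encodeTuple {n k : ℕ} (t : Fin k → Cons) : List (Sym n) :=
  Sym.answer :: (List.ofFn t).flatMap fun c => encodeVal (Val.cst c)

/-- A global condition. -/
def encodeCond {n : ℕ} (φ : List (List (Val × Val))) : List (Sym n) :=
  φ.flatMap fun δ => Sym.clause ::
    δ.flatMap fun e => Sym.neq :: (encodeVal e.1 ++ encodeVal e.2)

/-- A source instance, given as a list of its facts in any order, and a tuple of constants. -/
def encodeSourceInput {S : Schema} {k : ℕ} (x : List (RelAtom S Cons) × (Fin k → Cons)) :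
    List (Sym S.size) :=
  (x.1.flatMap fun a => encodeAtom (a.map Val.cst)) ++ encodeTuple x.2

/-- A table with a global condition, and a tuple of constants. -/
def encodeTableInput {T : Schema} {k : ℕ} (x : CondTable T × (Fin k → Cons)) :
    List (Sym T.size) :=
  x.1.table.flatMap encodeAtom ++ encodeCond x.1.cond ++ encodeTuple x.2

/-- The Boolean function `f` on inputs written by `enc` is computed by a Turing machine in time
polynomial in the length of the written input. -/
def PolyTime {α Γ : Type} (enc : α → List Γ) (f : α → Bool) : Prop :=
  Nonempty (Turing.TM2ComputableInPolyTime enc Computability.encodeBool f)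

end ABDExchange

/-!
A tuple `t` is *not* a certain answer if and only if some possible instance avoids it.  In both parts
of the theorem this condition is turned into the existence of a single valuation of finitely many
elements that satisfies finitely many egds and denials, and the latter is decided by a chase.

**Queries.**  An instance avoids `t` if and only if no disjunct of the query returns `t`.  A disjunct
with exactly one unequality `x ≠ y` does not return `t` if and only if every match of its atoms makes
`x` and `y` equal, so it acts as an egd; a disjunct without unequalities acts as a denial
(`UCQNeq.not_mem_answers_iff`).  Moreover, answers of queries with unequalities are preserved when an
instance grows.

**Tables.**  By this monotonicity, one valuation of the open nulls suffices, and each clause of the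
global condition forbids that all its unequalities are violated at once: again a denial
(`CondTable.exists_rep_iff`, `table_conditions_iff`).

**Source instances.**  Firing all abds from left to right on the source instance, with one null for
every abd, every variable that does not occur in its body, and all values of its shared variables,
yields the canonical facts. Every solution contains them under a suitable valuation
(`Describes.exists_fired_subset`).  Conversely, let a valuation satisfy the aegds and violate no
abd from right to left.  Then the canonical facts are a model (`Describes.models_fired`), and a
minimal model inside it is a solution that has no further answers (`Describes.exists_sol_iff`).
The condition on the abds, read from right to left, is a denial: a match of the head that has no
counterpart in the source instance is forbidden.  This uses that the annotation density is one: a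
fact that matches a head atom has been produced by the same atom, so its entries for the shared
variables are constants of the source instance, over which one can quantify.

**The chase.**  All premises are preserved when more elements become equal.  Hence there is a least
equivalence relation that is closed under the egds, and a valuation as required exists if and only if
this relation merges no two distinct constants and no denial is matched up to it
(`exists_valuation_iff`).  Elements are tuples of positions of the input word, so the relation is the
least fixed point of a monotone operator on relations of fixed arity between positions.  The operator
is first-order definable from the order of the positions, the letters, and the comparison of blocks
of digits (`Def`), and polynomially many rounds reach the fixed point (`polyTime_of_lfp`,
`polyTime_of_chase`).

**Turing machines.**  Such fixed points are computed by programs whose only loops run through the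
positions of the word (`Prog`).  These are compiled into structured programs for the stack machines
of Mathlib (`Cmd`, `Compile.compile`); a register that holds a position becomes a pair of stacks with
the parts of the word on its two sides.  As the loops are bounded, running times are polynomial
(`Compile.runLE_compile`, `Prog.polyTime`).
-/

namespace ABDExchange

/-! ### Structured programs for stack machines -/

/-- Structured programs over the stacks `K` with alphabets `Γ` and finite local state `σ`: the
primitive operations of `Turing.TM2`, closed under composition, conditionals and loops. -/
inductive Cmd {K : Type} (Γ : K → Type) (σ : Type) : Type
  | push (k : K) (f : σ → Γ k)
  | pop (k : K) (f : σ → Option (Γ k) → σ)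
  | peek (k : K) (f : σ → Option (Γ k) → σ)
  | load (f : σ → σ)
  | seq (c d : Cmd Γ σ)
  | ite (p : σ → Bool) (c d : Cmd Γ σ)
  | loop (p : σ → Bool) (c : Cmd Γ σ)

namespace Cmd

variable {K : Type} {Γ : K → Type} {σ : Type}

/-- `Run c v S v' S' t`: started with local state `v` and stacks `S`, the program `c` stops after
exactly `t` machine steps with local state `v'` and stacks `S'`. -/
inductive Run [DecidableEq K] : Cmd Γ σ → σ → (∀ k, List (Γ k)) → σ → (∀ k, List (Γ k)) → ℕ → Prop
  | push (k f v S) : Run (push k f) v S v (Function.update S k (f v :: S k)) 1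
  | pop (k f v S) : Run (pop k f) v S (f v (S k).head?) (Function.update S k (S k).tail) 1
  | peek (k f v S) : Run (peek k f) v S (f v (S k).head?) S 1
  | load (f v S) : Run (load f) v S (f v) S 1
  | seq {c d v S v' S' v'' S'' t t'} : Run c v S v' S' t → Run d v' S' v'' S'' t' →
      Run (seq c d) v S v'' S'' (t + t')
  | ite_true {p c d v S v' S' t} : p v = true → Run c v S v' S' t →
      Run (ite p c d) v S v' S' (1 + t)
  | ite_false {p c d v S v' S' t} : p v = false → Run d v S v' S' t →
      Run (ite p c d) v S v' S' (1 + t)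
  | loop_false {p c v S} : p v = false → Run (loop p c) v S v S 1
  | loop_true {p c v S v' S' v'' S'' t t'} : p v = true → Run c v S v' S' t →
      Run (loop p c) v' S' v'' S'' t' → Run (loop p c) v S v'' S'' (1 + t + t')

/-- The labels of the machine code of a program. -/
def Lab : Cmd Γ σ → Type
  | push _ _ | pop _ _ | peek _ _ | load _ => Unit
  | seq c d => Lab c ⊕ Lab d
  | ite _ c d => Option (Lab c ⊕ Lab d)
  | loop _ c => Option (Lab c)

noncomputable instance Lab.fintype (c : Cmd Γ σ) : Fintype (Lab c) := by
  induction c with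
  | push | pop | peek | load => exact inferInstanceAs (Fintype Unit)
  | seq c d ihc ihd => exact inferInstanceAs (Fintype (Lab c ⊕ Lab d))
  | ite p c d ihc ihd => exact inferInstanceAs (Fintype (Option (Lab c ⊕ Lab d)))
  | loop p c ihc => exact inferInstanceAs (Fintype (Option (Lab c)))

/-- The label at which the machine code of a program starts. -/
def entry : (c : Cmd Γ σ) → Lab c
  | push _ _ | pop _ _ | peek _ _ | load _ => ()
  | seq c _ => Sum.inl (entry c)
  | ite _ _ _ => none
  | loop _ _ => none

open Turing.TM2 (Stmt)

/-- The machine code of a program, placed by `emb` among the labels `Λ` of a machine and continuing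
at the label `exit`. -/
def code {Λ : Type} : (c : Cmd Γ σ) → (Lab c → Λ) → Λ → Lab c → Stmt Γ Λ σ
  | push k f, _, exit, _ => .push k f (.goto fun _ => exit)
  | pop k f, _, exit, _ => .pop k f (.goto fun _ => exit)
  | peek k f, _, exit, _ => .peek k f (.goto fun _ => exit)
  | load f, _, exit, _ => .load f (.goto fun _ => exit)
  | seq c d, emb, exit, l =>
      Sum.elim (code c (emb ∘ Sum.inl) (emb (Sum.inr (entry d)))) (code d (emb ∘ Sum.inr) exit) l
  | ite p c d, emb, exit, l =>
      Option.elim (α := Lab c ⊕ Lab d) l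
        (.branch p (.goto fun _ => emb (some (Sum.inl (entry c))))
          (.goto fun _ => emb (some (Sum.inr (entry d)))))
        (Sum.elim (code c (emb ∘ some ∘ Sum.inl) exit) (code d (emb ∘ some ∘ Sum.inr) exit))
  | loop p c, emb, exit, l =>
      Option.elim (α := Lab c) l
        (.branch p (.goto fun _ => emb (some (entry c))) (.goto fun _ => exit))
        (code c (emb ∘ some) (emb none))

/-- `t` steps of the machine `M` lead from `a` to `b`. -/
def Steps [DecidableEq K] {Λ : Type} (M : Λ → Stmt Γ Λ σ) (a b : Turing.TM2.Cfg Γ Λ σ) (t : ℕ) :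
    Prop :=
  (flip bind (Turing.TM2.step M))^[t] (some a) = some b

theorem Steps.trans [DecidableEq K] {Λ : Type} {M : Λ → Stmt Γ Λ σ} {a b c : Turing.TM2.Cfg Γ Λ σ}
    {t t' : ℕ} (h : Steps M a b t) (h' : Steps M b c t') : Steps M a c (t + t') := by
  unfold Steps at *
  rw [Nat.add_comm, Function.iterate_add_apply, h, h']

theorem Steps.single [DecidableEq K] {Λ : Type} {M : Λ → Stmt Γ Λ σ} {l : Λ} {v : σ}
    {S : ∀ k, List (Γ k)} {b : Turing.TM2.Cfg Γ Λ σ} (h : Turing.TM2.stepAux (M l) v S = b) :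
    Steps M ⟨some l, v, S⟩ b 1 := by
  subst h
  rfl

/-- Wherever the machine code of a program is placed, a run of the program is a run of the machine
from the entry label to the exit label. -/
theorem Run.steps [DecidableEq K] {c : Cmd Γ σ} {v v' : σ} {S S' : ∀ k, List (Γ k)} {t : ℕ}
    (h : Run c v S v' S' t) : ∀ {Λ : Type} (M : Λ → Stmt Γ Λ σ) (emb : Lab c → Λ) (exit : Λ),
      (∀ l, M (emb l) = code c emb exit l) →
      Steps M ⟨some (emb (entry c)), v, S⟩ ⟨some exit, v', S'⟩ t := by
  induction h with
  | push k f v S => intro Λ M emb exit hM; exact Steps.single (by rw [hM]; rfl)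
  | pop k f v S => intro Λ M emb exit hM; exact Steps.single (by rw [hM]; rfl)
  | peek k f v S => intro Λ M emb exit hM; exact Steps.single (by rw [hM]; rfl)
  | load f v S => intro Λ M emb exit hM; exact Steps.single (by rw [hM]; rfl)
  | seq _ _ ihc ihd =>
    intro Λ M emb exit hM
    exact (ihc M (emb ∘ Sum.inl) _ fun l => hM (Sum.inl l)).trans
      (ihd M (emb ∘ Sum.inr) exit fun l => hM (Sum.inr l))
  | @ite_true p c d v S v' S' t hp _ ih =>
    intro Λ M emb exit hM
    refine Steps.trans (Steps.single (b := ⟨some (emb (some (Sum.inl (entry c)))), v, S⟩) ?_)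
      (ih M (emb ∘ some ∘ Sum.inl) exit fun l => hM (some (Sum.inl l)))
    rw [hM]; simp [code, entry, hp]
  | @ite_false p c d v S v' S' t hp _ ih =>
    intro Λ M emb exit hM
    refine Steps.trans (Steps.single (b := ⟨some (emb (some (Sum.inr (entry d)))), v, S⟩) ?_)
      (ih M (emb ∘ some ∘ Sum.inr) exit fun l => hM (some (Sum.inr l)))
    rw [hM]; simp [code, entry, hp]
  | loop_false hp =>
    intro Λ M emb exit hM
    refine Steps.single ?_
    rw [hM]; simp [code, entry, hp]
  | @loop_true p c v S v' S' v'' S'' t t' hp _ _ ih ih' =>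
    intro Λ M emb exit hM
    refine Steps.trans (Steps.trans
      (Steps.single (b := ⟨some (emb (some (entry c))), v, S⟩) ?_)
      (ih M (emb ∘ some) (emb none) fun l => hM (some l))) (ih' M emb exit hM)
    rw [hM]; simp [code, entry, hp]

/-- The machine that runs a program and halts. -/
def machine (c : Cmd Γ σ) : Option (Lab c) → Stmt Γ (Option (Lab c)) σ
  | none => .halt
  | some l => code c some none l

theorem Run.halts [DecidableEq K] {c : Cmd Γ σ} {v v' : σ} {S S' : ∀ k, List (Γ k)} {t : ℕ}
    (h : Run c v S v' S' t) :
    Steps (machine c) ⟨some (some (entry c)), v, S⟩ ⟨none, v', S'⟩ (t + 1) :=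
  (h.steps (machine c) some none fun _ => rfl).trans (Steps.single rfl)

/-- `c` stops within `t` machine steps. -/
def RunLE [DecidableEq K] (c : Cmd Γ σ) (v : σ) (S : ∀ k, List (Γ k)) (v' : σ)
    (S' : ∀ k, List (Γ k)) (t : ℕ) : Prop :=
  ∃ t' ≤ t, Run c v S v' S' t'

section RunLE

variable [DecidableEq K] {c d : Cmd Γ σ} {v v' v'' : σ} {S S' S'' : ∀ k, List (Γ k)} {t t' : ℕ}

theorem RunLE.mono (h : RunLE c v S v' S' t) (ht : t ≤ t') : RunLE c v S v' S' t' :=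
  ⟨h.choose, h.choose_spec.1.trans ht, h.choose_spec.2⟩

theorem RunLE.push (k : K) (f : σ → Γ k) (v : σ) (S : ∀ k, List (Γ k)) :
    RunLE (.push k f) v S v (Function.update S k (f v :: S k)) 1 := ⟨1, le_rfl, .push ..⟩

theorem RunLE.pop (k : K) (f : σ → Option (Γ k) → σ) (v : σ) (S : ∀ k, List (Γ k)) :
    RunLE (.pop k f) v S (f v (S k).head?) (Function.update S k (S k).tail) 1 :=
  ⟨1, le_rfl, .pop ..⟩

theorem RunLE.peek (k : K) (f : σ → Option (Γ k) → σ) (v : σ) (S : ∀ k, List (Γ k)) :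
    RunLE (.peek k f) v S (f v (S k).head?) S 1 := ⟨1, le_rfl, .peek ..⟩

theorem RunLE.load (f : σ → σ) (v : σ) (S : ∀ k, List (Γ k)) :
    RunLE (.load f) v S (f v) S 1 := ⟨1, le_rfl, .load ..⟩

theorem RunLE.seq (h : RunLE c v S v' S' t) (h' : RunLE d v' S' v'' S'' t') :
    RunLE (.seq c d) v S v'' S'' (t + t') := by
  obtain ⟨a, ha, h⟩ := h
  obtain ⟨b, hb, h'⟩ := h'
  exact ⟨a + b, by omega, .seq h h'⟩

theorem RunLE.ite_true {p : σ → Bool} (hp : p v = true) (h : RunLE c v S v' S' t) :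
    RunLE (.ite p c d) v S v' S' (1 + t) := by
  obtain ⟨a, ha, h⟩ := h
  exact ⟨1 + a, by omega, .ite_true hp h⟩

theorem RunLE.ite_false {p : σ → Bool} (hp : p v = false) (h : RunLE d v S v' S' t) :
    RunLE (.ite p c d) v S v' S' (1 + t) := by
  obtain ⟨a, ha, h⟩ := h
  exact ⟨1 + a, by omega, .ite_false hp h⟩

theorem RunLE.loop_false {p : σ → Bool} (hp : p v = false) : RunLE (.loop p c) v S v S 1 :=
  ⟨1, le_rfl, .loop_false hp⟩

theorem RunLE.loop_true {p : σ → Bool} (hp : p v = true) (h : RunLE c v S v' S' t)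
    (h' : RunLE (.loop p c) v' S' v'' S'' t') : RunLE (.loop p c) v S v'' S'' (1 + t + t') := by
  obtain ⟨a, ha, h⟩ := h
  obtain ⟨b, hb, h'⟩ := h'
  exact ⟨1 + a + b, by omega, .loop_true hp h h'⟩

end RunLE

end Cmd

/-! ### Loop programs on words and their compilation -/

/-- Programs with `n` read-only registers for positions of the input word and `J` stacks of bits.
`any φ` executes `φ` for every position in turn, in the new register `n`, and returns the
disjunction of the results; it is the only loop, so running times are polynomial.
`same s x y` compares the longest blocks of letters with property `s` behind `x` and `y`. -/
inductive Prog (Γ : Type) (J : ℕ) : ℕ → Type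
  | const {n : ℕ} (b : Bool) : Prog Γ J n
  | letter {n : ℕ} (s : Γ → Bool) (x : Fin n) : Prog Γ J n
  | same {n : ℕ} (s : Γ → Bool) (x y : Fin n) : Prog Γ J n
  | ite {n : ℕ} (c t e : Prog Γ J n) : Prog Γ J n
  | any {n : ℕ} (φ : Prog Γ J (n + 1)) : Prog Γ J n
  | pop {n : ℕ} (j : Fin J) : Prog Γ J n
  | push {n : ℕ} (j : Fin J) (b : Bool) : Prog Γ J n

namespace Prog

variable {Γ : Type} {J : ℕ}

/-- The result of a program and the stacks of bits that it leaves. -/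
def eval [DecidableEq Γ] : {n : ℕ} → Prog Γ J n → (w : List Γ) → (Fin n → Fin w.length) →
    (Fin J → List Bool) → Bool × (Fin J → List Bool)
  | _, const b, _, _, m => (b, m)
  | _, letter s x, w, e, m => (s w[e x], m)
  | _, same s x y, w, e, m =>
      (decide ((w.drop (e x + 1)).takeWhile s = (w.drop (e y + 1)).takeWhile s), m)
  | _, ite c t f, w, e, m =>
      let r := eval c w e m
      if r.1 then eval t w e r.2 else eval f w e r.2
  | n, any φ, w, e, m =>
      (List.finRange w.length).foldl (fun a i =>
        let r := eval φ w (Fin.snoc (α := fun _ : Fin (n + 1) => Fin w.length) e i) a.2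
        (a.1 || r.1, r.2)) (false, m)
  | _, pop j, _, _, m => ((m j).head?.getD false, Function.update m j (m j).tail)
  | _, push j b, _, _, m => (b, Function.update m j (b :: m j))

/-- The largest number of registers that are in use at the same time. -/
def width : {n : ℕ} → Prog Γ J n → ℕ
  | n, const _ | n, letter _ _ | n, same _ _ _ | n, pop _ | n, push _ _ => n
  | _, ite c t f => max (width c) (max (width t) (width f))
  | _, any φ => width φ

theorem le_width {n : ℕ} (φ : Prog Γ J n) : n ≤ width φ := by
  induction φ with
  | const | letter | same | pop | push => exact le_rfl
  | ite c t f ih _ _ => exact ih.trans (le_max_left _ _)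
  | any φ ih => exact (Nat.le_succ _).trans ih

end Prog

/-- The stacks of the machine for a program: input, output, a scratch stack, the two halves of the
copy of the word that belongs to a register, and the stacks of bits. -/
inductive StackId (R J : ℕ) : Type
  | inp
  | out
  | tmp
  | right (i : Fin (R + 1))
  | left (i : Fin (R + 1))
  | mem (j : Fin J)
deriving DecidableEq, Fintype

/-- The alphabets of the stacks. -/
abbrev StackId.Alph (Γ : Type) {R J : ℕ} : StackId R J → Type
  | .inp | .tmp | .right _ | .left _ => Γ
  | .out | .mem _ => Bool

/-- The local state of the machine for a program: the current result, the partial disjunctions of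
the open loops, and two buffers for letters. -/
structure Reg (Γ : Type) (R : ℕ) : Type where
  res : Bool
  acc : Fin (R + 1) → Bool
  buf : Option Γ
  buf' : Option Γ

noncomputable instance (Γ : Type) [Fintype Γ] (R : ℕ) : Fintype (Reg Γ R) :=
  Fintype.ofInjective (fun s : Reg Γ R => (s.res, s.acc, s.buf, s.buf')) fun s t h => by
    cases s; cases t; simpa [Prod.ext_iff] using h

namespace Compile

variable {Γ : Type} {R J : ℕ}

/-- The stacks with the given contents. -/
def store (inp : List Γ) (out : List Bool) (tmp : List Γ) (A B : Fin (R + 1) → List Γ)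
    (m : Fin J → List Bool) : ∀ k : StackId R J, List (k.Alph Γ)
  | .inp => inp
  | .out => out
  | .tmp => tmp
  | .right i => A i
  | .left i => B i
  | .mem j => m j

section

variable (inp : List Γ) (out : List Bool) (tmp : List Γ) (A B : Fin (R + 1) → List Γ)
    (m : Fin J → List Bool)

theorem update_inp (l : List Γ) :
    Function.update (store inp out tmp A B m) .inp l = store l out tmp A B m := by
  funext k; cases k <;> simp [Function.update, store]

theorem update_out (l : List Bool) :
    Function.update (store inp out tmp A B m) .out l = store inp l tmp A B m := by
  funext k; cases k <;> simp [Function.update, store]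

theorem update_tmp (l : List Γ) :
    Function.update (store inp out tmp A B m) .tmp l = store inp out l A B m := by
  funext k; cases k <;> simp [Function.update, store]

theorem update_right (i : Fin (R + 1)) (l : List Γ) :
    Function.update (store inp out tmp A B m) (.right i) l =
      store inp out tmp (Function.update A i l) B m := by
  funext k
  cases k with
  | right k =>
    rcases eq_or_ne k i with rfl | hk
    · simp [store]
    · rw [Function.update_of_ne (by simpa using hk)]
      simp [store, hk]
  | _ => simp [Function.update, store]

theorem update_left (i : Fin (R + 1)) (l : List Γ) :
    Function.update (store inp out tmp A B m) (.left i) l =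
      store inp out tmp A (Function.update B i l) m := by
  funext k
  cases k with
  | left k =>
    rcases eq_or_ne k i with rfl | hk
    · simp [store]
    · rw [Function.update_of_ne (by simpa using hk)]
      simp [store, hk]
  | _ => simp [Function.update, store]

theorem update_mem (j : Fin J) (l : List Bool) :
    Function.update (store inp out tmp A B m) (.mem j) l =
      store inp out tmp A B (Function.update m j l) := by
  funext k
  cases k with
  | mem k =>
    rcases eq_or_ne k j with rfl | hk
    · simp [store]
    · rw [Function.update_of_ne (by simpa using hk)]
      simp [store, hk]
  | _ => simp [Function.update, store]

end

/-- The stacks when register `i` is at position `h i` of the word `w`: the letters from this position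
on are on its right stack, the letters before it, reversed, on its left stack.  The scratch stack is
a counter with the value `d`. -/
def conf (w : List Γ) (h : Fin (R + 1) → ℕ) (d : ℕ) [Inhabited Γ] (m : Fin J → List Bool) :
    ∀ k : StackId R J, List (k.Alph Γ) :=
  store [] [] (List.replicate d default) (fun i => w.drop (h i)) (fun i => (w.take (h i)).reverse) m

theorem runLE_congr {c : Cmd (K := StackId R J) (StackId.Alph Γ) (Reg Γ R)} {v v' w' : Reg Γ R}
    {S S' T' : ∀ k : StackId R J, List (k.Alph Γ)} {t : ℕ} (h : c.RunLE v S v' S' t)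
    (hv : v' = w') (hS : S' = T') : c.RunLE v S w' T' t := hv ▸ hS ▸ h

variable [Inhabited Γ]

/-- The programs of the machine. -/
abbrev RCmd (Γ : Type) (R J : ℕ) : Type :=
  Cmd (K := StackId R J) (StackId.Alph Γ) (Reg Γ R)

/-- Move register `i` one position to the right. -/
def moveR (i : Fin (R + 1)) : RCmd Γ R J :=
  .seq (.pop (.right i) fun s o => { s with buf := o }) (.push (.left i) fun s => s.buf.getD default)

/-- Move register `i` one position to the left. -/
def moveL (i : Fin (R + 1)) : RCmd Γ R J :=
  .seq (.pop (.left i) fun s o => { s with buf := o }) (.push (.right i) fun s => s.buf.getD default)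

open Cmd (RunLE)

theorem runLE_moveR (w : List Γ) (h : Fin (R + 1) → ℕ) (d : ℕ) (m : Fin J → List Bool)
    (i : Fin (R + 1)) (v : Reg Γ R) (hi : h i < w.length) :
    RunLE (moveR i) v (conf w h d m) { v with buf := some w[h i] }
      (conf w (Function.update h i (h i + 1)) d m) 2 := by
  refine runLE_congr ((RunLE.pop _ _ _ _).seq (RunLE.push _ _ _ _)) ?_ ?_
  · simp [conf, store, List.head?_drop, hi]
  · simp only [conf, update_right, update_left]
    congr 1
    · funext k
      rcases eq_or_ne k i with rfl | hk
      · simp [store]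
      · simp [hk]
    · funext k
      rcases eq_or_ne k i with rfl | hk
      · simp only [store, Function.update_self]
        rw [List.take_add_one, List.reverse_append]
        simp [List.head?_drop, hi]
      · simp [hk]

theorem runLE_moveL (w : List Γ) (h : Fin (R + 1) → ℕ) (d : ℕ) (m : Fin J → List Bool)
    (i : Fin (R + 1)) (v : Reg Γ R) (a : ℕ) (hi : h i = a + 1) (ha : a < w.length) :
    RunLE (moveL i) v (conf w h d m) { v with buf := some w[a] }
      (conf w (Function.update h i a) d m) 2 := by
  have key : (w.take (h i)).reverse = w[a] :: (w.take a).reverse := by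
    rw [hi, List.take_add_one, List.reverse_append]
    simp [ha]
  refine runLE_congr ((RunLE.pop _ _ _ _).seq (RunLE.push _ _ _ _)) ?_ ?_
  · simp [conf, store, key]
  · simp only [conf, update_right, update_left]
    congr 1
    · funext k
      rcases eq_or_ne k i with rfl | hk
      · simp only [store, Function.update_self]
        rw [key]
        simp [hi]
      · simp [hk]
    · funext k
      rcases eq_or_ne k i with rfl | hk
      · simp [store, key]
      · simp [hk]

/-- Peek at the letters under the registers `x` and `y`. -/
def peeks (x y : Fin (R + 1)) : RCmd Γ R J :=
  .seq (.peek (.right x) fun s o => { s with buf := o })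
    (.peek (.right y) fun s o => { s with buf' := o })

theorem runLE_peeks (w : List Γ) (h : Fin (R + 1) → ℕ) (d : ℕ) (m : Fin J → List Bool)
    (x y : Fin (R + 1)) (v : Reg Γ R) :
    RunLE (peeks x y) v (conf w h d m) { v with buf := w[h x]?, buf' := w[h y]? }
      (conf w h d m) 2 := by
  refine runLE_congr ((RunLE.peek _ _ _ _).seq (RunLE.peek _ _ _ _)) ?_ rfl
  simp [conf, store, List.head?_drop]

/-- The buffers hold equal letters with property `s`. -/
def agree [DecidableEq Γ] (s : Γ → Bool) (v : Reg Γ R) : Bool :=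
  v.buf.any s && decide (v.buf = v.buf')

/-- Move the registers `x` and `y` to the right as long as they see equal letters with property `s`,
and count the moves on the scratch stack. -/
def scan [DecidableEq Γ] (s : Γ → Bool) (x y : Fin (R + 1)) : RCmd Γ R J :=
  .loop (agree s) (.seq (moveR x) (.seq (moveR y) (.seq (.push .tmp fun _ => default) (peeks x y))))

/-- The position function in which the two registers `x` and `y` are placed at `a` and `b`. -/
def place (h : Fin (R + 1) → ℕ) (x y : Fin (R + 1)) (a b : ℕ) : Fin (R + 1) → ℕ :=
  Function.update (Function.update h x a) y b

theorem runLE_move_both (w : List Γ) (h : Fin (R + 1) → ℕ) (d : ℕ) (m : Fin J → List Bool)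
    {x y : Fin (R + 1)} (hxy : x ≠ y) (v : Reg Γ R) {a b : ℕ} (ha : a < w.length)
    (hb : b < w.length) :
    RunLE (.seq (moveR x) (moveR y)) v (conf w (place h x y a b) d m) { v with buf := some w[b] }
      (conf w (place h x y (a + 1) (b + 1)) d m) 4 := by
  have e1 : place h x y a b x = a := by simp [place, hxy]
  have e2 : Function.update (place h x y a b) x (a + 1) y = b := by simp [place, hxy.symm]
  have := (runLE_moveR w (place h x y a b) d m x v (by rw [e1]; exact ha)).seq
    (runLE_moveR w _ d m y _ (by rw [e1, e2]; exact hb))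
  simp only [e1, e2] at this
  have e3 : Function.update (Function.update (place h x y a b) x (a + 1)) y (b + 1) =
      place h x y (a + 1) (b + 1) := by
    unfold place
    rw [Function.update_comm hxy.symm, Function.update_idem, Function.update_idem]
  rwa [e3] at this

theorem runLE_move_both_left (w : List Γ) (h : Fin (R + 1) → ℕ) (d : ℕ) (m : Fin J → List Bool)
    {x y : Fin (R + 1)} (hxy : x ≠ y) (v : Reg Γ R) {a b : ℕ} (ha : a < w.length)
    (hb : b < w.length) :
    RunLE (.seq (moveL x) (moveL y)) v (conf w (place h x y (a + 1) (b + 1)) d m)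
      { v with buf := some w[b] } (conf w (place h x y a b) d m) 4 := by
  have e1 : place h x y (a + 1) (b + 1) x = a + 1 := by simp [place, hxy]
  have e2 : Function.update (place h x y (a + 1) (b + 1)) x a y = b + 1 := by
    simp [place, hxy.symm]
  have := (runLE_moveL w (place h x y (a + 1) (b + 1)) d m x v a e1 ha).seq
    (runLE_moveL w _ d m y _ b e2 hb)
  have e3 : Function.update (Function.update (place h x y (a + 1) (b + 1)) x a) y b =
      place h x y a b := by
    unfold place
    rw [Function.update_comm hxy.symm, Function.update_idem, Function.update_idem]
  rwa [e3] at this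

theorem runLE_push_tmp (w : List Γ) (h : Fin (R + 1) → ℕ) (d : ℕ) (m : Fin J → List Bool)
    (v : Reg Γ R) :
    RunLE (.push .tmp fun _ => default) v (conf w h d m) v (conf w h (d + 1) m) 1 := by
  refine runLE_congr (RunLE.push _ _ _ _) rfl ?_
  simp [conf, update_tmp, store, List.replicate_succ]

/-- The scan from the positions `a` and `b` stops after some number `k` of moves, which is on the
counter.  The blocks behind the two positions are equal if and only if none of the two letters that
stop the scan has property `s`. -/
theorem runLE_scan [DecidableEq Γ] (s : Γ → Bool) (w : List Γ) (h : Fin (R + 1) → ℕ)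
    (m : Fin J → List Bool) {x y : Fin (R + 1)} (hxy : x ≠ y) :
    ∀ (n a b d : ℕ) (v : Reg Γ R), n + a = w.length → b ≤ w.length →
      v.buf = w[a]? → v.buf' = w[b]? →
      ∃ (v' : Reg Γ R) (k : ℕ), RunLE (scan s x y) v (conf w (place h x y a b) d m) v'
        (conf w (place h x y (a + k) (b + k)) (d + k) m) (8 * n + 1) ∧ v'.acc = v.acc ∧
        a + k ≤ w.length ∧ b + k ≤ w.length ∧
        ((!v'.buf.any s && !v'.buf'.any s) =
          decide ((w.drop a).takeWhile s = (w.drop b).takeWhile s)) := by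
  intro n
  induction n with
  | zero =>
    intro a b d v hn hb h1 h2
    have hn' : a = w.length := by omega
    refine ⟨v, 0, RunLE.loop_false ?_, rfl, by omega, by omega, ?_⟩
    · simp [agree, h1, hn']
    · subst hn'
      rw [h1, h2]
      by_cases hb' : b < w.length
      · rw [List.drop_eq_getElem_cons hb', List.takeWhile_cons]
        by_cases hs : s w[b] <;> simp [hs, hb']
      · simp [hb', show w.length ≤ b by omega]
  | succ n ih =>
    intro a b d v hn hb h1 h2
    have ha : a < w.length := by omega
    have h1' : v.buf = some w[a] := by rw [h1]; simp [ha]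
    by_cases hag : agree s v = true
    · have hsb : s w[a] = true ∧ v.buf' = some w[a] := by
        simp only [agree, h1', Option.any_some, Bool.and_eq_true, decide_eq_true_eq] at hag
        exact ⟨hag.1, hag.2.symm⟩
      have hb' : b < w.length := by
        by_contra hb'
        rw [h2, List.getElem?_eq_none (by omega)] at hsb
        simp at hsb
      have hwb : w[b] = w[a] := by
        have := hsb.2
        rw [h2] at this
        simpa [hb'] using this
      have hpx : place h x y (a + 1) (b + 1) x = a + 1 := by simp [place, hxy]
      have hpy : place h x y (a + 1) (b + 1) y = b + 1 := by simp [place]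
      have hp := runLE_peeks w (place h x y (a + 1) (b + 1)) (d + 1) m x y
        { v with buf := some w[b] }
      rw [hpx, hpy] at hp
      obtain ⟨v', k, hrun, hacc, hk1, hk2, hres⟩ := ih (a + 1) (b + 1) (d + 1)
        { v with buf := w[a + 1]?, buf' := w[b + 1]? } (by omega) (by omega) rfl rfl
      obtain ⟨t1, ht1, r1⟩ := runLE_move_both w h d m hxy v ha hb'
      -- composition is reassociated so that the two moves form one block
      have hbody : RunLE (.seq (moveR x) (.seq (moveR y)
          (.seq (.push .tmp fun _ => default) (peeks x y)))) v (conf w (place h x y a b) d m)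
          { v with buf := w[a + 1]?, buf' := w[b + 1]? }
          (conf w (place h x y (a + 1) (b + 1)) (d + 1) m) 7 := by
        cases r1 with
        | seq ra rb =>
          exact (RunLE.seq ⟨_, le_rfl, ra⟩ (RunLE.seq ⟨_, le_rfl, rb⟩
            ((runLE_push_tmp w _ d m _).seq hp))).mono (by omega)
      refine ⟨v', k + 1, ?_, hacc, by omega, by omega, ?_⟩
      · have := RunLE.loop_true (p := agree s) hag hbody hrun
        rw [show a + (k + 1) = a + 1 + k by omega, show b + (k + 1) = b + 1 + k by omega,
          show d + (k + 1) = d + 1 + k by omega]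
        exact this.mono (by omega)
      · rw [hres, List.drop_eq_getElem_cons ha, List.drop_eq_getElem_cons hb', hwb,
          List.takeWhile_cons, List.takeWhile_cons]
        simp [hsb.1]
    · refine ⟨v, 0, (RunLE.loop_false (by simpa using hag)).mono (by omega), rfl, by omega,
        by omega, ?_⟩
      rw [List.drop_eq_getElem_cons ha, List.takeWhile_cons, h1', h2]
      by_cases hb' : b < w.length
      · rw [List.drop_eq_getElem_cons hb', List.takeWhile_cons]
        have h2' : v.buf' = some w[b] := by rw [h2]; simp [hb']
        simp only [agree, h1', h2'] at hag
        by_cases hs : s w[a] <;> by_cases hs' : s w[b] <;> simp_all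
      · rw [List.drop_of_length_le (i := b) (by omega)]
        by_cases hs : s w[a] <;> simp [hs, hb']

/-- Undo the moves that are counted on the scratch stack. -/
def rewind (x y : Fin (R + 1)) : RCmd Γ R J :=
  .seq (.peek .tmp fun s o => { s with buf := o })
    (.loop (fun s => s.buf.isSome) (.seq (.pop .tmp fun s _ => s)
      (.seq (moveL x) (.seq (moveL y) (.peek .tmp fun s o => { s with buf := o })))))

theorem runLE_peek_tmp (w : List Γ) (h : Fin (R + 1) → ℕ) (d : ℕ) (m : Fin J → List Bool)
    (v : Reg Γ R) :
    RunLE (.peek .tmp fun s o => { s with buf := o }) v (conf w h d m)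
      { v with buf := (List.replicate d default).head? } (conf w h d m) 1 := by
  exact runLE_congr (RunLE.peek _ _ _ _) rfl rfl

theorem runLE_rewind (w : List Γ) (h : Fin (R + 1) → ℕ) (m : Fin J → List Bool)
    {x y : Fin (R + 1)} (hxy : x ≠ y) (d a b : ℕ) (v : Reg Γ R) (ha : a + d ≤ w.length)
    (hb : b + d ≤ w.length) :
    ∃ v', RunLE (rewind x y) v (conf w (place h x y (a + d) (b + d)) d m) v'
      (conf w (place h x y a b) 0 m) (7 * d + 2) ∧ v'.acc = v.acc ∧ v'.res = v.res := by
  suffices H : ∀ (d : ℕ) (v : Reg Γ R), a + d ≤ w.length → b + d ≤ w.length →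
      v.buf = (List.replicate d default).head? →
      ∃ v', RunLE (.loop (fun s => s.buf.isSome) (.seq (.pop .tmp fun s _ => s)
        (.seq (moveL x) (.seq (moveL y) (.peek .tmp fun s o => { s with buf := o })))))
        v (conf w (place h x y (a + d) (b + d)) d m) v' (conf w (place h x y a b) 0 m)
        (7 * d + 1) ∧ v'.acc = v.acc ∧ v'.res = v.res by
    obtain ⟨v', hrun, h1, h2⟩ := H d { v with buf := (List.replicate d default).head? } ha hb rfl
    exact ⟨v', ((runLE_peek_tmp w _ d m v).seq hrun).mono (by omega), h1, h2⟩
  intro d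
  induction d with
  | zero =>
    intro v _ _ hv
    exact ⟨v, RunLE.loop_false (by simp [hv]), rfl, rfl⟩
  | succ d ih =>
    intro v ha hb hv
    obtain ⟨v', hrun, h1, h2⟩ := ih
      { v with buf := (List.replicate d default).head? } (by omega) (by omega) rfl
    refine ⟨v', ?_, h1, h2⟩
    have hpop : RunLE (.pop .tmp fun s _ => s) v
        (conf w (place h x y (a + (d + 1)) (b + (d + 1))) (d + 1) m) v
        (conf w (place h x y (a + (d + 1)) (b + (d + 1))) d m) 1 := by
      refine runLE_congr (RunLE.pop _ _ _ _) rfl ?_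
      simp [conf, update_tmp, store, List.replicate_succ]
    obtain ⟨t1, ht1, r1⟩ := runLE_move_both_left w h d m hxy v (a := a + d) (b := b + d)
      (by omega) (by omega)
    have hpk := runLE_peek_tmp w (place h x y (a + d) (b + d)) d m
      { v with buf := some w[b + d] }
    cases r1 with
    | seq ra rb =>
      have hbody := hpop.seq (RunLE.seq ⟨_, le_rfl, ra⟩ (RunLE.seq ⟨_, le_rfl, rb⟩ hpk))
      have := RunLE.loop_true (p := fun s => s.buf.isSome)
        (by simp [hv, List.replicate_succ]) hbody hrun
      exact this.mono (by omega)

/-- The comparison of the blocks of letters behind two different registers. -/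
def sameCmd [DecidableEq Γ] (s : Γ → Bool) (x y : Fin (R + 1)) : RCmd Γ R J :=
  .seq (.seq (moveR x) (moveR y)) (.seq (peeks x y) (.seq (scan s x y)
    (.seq (.load fun v => { v with res := !v.buf.any s && !v.buf'.any s })
      (.seq (rewind x y) (.seq (moveL x) (moveL y))))))

/-- The comparison restores the positions of the registers, which are first moved one step to the
right because the blocks start behind the given positions. -/
theorem runLE_sameCmd [DecidableEq Γ] (s : Γ → Bool) (w : List Γ) (h : Fin (R + 1) → ℕ)
    (m : Fin J → List Bool) {x y : Fin (R + 1)} (hxy : x ≠ y) (v : Reg Γ R) (hx : h x < w.length)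
    (hy : h y < w.length) :
    ∃ v', RunLE (sameCmd s x y) v (conf w h 0 m) v' (conf w h 0 m) (15 * w.length + 15) ∧
      v'.acc = v.acc ∧ v'.res =
        decide ((w.drop (h x + 1)).takeWhile s = (w.drop (h y + 1)).takeWhile s) := by
  have hh : place h x y (h x) (h y) = h := by simp [place]
  have r1 := runLE_move_both w h 0 m hxy v hx hy
  rw [hh] at r1
  have r2 := runLE_peeks w (place h x y (h x + 1) (h y + 1)) 0 m x y { v with buf := some w[h y] }
  rw [show place h x y (h x + 1) (h y + 1) x = h x + 1 by simp [place, hxy],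
    show place h x y (h x + 1) (h y + 1) y = h y + 1 by simp [place]] at r2
  obtain ⟨v1, k, r3, hacc, hk1, hk2, hres⟩ := runLE_scan s w h m hxy (w.length - (h x + 1))
    (h x + 1) (h y + 1) 0 { v with buf := w[h x + 1]?, buf' := w[h y + 1]? } (by omega) (by omega)
    rfl rfl
  rw [Nat.zero_add] at r3
  obtain ⟨v2, r4, hacc2, hres2⟩ := runLE_rewind w h m hxy k (h x + 1) (h y + 1)
    { v1 with res := !v1.buf.any s && !v1.buf'.any s } hk1 hk2
  have r5 := runLE_move_both_left w h 0 m hxy v2 hx hy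
  rw [hh] at r5
  refine ⟨_, (r1.seq (r2.seq (r3.seq ((RunLE.load _ _ _).seq (r4.seq r5))))).mono ?_, ?_, ?_⟩
  · omega
  · exact hacc2.trans hacc
  · exact hres2.trans hres

end Compile

/-! ### Running times of compiled programs -/

namespace Compile

open Cmd (RunLE)

theorem ofNat_inj {R a b : ℕ} (ha : a ≤ R) (hb : b ≤ R)
    (h : Fin.ofNat (R + 1) a = Fin.ofNat (R + 1) b) : a = b := by
  have := congrArg Fin.val h
  simpa [Fin.ofNat, Nat.mod_eq_of_lt (Nat.lt_succ_of_le ha),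
    Nat.mod_eq_of_lt (Nat.lt_succ_of_le hb)] using this

variable {Γ : Type} [Inhabited Γ] {R J : ℕ}

theorem runLE_peek_right (w : List Γ) (h : Fin (R + 1) → ℕ) (m : Fin J → List Bool)
    (i : Fin (R + 1)) (v : Reg Γ R) :
    RunLE (.peek (.right i) fun v o => { v with buf := o }) v (conf w h 0 m)
      { v with buf := w[h i]? } (conf w h 0 m) 1 :=
  runLE_congr (RunLE.peek _ _ _ _) (by simp [conf, store, List.head?_drop]) rfl

theorem runLE_peek_left (w : List Γ) (h : Fin (R + 1) → ℕ) (m : Fin J → List Bool)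
    (i : Fin (R + 1)) (v : Reg Γ R) :
    RunLE (.peek (.left i) fun v o => { v with buf := o }) v (conf w h 0 m)
      { v with buf := (w.take (h i)).getLast? } (conf w h 0 m) 1 :=
  runLE_congr (RunLE.peek _ _ _ _) (by simp [conf, store]) rfl

/-- The loop that brings register `i` back to the left end. -/
theorem runLE_return (w : List Γ) (h : Fin (R + 1) → ℕ) (m : Fin J → List Bool)
    (i : Fin (R + 1)) : ∀ (k : ℕ) (v : Reg Γ R), k ≤ w.length → v.buf = (w.take k).getLast? →
    ∃ v', RunLE (.loop (fun v => v.buf.isSome)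
        (.seq (moveL i) (.peek (.left i) fun v o => { v with buf := o }))) v
        (conf w (Function.update h i k) 0 m) v' (conf w (Function.update h i 0) 0 m) (4 * k + 1) ∧
      v'.acc = v.acc := by
  intro k
  induction k with
  | zero => exact fun v _ hv => ⟨v, RunLE.loop_false (by simp [hv]), rfl⟩
  | succ k ih =>
    intro v hk hv
    have r1 := runLE_moveL w (Function.update h i (k + 1)) 0 m i v k (by simp) (by omega)
    rw [Function.update_idem] at r1
    have r2 := runLE_peek_left w (Function.update h i k) m i { v with buf := some w[k] }
    rw [Function.update_self] at r2
    obtain ⟨v', r3, hacc⟩ := ih { v with buf := (w.take k).getLast? } (by omega) rfl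
    refine ⟨v', ?_, hacc⟩
    have := RunLE.loop_true (p := fun v => v.buf.isSome) (by
      rw [hv, List.take_add_one, List.getElem?_eq_getElem (by omega)]
      simp
      rintro rfl
      simp at hk) (r1.seq r2) r3
    exact this.mono (by omega)

variable [DecidableEq Γ]

/-- The program of the machine for a loop program.  The register `i` of the loop program is the
machine register `i` (modulo the number of registers, which is never reached). -/
def compile (R : ℕ) : {n : ℕ} → Prog Γ J n → RCmd Γ R J
  | _, .const b => .load fun v => { v with res := b }
  | _, .letter s x => .peek (.right (Fin.ofNat (R + 1) x)) fun v o => { v with res := o.any s }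
  | _, .same s x y =>
      if x = y then .load fun v => { v with res := true }
      else sameCmd s (Fin.ofNat (R + 1) x) (Fin.ofNat (R + 1) y)
  | _, .ite c t f => .seq (compile R c) (.ite (fun v => v.res) (compile R t) (compile R f))
  | n, .any φ =>
      let i := Fin.ofNat (R + 1) n
      .seq (.load fun v => { v with acc := Function.update v.acc i false })
        (.seq (.peek (.right i) fun v o => { v with buf := o })
        (.seq (.loop (fun v => v.buf.isSome) (.seq (compile R φ)
          (.seq (.load fun v => { v with acc := Function.update v.acc i (v.acc i || v.res) })
            (.seq (moveR i) (.peek (.right i) fun v o => { v with buf := o })))))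
        (.seq (.peek (.left i) fun v o => { v with buf := o })
        (.seq (.loop (fun v => v.buf.isSome)
          (.seq (moveL i) (.peek (.left i) fun v o => { v with buf := o })))
        (.load fun v => { v with res := v.acc i })))))
  | _, .pop j => .pop (.mem j) fun v o => { v with res := o.getD false }
  | _, .push j b => .seq (.push (.mem j) fun _ => b) (.load fun v => { v with res := b })

/-- The positions of the machine registers: those that are not in use are at the left end. -/
def pos {N n : ℕ} (e : Fin n → Fin N) (i : Fin (R + 1)) : ℕ :=
  if h : i.1 < n then (e ⟨i, h⟩).1 else 0

theorem pos_ofNat {N n : ℕ} (e : Fin n → Fin N) (x : Fin n) (hn : n ≤ R) :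
    pos (R := R) e (Fin.ofNat (R + 1) x) = e x := by
  have : x.1 % (R + 1) = x.1 := Nat.mod_eq_of_lt (by omega)
  simp [pos, this]

theorem pos_snoc {N n : ℕ} (e : Fin n → Fin N) (i : Fin N) (hn : n ≤ R) :
    pos (R := R) (Fin.snoc (α := fun _ : Fin (n + 1) => Fin N) e i) =
      Function.update (pos e) (Fin.ofNat (R + 1) n) i.1 := by
  have hm : n % (R + 1) = n := Nat.mod_eq_of_lt (by omega)
  funext k
  rcases eq_or_ne k (Fin.ofNat (R + 1) n) with rfl | hk
  · simp [pos, hm, Fin.snoc]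
  · rw [Function.update_of_ne hk]
    have hk' : k.1 ≠ n := fun h => hk (by ext; simp [h, hm])
    unfold pos
    by_cases h : k.1 < n
    · simp [h, Nat.lt_succ_of_lt h, Fin.snoc]
    · rw [dif_neg h, dif_neg (by omega)]

/-- The loop for `any φ`, from position `k` on.  The hypothesis `ih` says that the body is correct; the
register `n` runs through the positions, and `acc` collects the disjunction of the results.  The
registers of the enclosing loops and their partial disjunctions are preserved. -/
theorem fold_any_spec {n : ℕ} (φ : Prog Γ J (n + 1)) (hn : n ≤ R) (w : List Γ)
    (e : Fin n → Fin w.length) (T : ℕ)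
    (ih : ∀ (e : Fin (n + 1) → Fin w.length) (m : Fin J → List Bool) (v : Reg Γ R),
      ∃ v', RunLE (compile R φ) v (conf w (pos e) 0 m) v' (conf w (pos e) 0 (φ.eval w e m).2) T ∧
        v'.res = (φ.eval w e m).1 ∧
        ∀ i < n + 1, v'.acc (Fin.ofNat (R + 1) i) = v.acc (Fin.ofNat (R + 1) i)) :
    ∀ (d k : ℕ) (m : Fin J → List Bool) (v : Reg Γ R), k + d = w.length → v.buf = w[k]? →
      let r := ((List.finRange w.length).drop k).foldl (fun a i =>
        let r := φ.eval w (Fin.snoc (α := fun _ : Fin (n + 1) => Fin w.length) e i) a.2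
        (a.1 || r.1, r.2)) (v.acc (Fin.ofNat (R + 1) n), m)
      ∃ v', RunLE (.loop (fun v => v.buf.isSome) (.seq (compile R φ)
          (.seq (.load fun v => { v with
              acc := Function.update v.acc (Fin.ofNat (R + 1) n)
                (v.acc (Fin.ofNat (R + 1) n) || v.res) })
            (.seq (moveR (Fin.ofNat (R + 1) n))
              (.peek (.right (Fin.ofNat (R + 1) n)) fun v o => { v with buf := o })))))
        v (conf w (Function.update (pos e) (Fin.ofNat (R + 1) n) k) 0 m) v'
        (conf w (Function.update (pos e) (Fin.ofNat (R + 1) n) w.length) 0 r.2)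
        (d * (T + 5) + 1) ∧ v'.acc (Fin.ofNat (R + 1) n) = r.1 ∧
        ∀ i < n, v'.acc (Fin.ofNat (R + 1) i) = v.acc (Fin.ofNat (R + 1) i) := by
  intro d
  induction d with
  | zero =>
    intro k m v hk hv
    have hk' : k = w.length := by omega
    subst hk'
    rw [List.drop_of_length_le (by simp)]
    exact ⟨v, (RunLE.loop_false (by simp [hv])).mono (by omega), rfl, fun _ _ => rfl⟩
  | succ d ihd =>
    intro k m v hk hv
    have hkw : k < w.length := by omega
    obtain ⟨v1, r1, hres1, hacc1⟩ :=
      ih (Fin.snoc (α := fun _ : Fin (n + 1) => Fin w.length) e ⟨k, hkw⟩) m v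
    rw [pos_snoc e _ hn] at r1
    set i := Fin.ofNat (R + 1) n with hi
    set m1 := (φ.eval w (Fin.snoc (α := fun _ : Fin (n + 1) => Fin w.length) e ⟨k, hkw⟩) m).2
      with hm1
    set v2 : Reg Γ R := { v1 with acc := Function.update v1.acc i (v1.acc i || v1.res) } with hv2
    have r2 : RunLE (.load fun v =>
        { v with acc := Function.update v.acc i (v.acc i || v.res) } : RCmd Γ R J)
        v1 (conf w (Function.update (pos e) i k) 0 m1) v2
        (conf w (Function.update (pos e) i k) 0 m1) 1 := RunLE.load _ _ _
    have r3 := runLE_moveR w (Function.update (pos e) i k) 0 m1 i v2 (by simpa using hkw)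
    simp only [Function.update_idem, Function.update_self] at r3
    have r4 := runLE_peek_right w (Function.update (pos e) i (k + 1)) m1 i
      { v2 with buf := some w[k] }
    rw [Function.update_self] at r4
    obtain ⟨v', r5, hacc', hacc''⟩ := ihd (k + 1) m1 { v2 with buf := w[k + 1]? } (by omega) rfl
    have hfold : ((List.finRange w.length).drop k) =
        ⟨k, hkw⟩ :: (List.finRange w.length).drop (k + 1) := by
      rw [List.drop_eq_getElem_cons (by simpa using hkw)]
      simp
    have hai : v2.acc i = (v.acc i || (φ.eval w
        (Fin.snoc (α := fun _ : Fin (n + 1) => Fin w.length) e ⟨k, hkw⟩) m).1) := by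
      rw [hv2]
      simp only [Function.update_self]
      rw [hacc1 n (by omega), hres1]
    refine ⟨v', ?_, ?_, ?_⟩
    · rw [hfold, List.foldl_cons]
      simp only at r5 ⊢
      rw [hai] at r5
      have := RunLE.loop_true (p := fun v : Reg Γ R => v.buf.isSome) (by simp [hv, hkw])
        (r1.seq (r2.seq (r3.seq r4))) r5
      exact this.mono (by ring_nf; omega)
    · rw [hfold, List.foldl_cons, hacc']
      simp only
      rw [hai]
    · intro j hj
      rw [hacc'' j hj]
      have : Fin.ofNat (R + 1) j ≠ i := fun h => by
        have := ofNat_inj (R := R) (by omega) hn h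
        omega
      simp only [hv2, Function.update_of_ne this]
      exact hacc1 j (by omega)

/-- The machine program of a loop program computes its value in polynomial time, and does not touch
the partial disjunctions of the enclosing loops. -/
theorem runLE_compile {n : ℕ} (φ : Prog Γ J n) (hR : φ.width ≤ R) :
    ∃ p : Polynomial ℕ, ∀ (w : List Γ) (e : Fin n → Fin w.length) (m : Fin J → List Bool)
      (v : Reg Γ R), ∃ v', RunLE (compile R φ) v (conf w (pos e) 0 m) v'
        (conf w (pos e) 0 (φ.eval w e m).2) (p.eval w.length) ∧ v'.res = (φ.eval w e m).1 ∧
        ∀ i < n, v'.acc (Fin.ofNat (R + 1) i) = v.acc (Fin.ofNat (R + 1) i) := by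
  induction φ with
  | const b =>
    refine ⟨1, fun w e m v => ⟨_, (RunLE.load _ _ _).mono (by simp), rfl, fun _ _ => rfl⟩⟩
  | letter s x =>
    refine ⟨1, fun w e m v => ⟨_, (RunLE.peek _ _ _ _).mono (by simp), ?_, fun _ _ => rfl⟩⟩
    simp only [conf, store, List.head?_drop, pos_ofNat e x hR, Prog.eval]
    simp
  | @same n s x y =>
    by_cases hxy : x = y
    · refine ⟨1, fun w e m v => ⟨{ v with res := true }, ?_, ?_, fun _ _ => rfl⟩⟩
      · simp only [compile, hxy, if_true]
        exact (RunLE.load _ _ _).mono (by simp)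
      · simp [Prog.eval, hxy]
    · refine ⟨.C 15 * .X + .C 15, fun w e m v => ?_⟩
      have hne : Fin.ofNat (R + 1) x.1 ≠ Fin.ofNat (R + 1) y.1 := fun h =>
        hxy (Fin.ext (ofNat_inj (x.2.le.trans hR) (y.2.le.trans hR) h))
      obtain ⟨v', h1, h2, h3⟩ := runLE_sameCmd s w (pos (R := R) e) m hne v
        (by rw [pos_ofNat e x hR]; exact (e x).2) (by rw [pos_ofNat e y hR]; exact (e y).2)
      refine ⟨v', ?_, ?_, fun _ _ => by rw [h2]⟩
      · simp only [compile, hxy, if_false]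
        exact h1.mono (by simp)
      · rw [h3, pos_ofNat e x hR, pos_ofNat e y hR]
        rfl
  | ite c t f ihc iht ihf =>
    simp only [Prog.width, sup_le_iff] at hR
    obtain ⟨pc, hc⟩ := ihc hR.1
    obtain ⟨pt, ht⟩ := iht hR.2.1
    obtain ⟨pf, hf⟩ := ihf hR.2.2
    refine ⟨pc + pt + pf + 1, fun w e m v => ?_⟩
    obtain ⟨v1, r1, hres1, hacc1⟩ := hc w e m v
    by_cases hb : (c.eval w e m).1 = true
    · obtain ⟨v2, r2, hres2, hacc2⟩ := ht w e (c.eval w e m).2 v1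
      refine ⟨v2, ?_, ?_, fun i hi => by rw [hacc2 i hi, hacc1 i hi]⟩
      · have := r1.seq (RunLE.ite_true (p := fun v : Reg Γ R => v.res) (d := compile R f)
          (by rw [hres1, hb]) r2)
        simp only [Prog.eval, hb, if_true]
        exact this.mono (by simp; omega)
      · simp only [Prog.eval, hb, if_true, hres2]
    · obtain ⟨v2, r2, hres2, hacc2⟩ := hf w e (c.eval w e m).2 v1
      refine ⟨v2, ?_, ?_, fun i hi => by rw [hacc2 i hi, hacc1 i hi]⟩
      · have := r1.seq (RunLE.ite_false (p := fun v : Reg Γ R => v.res) (c := compile R t)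
          (by rw [hres1]; simpa using hb) r2)
        simp only [Prog.eval, hb]
        exact this.mono (by simp; omega)
      · simp only [Prog.eval, hb, hres2]
        rfl
  | @any n φ ih =>
    have hn : n ≤ R := (Nat.le_succ n).trans (φ.le_width.trans hR)
    obtain ⟨p, hp⟩ := ih hR
    refine ⟨.X * (p + 9) + 6, fun w e m v => ?_⟩
    set i := Fin.ofNat (R + 1) n with hi
    have hpe : Function.update (pos e) i 0 = pos e := by
      rw [Function.update_eq_self_iff]
      have hm : n % (R + 1) = n := Nat.mod_eq_of_lt (by omega)
      simp [pos, hi, hm]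
    set v1 : Reg Γ R := { v with acc := Function.update v.acc i false } with hv1
    have r1 : RunLE (.load fun v => { v with acc := Function.update v.acc i false } : RCmd Γ R J)
        v (conf w (pos e) 0 m) v1 (conf w (pos e) 0 m) 1 := RunLE.load _ _ _
    have r2 := runLE_peek_right w (pos e) m i v1
    have hpi : pos e i = 0 := by
      have := congrFun hpe i
      rw [Function.update_self] at this
      exact this.symm
    rw [hpi] at r2
    obtain ⟨v2, r3, hres3, hacc3⟩ := fold_any_spec φ hn w e (p.eval w.length) (hp w) w.length 0 m
      { v1 with buf := w[0]? } (by omega) rfl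
    rw [hpe] at r3
    have hfold : (((List.finRange w.length).drop 0).foldl (fun a i =>
        let r := φ.eval w (Fin.snoc (α := fun _ : Fin (n + 1) => Fin w.length) e i) a.2
        (a.1 || r.1, r.2)) (v1.acc i, m)) = (Prog.any φ).eval w e m := by
      simp [Prog.eval, hv1]
    simp only at r3 hres3
    rw [← hi, hfold] at r3 hres3
    set m1 := ((Prog.any φ).eval w e m).2 with hm1
    have r4 := runLE_peek_left w (Function.update (pos e) i w.length) m1 i v2
    rw [Function.update_self] at r4
    obtain ⟨v3, r5, hacc5⟩ := runLE_return w (pos e) m1 i w.length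
      { v2 with buf := (w.take w.length).getLast? } le_rfl rfl
    rw [hpe] at r5
    have r6 : RunLE (.load fun v => { v with res := v.acc i } : RCmd Γ R J) v3 (conf w (pos e) 0 m1)
        { v3 with res := v3.acc i } (conf w (pos e) 0 m1) 1 := RunLE.load _ _ _
    refine ⟨_, (r1.seq (r2.seq (r3.seq (r4.seq (r5.seq r6))))).mono ?_, ?_, ?_⟩
    · simp
      ring_nf
      omega
    · simp only [hacc5, hres3]
    · intro j hj
      simp only [hacc5]
      rw [hacc3 j hj]
      have : Fin.ofNat (R + 1) j ≠ i := fun h => by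
        have := ofNat_inj (R := R) (by omega) hn h
        omega
      simp only [hv1, Function.update_of_ne this]
  | pop j =>
    refine ⟨1, fun w e m v => ⟨{ v with res := (m j).head?.getD false }, ?_, rfl, fun _ _ => rfl⟩⟩
    refine runLE_congr ((RunLE.pop _ _ _ _).mono (by simp)) rfl ?_
    simp [conf, update_mem, store, Prog.eval]
  | push j b =>
    refine ⟨2, fun w e m v => ⟨{ v with res := b }, ?_, rfl, fun _ _ => rfl⟩⟩
    refine runLE_congr (((RunLE.push _ _ _ _).seq (RunLE.load _ _ _)).mono (by simp)) rfl ?_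
    simp [conf, update_mem, store, Prog.eval]

end Compile

/-! ### Input and output of compiled programs -/

namespace Compile

open Cmd (RunLE)

variable {Γ : Type} {R J : ℕ}

/-- Push the same letter on the right stacks of the registers in `l`. -/
def pushAll (l : List (Fin (R + 1))) (f : Reg Γ R → Γ) : RCmd Γ R J :=
  l.foldr (fun i c => .seq (.push (.right i) f) c) (.load id)

/-- Pop the right stacks of the registers in `l`. -/
def popAll (l : List (Fin (R + 1))) : RCmd Γ R J :=
  l.foldr (fun i c => .seq (.pop (.right i) fun v _ => v) c) (.load id)

theorem runLE_pushAll (f : Reg Γ R → Γ) (inp : List Γ) (out : List Bool) (tmp : List Γ)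
    (B : Fin (R + 1) → List Γ) (m : Fin J → List Bool) (v : Reg Γ R) :
    ∀ (l : List (Fin (R + 1))) (A : Fin (R + 1) → List Γ), l.Nodup →
      RunLE (pushAll l f) v (store inp out tmp A B m) v
        (store inp out tmp (fun i => if i ∈ l then f v :: A i else A i) B m) (l.length + 1) := by
  intro l
  induction l with
  | nil => exact fun A _ => RunLE.load _ _ _
  | cons a l ih =>
    intro A hl
    rw [List.nodup_cons] at hl
    have h := (RunLE.push (.right a) f v (store inp out tmp A B m)).seq (t' := l.length + 1)
      (by rw [update_right]; exact ih _ hl.2)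
    refine runLE_congr (h.mono (by simp; omega)) rfl ?_
    congr 1
    funext i
    rcases eq_or_ne i a with rfl | hi
    · simp [hl.1, store]
    · simp [hi]

theorem runLE_popAll (inp : List Γ) (out : List Bool) (tmp : List Γ)
    (B : Fin (R + 1) → List Γ) (m : Fin J → List Bool) (v : Reg Γ R) :
    ∀ (l : List (Fin (R + 1))) (A : Fin (R + 1) → List Γ), l.Nodup →
      RunLE (popAll l) v (store inp out tmp A B m) v
        (store inp out tmp (fun i => if i ∈ l then (A i).tail else A i) B m) (l.length + 1) := by
  intro l
  induction l with
  | nil => exact fun A _ => RunLE.load _ _ _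
  | cons a l ih =>
    intro A hl
    rw [List.nodup_cons] at hl
    have h := (RunLE.pop (.right a) (fun v _ => v) v (store inp out tmp A B m)).seq
      (t' := l.length + 1) (by rw [update_right]; exact ih _ hl.2)
    refine runLE_congr (h.mono (by simp; omega)) rfl ?_
    congr 1
    funext i
    rcases eq_or_ne i a with rfl | hi
    · simp [hl.1, store]
    · simp [hi]

/-- Write a fixed word in front of the word of every register. -/
def prefixAll (pre : List Γ) : RCmd Γ R J :=
  pre.foldr (fun a c => .seq c (pushAll (List.finRange (R + 1)) fun _ => a)) (.load id)

theorem runLE_prefixAll (B : Fin (R + 1) → List Γ) (m : Fin J → List Bool) (w : List Γ)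
    (v : Reg Γ R) : ∀ pre : List Γ,
      RunLE (prefixAll pre) v (store [] [] [] (fun _ => w) B m) v
        (store [] [] [] (fun _ => pre ++ w) B m) ((R + 2) * pre.length + 1) := by
  intro pre
  induction pre with
  | nil => exact RunLE.load _ _ _
  | cons a pre ih =>
    have h := ih.seq (runLE_pushAll (fun _ => a) [] [] [] B m v
      (List.finRange (R + 1)) (fun _ => pre ++ w) (List.nodup_finRange _))
    refine runLE_congr (h.mono ?_) rfl (by simp)
    simp
    ring_nf
    omega

/-- The initial local state. -/
def reg₀ : Reg Γ R := ⟨false, fun _ => false, none, none⟩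

/-- Empty the right stacks of all registers. -/
def clearAll : RCmd Γ R J :=
  .loop (fun v => v.buf.isSome) (.seq (popAll (List.finRange (R + 1)))
    (.peek (.right 0) fun v o => { v with buf := o }))

theorem runLE_clearAll (B : Fin (R + 1) → List Γ) (m : Fin J → List Bool) :
    ∀ (w : List Γ) (v : Reg Γ R), v.buf = w.head? →
      ∃ v', RunLE clearAll v (store [] [] [] (fun _ => w) B m) v'
        (store [] [] [] (fun _ => []) B m) ((R + 4) * w.length + 1) ∧ v'.res = v.res := by
  intro w
  induction w with
  | nil => exact fun v hv => ⟨v, RunLE.loop_false (by simp [hv]), rfl⟩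
  | cons a w ih =>
    intro v hv
    obtain ⟨v', h, hres⟩ := ih { v with buf := w.head? } rfl
    refine ⟨v', ?_, hres⟩
    have h2 := (runLE_popAll [] [] [] B m v
      (List.finRange (R + 1)) (fun _ => a :: w) (List.nodup_finRange _)).seq
        (RunLE.peek (.right 0) (fun v o => { v with buf := o }) _ _)
    have h1 := runLE_congr (w' := { v with buf := w.head? })
      (T' := store [] [] [] (fun _ => w) B m) h2 (by simp [store]) (by simp)
    have := RunLE.loop_true (p := fun v : Reg Γ R => v.buf.isSome) (by simp [hv]) h1 h
    refine this.mono ?_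
    simp
    ring_nf
    omega

variable [Inhabited Γ]

/-- Move the input, reversed, to the scratch stack. -/
def reverseInput : RCmd Γ R J :=
  .loop (fun v => v.buf.isSome) (.seq (.pop .inp fun v _ => v)
    (.seq (.push .tmp fun v => v.buf.getD default) (.peek .inp fun v o => { v with buf := o })))

theorem runLE_reverseInput (A B : Fin (R + 1) → List Γ) (m : Fin J → List Bool) :
    ∀ (inp tmp : List Γ) (v : Reg Γ R), v.buf = inp.head? →
      ∃ v', RunLE reverseInput v (store inp [] tmp A B m) v'
        (store [] [] (inp.reverse ++ tmp) A B m) (4 * inp.length + 1) := by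
  intro inp
  induction inp with
  | nil => exact fun tmp v hv => ⟨v, RunLE.loop_false (by simp [hv])⟩
  | cons a inp ih =>
    intro tmp v hv
    obtain ⟨v', h⟩ := ih (a :: tmp) { v with buf := inp.head? } rfl
    refine ⟨v', ?_⟩
    have h0 := (RunLE.pop .inp (fun v _ => v) v (store (a :: inp) [] tmp A B m)).seq
      ((RunLE.push .tmp (fun v => v.buf.getD default) _ _).seq
        (RunLE.peek .inp (fun v o => { v with buf := o }) _ _))
    have h1 := runLE_congr (w' := { v with buf := inp.head? })
      (T' := store inp [] (a :: tmp) A B m) h0 (by simp [store])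
      (by simp [update_inp, update_tmp, store, hv])
    have := RunLE.loop_true (p := fun v : Reg Γ R => v.buf.isSome) (by simp [hv]) h1 h
    exact runLE_congr (this.mono (by simp; omega)) rfl (by simp)

/-- Copy the scratch stack, reversed, to all registers. -/
def copyInput : RCmd Γ R J :=
  .loop (fun v => v.buf.isSome) (.seq (.pop .tmp fun v _ => v)
    (.seq (pushAll (List.finRange (R + 1)) fun v => v.buf.getD default)
      (.peek .tmp fun v o => { v with buf := o })))

theorem runLE_copyInput (B : Fin (R + 1) → List Γ) (m : Fin J → List Bool) :
    ∀ (tmp w : List Γ) (v : Reg Γ R), v.buf = tmp.head? →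
      ∃ v', RunLE copyInput v (store [] [] tmp (fun _ => w) B m) v'
        (store [] [] [] (fun _ => tmp.reverse ++ w) B m) ((R + 6) * tmp.length + 1) := by
  intro tmp
  induction tmp with
  | nil => exact fun w v hv => ⟨v, RunLE.loop_false (by simp [hv])⟩
  | cons a tmp ih =>
    intro w v hv
    obtain ⟨v', h⟩ := ih (a :: w) { v with buf := tmp.head? } rfl
    refine ⟨v', ?_⟩
    have h0 := RunLE.pop .tmp (fun v _ => v) v (store (Γ := Γ) [] [] (a :: tmp) (fun _ => w) B m)
    rw [update_tmp] at h0
    have h2 := h0.seq ((runLE_pushAll (fun v => v.buf.getD default) [] [] tmp B m v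
      (List.finRange (R + 1)) (fun _ => w) (List.nodup_finRange _)).seq
        (RunLE.peek .tmp (fun v o => { v with buf := o }) _ _))
    have h1 := runLE_congr (w' := { v with buf := tmp.head? })
      (T' := store [] [] tmp (fun _ => a :: w) B m) h2 (by simp [store]) (by simp [hv])
    have := RunLE.loop_true (p := fun v : Reg Γ R => v.buf.isSome) (by simp [hv]) h1 h
    refine runLE_congr (this.mono ?_) rfl (by simp)
    simp
    ring_nf
    omega

theorem conf_closed {w : List Γ} (e : Fin 0 → Fin w.length) (m : Fin J → List Bool) :
    conf w (pos (R := R) e) 0 m = store [] [] [] (fun _ => w) (fun _ => []) m := by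
  unfold conf
  congr 1

variable [DecidableEq Γ]

/-- Distribute the input, behind the fixed word `pre`, to all registers, execute the loop program,
clear the registers and write the result to the output. -/
def fullCmd (R : ℕ) (pre : List Γ) (φ : Prog Γ J 0) : RCmd Γ R J :=
  .seq (.peek .inp fun v o => { v with buf := o }) (.seq reverseInput
    (.seq (.peek .tmp fun v o => { v with buf := o }) (.seq copyInput (.seq (prefixAll pre)
      (.seq (compile R φ) (.seq (.peek (.right 0) fun v o => { v with buf := o }) (.seq clearAll
        (.seq (.push .out fun v => v.res) (.load fun _ => reg₀)))))))))

theorem runLE_fullCmd (pre : List Γ) (φ : Prog Γ J 0) (hR : φ.width ≤ R) :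
    ∃ p : Polynomial ℕ, ∀ (x : List Γ) (b : Bool),
      φ.eval (pre ++ x) Fin.elim0 (fun _ => []) = (b, fun _ => []) →
      RunLE (fullCmd R pre φ) reg₀
        (store x [] [] (fun _ => []) (fun _ => []) (fun _ => [])) reg₀
        (store [] [b] [] (fun _ => []) (fun _ => []) (fun _ => [])) (p.eval x.length) := by
  obtain ⟨p, hp⟩ := runLE_compile φ hR
  refine ⟨.C (2 * R + 14) * (.X + .C pre.length) + p.comp (.X + .C pre.length) + 20,
    fun x b hb => ?_⟩
  have r1 := RunLE.peek .inp (fun (v : Reg Γ R) o => { v with buf := o }) reg₀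
    (store (Γ := Γ) (R := R) (J := J) x [] [] (fun _ => []) (fun _ => []) (fun _ => []))
  obtain ⟨v2, r2⟩ := runLE_reverseInput (R := R) (J := J) (fun _ => []) (fun _ => [])
    (fun _ => []) x [] { reg₀ with buf := x.head? } rfl
  rw [List.append_nil] at r2
  have r3 := RunLE.peek .tmp (fun (v : Reg Γ R) o => { v with buf := o }) v2
    (store (Γ := Γ) (R := R) (J := J) [] [] x.reverse (fun _ => []) (fun _ => []) (fun _ => []))
  obtain ⟨v4, r4⟩ := runLE_copyInput (R := R) (J := J) (fun _ => [])
    (fun _ => []) x.reverse [] { v2 with buf := x.reverse.head? } rfl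
  rw [List.reverse_reverse, List.append_nil] at r4
  have r5 := runLE_prefixAll (R := R) (J := J) (fun _ => []) (fun _ => []) x v4 pre
  obtain ⟨v6, r6, hres6, -⟩ := hp (pre ++ x) Fin.elim0 (fun _ => []) v4
  rw [hb, conf_closed] at r6
  have r7 := RunLE.peek (.right 0) (fun (v : Reg Γ R) o => { v with buf := o }) v6
    (store (Γ := Γ) (R := R) (J := J) [] [] [] (fun _ => pre ++ x) (fun _ => []) (fun _ => []))
  obtain ⟨v8, r8, hres8⟩ := runLE_clearAll (R := R) (J := J) (fun _ => [])
    (fun _ => []) (pre ++ x) { v6 with buf := (pre ++ x).head? } rfl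
  have r9 := RunLE.push .out (fun v : Reg Γ R => v.res) v8
    (store (Γ := Γ) (R := R) (J := J) [] [] [] (fun _ => []) (fun _ => []) (fun _ => []))
  have r10 := RunLE.load (fun _ : Reg Γ R => reg₀) v8 (Function.update
    (store (Γ := Γ) (R := R) (J := J) [] [] [] (fun _ => []) (fun _ => []) (fun _ => []))
    .out [v8.res])
  have := r1.seq (r2.seq (r3.seq (r4.seq (r5.seq (r6.seq (r7.seq (r8.seq (r9.seq r10))))))))
  refine runLE_congr (this.mono ?_) rfl ?_
  · simp [Polynomial.eval_comp]
    rw [Nat.add_comm pre.length x.length]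
    ring_nf
    nlinarith
  · have : v8.res = b := by rw [hres8]; simp only; rw [hres6, hb]
    rw [update_out, this]

end Compile

open Compile in
/-- A predicate that a loop program decides is decidable in polynomial time.  The program may run on
the input behind a fixed word `pre`; the stacks of bits have to be empty at the end, because the
machine model requires all stacks but the output to be empty. -/
theorem Prog.polyTime {α Γ : Type} [Inhabited Γ] [DecidableEq Γ] [Fintype Γ] {J : ℕ}
    (enc : α → List Γ) (f : α → Bool) (pre : List Γ) (φ : Prog Γ J 0)
    (h : ∀ x, φ.eval (pre ++ enc x) Fin.elim0 (fun _ => []) = (f x, fun _ => [])) :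
    PolyTime enc f := by
  obtain ⟨p, hp⟩ := runLE_fullCmd (R := φ.width) pre φ le_rfl
  let c : RCmd Γ φ.width J := fullCmd φ.width pre φ
  let tm : Turing.FinTM2 :=
    { K := StackId φ.width J
      k₀ := .inp
      k₁ := .out
      Γ := StackId.Alph Γ
      Λ := Option c.Lab
      main := some c.entry
      σ := Reg Γ φ.width
      initialState := reg₀
      Γk₀Fin := inferInstanceAs (Fintype Γ)
      m := c.machine }
  have hinit : ∀ s : List Γ, Turing.initList tm s = ⟨some (some c.entry), reg₀,
      store s [] [] (fun _ => []) (fun _ => []) (fun _ => [])⟩ := by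
    intro s
    unfold Turing.initList
    congr 1
    funext k
    cases k <;> rfl
  have hhalt : ∀ s : List Bool, Turing.haltList tm s = ⟨none, reg₀,
      store [] s [] (fun _ => []) (fun _ => []) (fun _ => [])⟩ := by
    intro s
    unfold Turing.haltList
    congr 1
    funext k
    cases k <;> rfl
  refine ⟨{ tm := tm
            inputAlphabet := Equiv.refl Γ
            outputAlphabet := Equiv.refl Bool
            time := p + 1
            outputsFun := fun x => ?_ }⟩
  have hx := hp (enc x) (f x) (h x)
  refine ⟨⟨hx.choose + 1, ?_⟩, ?_⟩
  · have h1 := hx.choose_spec.2.halts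
    have e1 : List.map (Equiv.refl Γ).invFun (enc x) = enc x := List.map_id _
    have e2 : List.map (Equiv.refl Bool).invFun (Computability.encodeBool (f x)) = [f x] := rfl
    refine Eq.trans (congrArg _ ?_) (Eq.trans h1 ?_)
    · exact congrArg some ((congrArg (Turing.initList tm) e1).trans (hinit _))
    · exact congrArg some ((congrArg (Turing.haltList tm) e2).trans (hhalt _)).symm
  · simpa using hx.choose_spec.1

/-! ### Definable predicates and least fixed points -/

/-- All tuples of length `r` over `Fin N`, in lexicographic order. -/
def tuples (N : ℕ) : (r : ℕ) → List (Fin r → Fin N)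
  | 0 => [Fin.elim0]
  | r + 1 => (tuples N r).flatMap fun y =>
      (List.finRange N).map fun i => Fin.snoc (α := fun _ : Fin (r + 1) => Fin N) y i

theorem mem_tuples {N r : ℕ} (y : Fin r → Fin N) : y ∈ tuples N r := by
  induction r with
  | zero => simp [tuples, Subsingleton.elim y Fin.elim0]
  | succ r ih =>
    simp only [tuples, List.mem_flatMap, List.mem_map]
    exact ⟨Fin.init y, ih _, y (Fin.last r), List.mem_finRange _, Fin.snoc_init_self y⟩

theorem length_tuples (N r : ℕ) : (tuples N r).length = N ^ r := by
  induction r with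
  | zero => simp [tuples]
  | succ r ih => simp [tuples, List.length_flatMap, ih, pow_succ]

namespace Prog

variable {Γ : Type} [DecidableEq Γ] {J : ℕ}

/-- One round of a loop: execute `φ` in the environment `e` and update the disjunction. -/
def round {n : ℕ} (φ : Prog Γ J n) (w : List Γ) (a : Bool × (Fin J → List Bool))
    (e : Fin n → Fin w.length) : Bool × (Fin J → List Bool) :=
  (a.1 || (φ.eval w e a.2).1, (φ.eval w e a.2).2)

/-- The disjunction that a loop starts with can be split off. -/
theorem foldl_round {n : ℕ} (φ : Prog Γ J n) (w : List Γ) {β : Type}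
    (f : β → Fin n → Fin w.length) (l : List β) (b : Bool) (m : Fin J → List Bool) :
    l.foldl (fun a i => φ.round w a (f i)) (b, m) =
      (b || (l.foldl (fun a i => φ.round w a (f i)) (false, m)).1,
        (l.foldl (fun a i => φ.round w a (f i)) (false, m)).2) := by
  induction l generalizing b m with
  | nil => simp
  | cons i l ih =>
    rw [List.foldl_cons, List.foldl_cons, round, ih, round, ih (false || _)]
    simp [Bool.or_assoc]

/-- Nested loops over `r` new registers. -/
def exs {n : ℕ} : (r : ℕ) → Prog Γ J (n + r) → Prog Γ J n
  | 0, φ => φ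
  | r + 1, φ => exs r (any φ)

theorem eval_exs {n : ℕ} (r : ℕ) (φ : Prog Γ J (n + r)) (w : List Γ) (e : Fin n → Fin w.length)
    (m : Fin J → List Bool) :
    (exs r φ).eval w e m =
      (tuples w.length r).foldl (fun a y => φ.round w a (Fin.append e y)) (false, m) := by
  induction r generalizing m with
  | zero => simp [exs, tuples, round]
  | succ r ih =>
    rw [exs, ih, tuples, List.foldl_flatMap]
    congr 1
    funext a y
    rw [List.foldl_map]
    obtain ⟨b, m⟩ := a
    have := foldl_round φ w (fun i => Fin.append e
      (Fin.snoc (α := fun _ : Fin (r + 1) => Fin w.length) y i)) (List.finRange w.length) b m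
    refine Eq.trans ?_ this.symm
    have h : ∀ i, Fin.append e (Fin.snoc (α := fun _ : Fin (r + 1) => Fin w.length) y i) =
        Fin.snoc (α := fun _ : Fin (n + r + 1) => Fin w.length) (Fin.append e y) i :=
      fun i => Fin.append_snoc e y i
    simp only [h]
    rfl

/-- Execute `c` and then `d`, with the result of `c`. -/
def andThen {n : ℕ} (c d : Prog Γ J n) : Prog Γ J n :=
  ite c (ite d (const true) (const true)) (ite d (const false) (const false))

theorem eval_andThen {n : ℕ} (c d : Prog Γ J n) (w : List Γ) (e : Fin n → Fin w.length)
    (m : Fin J → List Bool) :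
    (andThen c d).eval w e m = ((c.eval w e m).1, (d.eval w e (c.eval w e m).2).2) := by
  simp only [andThen, eval]
  cases (c.eval w e m).1 <;> simp

/-- The conjunction of the equations between the registers in a list. -/
def eqs {n : ℕ} : List (Fin n × Fin n) → Prog Γ J n
  | [] => const true
  | p :: l => ite (same (fun _ => true) p.1 p.2) (eqs l) (const false)

theorem drop_succ_inj {Γ : Type} {w : List Γ} {x y : Fin w.length} :
    w.drop (x + 1) = w.drop (y + 1) ↔ x = y := by
  refine ⟨fun h => ?_, fun h => by rw [h]⟩
  have := congrArg List.length h
  rw [List.length_drop, List.length_drop] at this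
  ext
  omega

theorem takeWhile_true {Γ : Type} (l : List Γ) : l.takeWhile (fun _ => true) = l := by
  induction l with
  | nil => rfl
  | cons a l ih => simp

theorem eval_eqs {n : ℕ} (l : List (Fin n × Fin n)) (w : List Γ) (e : Fin n → Fin w.length)
    (m : Fin J → List Bool) :
    (eqs l).eval w e m = (decide (∀ p ∈ l, e p.1 = e p.2), m) := by
  induction l with
  | nil => simp [eqs, eval]
  | cons p l ih =>
    simp only [eqs, eval, takeWhile_true, drop_succ_inj, ih]
    by_cases h : e p.1 = e p.2 <;> simp [h]

/-- Move all values of the relation from stack `0` to stack `1`, return the value at the tuple `x`,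
and set this value to true if `b` is true. -/
def shift {n r : ℕ} (x : Fin r → Fin n) (b : Bool) : Prog Γ 3 n :=
  exs r <|
    let same := eqs ((List.finRange r).map fun j => (Fin.natAdd n j, Fin.castAdd r (x j)))
    ite (pop 0) (ite same (push 1 true) (ite (push 1 true) (const false) (const false)))
      (ite same (ite (push 1 b) (const false) (const false)) (push 1 false))

/-- Move all values of the relation back from stack `1` to stack `0`. -/
def unshift {n : ℕ} (r : ℕ) : Prog Γ 3 n :=
  exs r (ite (pop 1) (push 0 true) (push 0 false))

/-- Return the value of the relation at the tuple `x`, and then set it to true if `b` is true. -/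
def access {n r : ℕ} (x : Fin r → Fin n) (b : Bool) : Prog Γ 3 n :=
  andThen (shift x b) (unshift r)

end Prog

open Classical in
/-- The three stacks of bits that represent an `r`-ary relation: the list of its values on all tuples
on stack `0`, and two empty stacks, which serve as working memory during operations. -/
noncomputable def relMem {N r : ℕ} (X : (Fin r → Fin N) → Prop) : Fin 3 → List Bool :=
  ![(tuples N r).map fun y => decide (X y), [], []]

namespace Prog

variable {Γ : Type} [DecidableEq Γ]

theorem update_zero {A B C D : List Bool} : Function.update ![A, B, C] 0 D = ![D, B, C] := by
  funext i; fin_cases i <;> rfl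

theorem update_one {A B C D : List Bool} : Function.update ![A, B, C] 1 D = ![A, D, C] := by
  funext i; fin_cases i <;> rfl

theorem update_two {A B C D : List Bool} : Function.update ![A, B, C] 2 D = ![A, B, D] := by
  funext i; fin_cases i <;> rfl

open Classical in
theorem eval_shift {n r : ℕ} (x : Fin r → Fin n) (b : Bool) (w : List Γ)
    (e : Fin n → Fin w.length) (X : (Fin r → Fin w.length) → Prop) :
    (shift x b).eval w e (relMem X) = (decide (X (e ∘ x)),
      ![[], ((tuples w.length r).map fun y => decide (X y ∨ b = true ∧ y = e ∘ x)).reverse, []]) := by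
  have key : ∀ (T : List (Fin r → Fin w.length)) (A : List Bool) (c : Bool),
      T.foldl (fun a y => (ite (pop 0)
        (ite (eqs ((List.finRange r).map fun j => (Fin.natAdd n j, Fin.castAdd r (x j))))
          (push 1 true) (ite (push 1 true) (const false) (const false)))
        (ite (eqs ((List.finRange r).map fun j => (Fin.natAdd n j, Fin.castAdd r (x j))))
          (ite (push 1 b) (const false) (const false)) (push 1 false)) : Prog Γ 3 (n + r)).round
          w a (Fin.append e y)) (c, ![T.map fun y => decide (X y), A, []]) =
      (c || decide (∃ y ∈ T, X y ∧ y = e ∘ x),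
        ![[], (T.map fun y => decide (X y ∨ b = true ∧ y = e ∘ x)).reverse ++ A, []]) := by
    intro T
    induction T with
    | nil => intro A c; simp
    | cons y T ih =>
      intro A c
      have hy : (∀ p ∈ (List.finRange r).map fun j => (Fin.natAdd n j, Fin.castAdd r (x j)),
          Fin.append e y p.1 = Fin.append e y p.2) ↔ y = e ∘ x := by
        simp [funext_iff]
      rw [List.foldl_cons]
      have h1 : (ite (pop 0)
        (ite (eqs ((List.finRange r).map fun j => (Fin.natAdd n j, Fin.castAdd r (x j))))
          (push 1 true) (ite (push 1 true) (const false) (const false)))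
        (ite (eqs ((List.finRange r).map fun j => (Fin.natAdd n j, Fin.castAdd r (x j))))
          (ite (push 1 b) (const false) (const false)) (push 1 false)) : Prog Γ 3 (n + r)).round
          w (c, ![(y :: T).map fun y => decide (X y), A, []]) (Fin.append e y) =
          (c || decide (X y ∧ y = e ∘ x), ![T.map fun y => decide (X y),
            decide (X y ∨ b = true ∧ y = e ∘ x) :: A, []]) := by
        simp only [round, eval, eval_eqs, hy]
        by_cases h2 : y = e ∘ x
        · subst h2
          by_cases h1 : X (e ∘ x) <;> cases b <;> simp [h1, update_zero, update_one]
        · by_cases h1 : X y <;> simp [h1, h2, update_zero, update_one]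
      have h2 : (X y ∧ y = e ∘ x ∨ ∃ z ∈ T, X z ∧ z = e ∘ x) ↔
          ∃ z ∈ y :: T, X z ∧ z = e ∘ x := by
        simp only [List.mem_cons, exists_eq_or_imp]
      rw [h1, ih, Bool.or_assoc, ← Bool.decide_or]
      exact Prod.ext (congrArg (c || ·) (decide_eq_decide.2 h2)) (by simp)
  have := key (tuples w.length r) [] false
  simp only [shift, eval_exs, relMem, this]
  simp [mem_tuples]

theorem eval_unshift {n r : ℕ} (w : List Γ) (e : Fin n → Fin w.length) (L : List Bool)
    (hL : L.length = w.length ^ r) :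
    ((unshift r : Prog Γ 3 n).eval w e ![[], L.reverse, []]).2 = ![L, [], []] := by
  have key : ∀ (T : List (Fin r → Fin w.length)) (L A : List Bool) (c : Bool),
      L.length = T.length →
      (T.foldl (fun a y => (ite (pop 1) (push 0 true) (push 0 false) : Prog Γ 3 (n + r)).round
          w a (Fin.append e y)) (c, ![A, L, []])).2 = ![L.reverse ++ A, [], []] := by
    intro T
    induction T with
    | nil =>
      intro L A c hL
      simp [List.length_eq_zero_iff.1 hL]
    | cons y T ih =>
      intro L A c hL
      obtain ⟨b, L, rfl⟩ : ∃ b L', L = b :: L' := by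
        cases L with
        | nil => simp at hL
        | cons b L => exact ⟨b, L, rfl⟩
      have h1 : (ite (pop 1) (push 0 true) (push 0 false) : Prog Γ 3 (n + r)).round
          w (c, ![A, b :: L, []]) (Fin.append e y) = (c || b, ![b :: A, L, []]) := by
        simp only [round, eval]
        cases b <;> simp [update_zero, update_one]
      rw [List.foldl_cons, h1, ih _ _ _ (by simpa using hL)]
      simp
  rw [unshift, eval_exs, key _ _ _ _ (by simp [hL, length_tuples])]
  simp

theorem eval_access {n r : ℕ} (x : Fin r → Fin n) (b : Bool) (w : List Γ)
    (e : Fin n → Fin w.length) (X : (Fin r → Fin w.length) → Prop) [Decidable (X (e ∘ x))] :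
    (access x b).eval w e (relMem X) = (decide (X (e ∘ x)),
      relMem fun y => X y ∨ b = true ∧ y = e ∘ x) := by
  classical
  rw [access, eval_andThen, eval_shift, eval_unshift _ _ _ (by simp [length_tuples]), relMem]
  refine Prod.ext (decide_eq_decide.2 Iff.rfl) ?_
  dsimp only
  congr 2
  funext y
  exact decide_eq_decide.2 Iff.rfl

/-- One round of the comparison of positions, at the position in the last register. -/
def ltStep {n : ℕ} (x y : Fin n) : Prog Γ 3 (n + 1) :=
  andThen
    (ite (same (fun _ => true) (Fin.last n) y.castSucc)
      (ite (pop 2) (push 2 true) (push 2 false)) (const false))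
    (ite (same (fun _ => true) (Fin.last n) x.castSucc) (push 2 true) (const false))

/-- The test whether the register `x` is to the left of `y`: a loop over all positions `z` that
keeps on stack `2` whether `x` has been passed. -/
def lt {n : ℕ} (x y : Fin n) : Prog Γ 3 n :=
  ite (push 2 false) (const false)
    (andThen (any (ltStep x y)) (ite (pop 2) (pop 2) (pop 2)))

theorem eval_lt {n : ℕ} (x y : Fin n) (w : List Γ) (e : Fin n → Fin w.length) (A B : List Bool) :
    (lt x y).eval w e ![A, B, []] = (decide (e x < e y), ![A, B, []]) := by
  have key : ∀ (d k : ℕ) (c : Bool), k + d = w.length →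
      ((List.finRange w.length).drop k).foldl (fun a z => (ltStep x y).round w a
        (Fin.snoc (α := fun _ : Fin (n + 1) => Fin w.length) e z))
        (c, ![A, B, if (e x).1 < k then [true, false] else [false]]) =
      (c || decide (e x < e y ∧ k ≤ (e y).1), ![A, B, [true, false]]) := by
    intro d
    induction d with
    | zero =>
      intro k c hk
      have h1 : (e x).1 < k := by have := (e x).2; omega
      have h2 : ¬ k ≤ (e y).1 := by have := (e y).2; omega
      rw [List.drop_of_length_le (by simp; omega)]
      simp [h1, h2]
    | succ d ih =>
      intro k c hk
      have hkw : k < w.length := by omega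
      have hfold : ((List.finRange w.length).drop k) =
          ⟨k, hkw⟩ :: (List.finRange w.length).drop (k + 1) := by
        rw [List.drop_eq_getElem_cons (by simpa using hkw)]
        simp
      have h1 : (ltStep x y).round w
          (c, ![A, B, if (e x).1 < k then [true, false] else [false]])
          (Fin.snoc (α := fun _ : Fin (n + 1) => Fin w.length) e ⟨k, hkw⟩) =
          (c || decide (e x < e y ∧ k = (e y).1),
            ![A, B, if (e x).1 < k + 1 then [true, false] else [false]]) := by
        simp only [round, ltStep, eval_andThen, eval, takeWhile_true, drop_succ_inj]
        simp only [Fin.snoc_last, Fin.snoc_castSucc]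
        by_cases hy : (⟨k, hkw⟩ : Fin w.length) = e y <;>
          by_cases hx : (⟨k, hkw⟩ : Fin w.length) = e x
        · have hx' := congrArg Fin.val hx
          have hy' := congrArg Fin.val hy
          simp only at hx' hy'
          simp [← hx, ← hy, update_two]
        · have hx' : k ≠ (e x).1 := fun h => hx (Fin.ext h)
          have hy' := congrArg Fin.val hy
          simp only at hy'
          rw [decide_eq_true hy, decide_eq_false hx]
          by_cases hlt : (e x).1 < k
          · simp [Fin.lt_def, ← hy', hlt, update_two, Nat.lt_succ_of_lt hlt]
          · simp [Fin.lt_def, ← hy', hlt, update_two, show ¬ (e x).1 < k + 1 by omega]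
        · have hx' := congrArg Fin.val hx
          have hy' : k ≠ (e y).1 := fun h => hy (Fin.ext h)
          simp only at hx'
          rw [decide_eq_false hy, decide_eq_true hx]
          simp [← hx', hy', update_two]
        · have hx' : k ≠ (e x).1 := fun h => hx (Fin.ext h)
          have hy' : k ≠ (e y).1 := fun h => hy (Fin.ext h)
          rw [decide_eq_false hy, decide_eq_false hx]
          have : (e x).1 < k + 1 ↔ (e x).1 < k := by omega
          simp [hy', this]
      rw [hfold, List.foldl_cons, h1, ih (k + 1) _ (by omega), Bool.or_assoc,
        ← Bool.decide_or]
      have : (e x < e y ∧ k = (e y).1 ∨ e x < e y ∧ k + 1 ≤ (e y).1) ↔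
          (e x < e y ∧ k ≤ (e y).1) := by
        rw [← and_or_left]
        constructor <;> rintro ⟨h, h'⟩ <;> exact ⟨h, by omega⟩
      rw [decide_eq_decide.2 this]
  have h := key w.length 0 false (by omega)
  have h' : (any (ltStep x y)).eval w e ![A, B, [false]] =
      (decide (e x < e y), ![A, B, [true, false]]) := by
    simp only [Nat.not_lt_zero, if_false, List.drop_zero] at h
    exact h.trans (by simp)
  have hp : (push 2 false : Prog Γ 3 n).eval w e ![A, B, []] = (false, ![A, B, [false]]) := by
    simp [eval, update_two]
  rw [lt, eval, hp]
  simp only [Bool.false_eq_true, if_false, eval_andThen]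
  rw [h']
  simp [eval, update_two]

end Prog

section Definability

variable {Γ : Type} [DecidableEq Γ] {r : ℕ}

open Classical in
/-- The predicate `P` on words, `r`-ary relations `X` on the positions of the word, and tuples of
positions indexed by `ι` is computed by loop programs, whatever registers hold the positions.  The
programs preserve the representation of `X`. -/
def Def (ι : Type)
    (P : (w : List Γ) → ((Fin r → Fin w.length) → Prop) → (ι → Fin w.length) → Prop) : Prop :=
  ∀ (n : ℕ) (ρ : ι → Fin n), ∃ φ : Prog Γ 3 n, ∀ (w : List Γ) (X : (Fin r → Fin w.length) → Prop)
    (e : Fin n → Fin w.length), φ.eval w e (relMem X) = (decide (P w X (e ∘ ρ)), relMem X)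

namespace Def

variable {ι : Type}
  {P Q : (w : List Γ) → ((Fin r → Fin w.length) → Prop) → (ι → Fin w.length) → Prop}

theorem congr (h : ∀ w X e, P w X e ↔ Q w X e) (hP : Def ι P) : Def ι Q := by
  have : P = Q := by
    funext w X e
    exact propext (h w X e)
  exact this ▸ hP

theorem reindex {κ : Type}
    {P : (w : List Γ) → ((Fin r → Fin w.length) → Prop) → (κ → Fin w.length) → Prop}
    (s : κ → ι) (h : Def κ P) : Def ι fun w X e => P w X fun k => e (s k) :=
  fun n ρ => h n (ρ ∘ s)

theorem const (p : Prop) : Def ι fun (w : List Γ) (_ : (Fin r → Fin w.length) → Prop) _ => p := by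
  classical
  exact fun _ _ => ⟨.const (decide p), fun _ _ _ => Prod.ext (decide_eq_decide.2 Iff.rfl) rfl⟩

theorem letter (s : Γ → Bool) (i : ι) :
    Def ι fun (w : List Γ) (_ : (Fin r → Fin w.length) → Prop) e => s w[e i] = true :=
  fun n ρ => ⟨.letter s (ρ i), fun w X e => by simp [Prog.eval]⟩

theorem same (s : Γ → Bool) (i j : ι) :
    Def ι fun (w : List Γ) (_ : (Fin r → Fin w.length) → Prop) e =>
      (w.drop (e i + 1)).takeWhile s = (w.drop (e j + 1)).takeWhile s :=
  fun n ρ => ⟨.same s (ρ i) (ρ j), fun w X e =>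
    Prod.ext (decide_eq_decide.2 Iff.rfl) rfl⟩

theorem eq (i j : ι) :
    Def ι fun (w : List Γ) (_ : (Fin r → Fin w.length) → Prop) e => e i = e j :=
  (same (fun _ => true) i j).congr fun w X e => by
    rw [Prog.takeWhile_true, Prog.takeWhile_true, Prog.drop_succ_inj]

theorem lt (i j : ι) :
    Def ι fun (w : List Γ) (_ : (Fin r → Fin w.length) → Prop) e => e i < e j :=
  fun n ρ => ⟨.lt (ρ i) (ρ j), fun w X e => by
    rw [relMem, Prog.eval_lt]
    exact Prod.ext (decide_eq_decide.2 Iff.rfl) rfl⟩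

theorem rel (τ : Fin r → ι) :
    Def ι fun (w : List Γ) (X : (Fin r → Fin w.length) → Prop) e => X fun j => e (τ j) := by
  classical
  exact fun n ρ => ⟨.access (ρ ∘ τ) false, fun w X e => by
    rw [Prog.eval_access]
    refine Prod.ext (decide_eq_decide.2 Iff.rfl) ?_
    simp⟩

theorem not (hP : Def ι P) : Def ι fun w X e => ¬ P w X e := by
  classical
  intro n ρ
  obtain ⟨φ, hφ⟩ := hP n ρ
  refine ⟨.ite φ (.const false) (.const true), fun w X e => ?_⟩
  rw [Prog.eval, hφ]
  by_cases h : P w X (e ∘ ρ) <;> simp [h, Prog.eval]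

theorem and (hP : Def ι P) (hQ : Def ι Q) : Def ι fun w X e => P w X e ∧ Q w X e := by
  classical
  intro n ρ
  obtain ⟨φ, hφ⟩ := hP n ρ
  obtain ⟨ψ, hψ⟩ := hQ n ρ
  refine ⟨.ite φ ψ (.const false), fun w X e => ?_⟩
  rw [Prog.eval, hφ]
  by_cases h : P w X (e ∘ ρ) <;> simp [h, Prog.eval, hψ]

theorem or (hP : Def ι P) (hQ : Def ι Q) : Def ι fun w X e => P w X e ∨ Q w X e :=
  (hP.not.and hQ.not).not.congr fun w X e => by tauto

theorem imp (hP : Def ι P) (hQ : Def ι Q) : Def ι fun w X e => P w X e → Q w X e :=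
  (hP.not.or hQ).congr fun w X e => by tauto

theorem iff (hP : Def ι P) (hQ : Def ι Q) : Def ι fun w X e => (P w X e ↔ Q w X e) :=
  ((hP.imp hQ).and (hQ.imp hP)).congr fun w X e => by tauto

theorem exists_fin {k : ℕ} {Q : (w : List Γ) → ((Fin r → Fin w.length) → Prop) →
      (ι → Fin w.length) → (Fin k → Fin w.length) → Prop}
    (hQ : Def (ι ⊕ Fin k) fun w X e => Q w X (fun i => e (.inl i)) fun j => e (.inr j)) :
    Def ι fun w X e => ∃ y : Fin k → Fin w.length, Q w X e y := by
  classical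
  intro n ρ
  obtain ⟨φ, hφ⟩ := hQ (n + k) (Sum.elim (Fin.castAdd k ∘ ρ) (Fin.natAdd n))
  refine ⟨.exs k φ, fun w X e => ?_⟩
  have key : ∀ (T : List (Fin k → Fin w.length)) (b : Bool),
      T.foldl (fun a y => φ.round w a (Fin.append e y)) (b, relMem X) =
        (b || decide (∃ y ∈ T, Q w X (e ∘ ρ) y), relMem X) := by
    intro T
    induction T with
    | nil => intro b; simp
    | cons y T ih =>
      intro b
      have h1 : φ.round w (b, relMem X) (Fin.append e y) =
          (b || decide (Q w X (e ∘ ρ) y), relMem X) := by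
        rw [Prog.round, hφ]
        refine Prod.ext (congrArg (b || ·) (decide_eq_decide.2 ?_)) rfl
        simp only [Function.comp_apply, Sum.elim_inl, Sum.elim_inr, Fin.append_left,
          Fin.append_right]
        exact Iff.rfl
      rw [List.foldl_cons, h1, ih, Bool.or_assoc, ← Bool.decide_or]
      refine Prod.ext (congrArg (b || ·) (decide_eq_decide.2 ?_)) rfl
      simp only [List.mem_cons, exists_eq_or_imp]
  rw [Prog.eval_exs, key]
  refine Prod.ext ?_ rfl
  simp only [Bool.false_or]
  exact decide_eq_decide.2 ⟨fun ⟨y, _, hy⟩ => ⟨y, hy⟩, fun ⟨y, hy⟩ => ⟨y, mem_tuples y, hy⟩⟩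

theorem ex {κ : Type} [Fintype κ] {Q : (w : List Γ) → ((Fin r → Fin w.length) → Prop) →
      (ι → Fin w.length) → (κ → Fin w.length) → Prop}
    (hQ : Def (ι ⊕ κ) fun w X e => Q w X (fun i => e (.inl i)) fun j => e (.inr j)) :
    Def ι fun w X e => ∃ y : κ → Fin w.length, Q w X e y := by
  let σ := Fintype.equivFin κ
  refine congr (fun w X e => ?_) (exists_fin (k := Fintype.card κ)
    (Q := fun w X e y => Q w X e (y ∘ σ)) (hQ.reindex (Sum.map id σ)))
  exact ⟨fun ⟨y, hy⟩ => ⟨_, hy⟩, fun ⟨y, hy⟩ => ⟨y ∘ σ.symm, by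
    simpa [Function.comp_assoc] using hy⟩⟩

/-- Quantification over a single position. -/
theorem ex₁ {Q : (w : List Γ) → ((Fin r → Fin w.length) → Prop) →
      (ι → Fin w.length) → Fin w.length → Prop}
    (hQ : Def (ι ⊕ Unit) fun w X e => Q w X (fun i => e (.inl i)) (e (.inr ()))) :
    Def ι fun w X e => ∃ y : Fin w.length, Q w X e y :=
  (ex (κ := Unit) (Q := fun w X e y => Q w X e (y ())) hQ).congr fun w X e =>
    ⟨fun ⟨y, hy⟩ => ⟨_, hy⟩, fun ⟨y, hy⟩ => ⟨fun _ => y, hy⟩⟩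

theorem all₁ {Q : (w : List Γ) → ((Fin r → Fin w.length) → Prop) →
      (ι → Fin w.length) → Fin w.length → Prop}
    (hQ : Def (ι ⊕ Unit) fun w X e => Q w X (fun i => e (.inl i)) (e (.inr ()))) :
    Def ι fun w X e => ∀ y : Fin w.length, Q w X e y :=
  (ex₁ (Q := fun w X e y => ¬ Q w X e y) hQ.not).not.congr fun w X e => by simp

theorem exists_mem {β : Type} (l : List β)
    {P : β → (w : List Γ) → ((Fin r → Fin w.length) → Prop) → (ι → Fin w.length) → Prop}
    (h : ∀ a ∈ l, Def ι (P a)) : Def ι fun w X e => ∃ a ∈ l, P a w X e := by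
  induction l with
  | nil => exact (const False).congr fun w X e => by simp
  | cons a l ih =>
    exact ((h a (by simp)).or (ih fun b hb => h b (by simp [hb]))).congr fun w X e => by simp

theorem forall_mem {β : Type} (l : List β)
    {P : β → (w : List Γ) → ((Fin r → Fin w.length) → Prop) → (ι → Fin w.length) → Prop}
    (h : ∀ a ∈ l, Def ι (P a)) : Def ι fun w X e => ∀ a ∈ l, P a w X e :=
  (exists_mem l (P := fun a w X e => ¬ P a w X e) fun a ha => (h a ha).not).not.congr
    fun w X e => by simp

theorem forall_fintype {β : Type} [Fintype β]
    {P : β → (w : List Γ) → ((Fin r → Fin w.length) → Prop) → (ι → Fin w.length) → Prop}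
    (h : ∀ a, Def ι (P a)) : Def ι fun w X e => ∀ a, P a w X e :=
  (forall_mem (P := P) Finset.univ.toList fun a _ => h a).congr fun w X e => by simp

end Def

/-- The least fixed point of a monotone operator on relations. -/
def lfp {A : Type} (Op : (A → Prop) → A → Prop) (a : A) : Prop :=
  ∀ L : A → Prop, (∀ b, Op L b → L b) → L a

theorem lfp_le {A : Type} {Op : (A → Prop) → A → Prop} {L : A → Prop} (h : ∀ b, Op L b → L b)
    {a : A} (ha : lfp Op a) : L a := ha L h

theorem lfp_closed {A : Type} {Op : (A → Prop) → A → Prop}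
    (hmono : ∀ L L' : A → Prop, (∀ a, L a → L' a) → ∀ a, Op L a → Op L' a) {a : A}
    (ha : Op (lfp Op) a) : lfp Op a :=
  fun _ hL => hL a (hmono _ _ (fun _ hb => lfp_le hL hb) a ha)

section Iterate

variable {P : (w : List Γ) → ((Fin r → Fin w.length) → Prop) → (Fin r → Fin w.length) → Prop}

/-- One pass over all tuples adds to the relation every tuple that the operator derives from it,
and nothing outside any closed relation: the relation is updated during the pass. -/
theorem exists_pass (hP : Def (Fin r) P)
    (hmono : ∀ w (L L' : (Fin r → Fin w.length) → Prop), (∀ a, L a → L' a) →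
      ∀ a, P w L a → P w L' a) (n : ℕ) :
    ∃ φ : Prog Γ 3 n, ∀ (w : List Γ) (e : Fin n → Fin w.length)
      (X : (Fin r → Fin w.length) → Prop), ∃ X' b, φ.eval w e (relMem X) = (b, relMem X') ∧
        (∀ y, X y → X' y) ∧ (∀ y, P w X y → X' y) ∧
        ∀ L : (Fin r → Fin w.length) → Prop, (∀ y, P w L y → L y) → (∀ y, X y → L y) →
          ∀ y, X' y → L y := by
  classical
  obtain ⟨ψ, hψ⟩ := hP (n + r) (Fin.natAdd n)
  let body : Prog Γ 3 (n + r) := .ite ψ (.access (Fin.natAdd n) true) (.const false)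
  refine ⟨.exs r body, fun w e X => ?_⟩
  have key : ∀ (T : List (Fin r → Fin w.length)) (b : Bool) (X : (Fin r → Fin w.length) → Prop),
      ∃ X' b', T.foldl (fun a y => body.round w a (Fin.append e y)) (b, relMem X) =
        (b', relMem X') ∧ (∀ y, X y → X' y) ∧ (∀ y ∈ T, P w X y → X' y) ∧
        ∀ L : (Fin r → Fin w.length) → Prop, (∀ y, P w L y → L y) → (∀ y, X y → L y) →
          ∀ y, X' y → L y := by
    intro T
    induction T with
    | nil => exact fun b X => ⟨X, b, rfl, fun _ h => h, by simp, fun L _ h => h⟩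
    | cons y T ih =>
      intro b X
      have hcomp : Fin.append e y ∘ Fin.natAdd n = y := by
        funext j
        simp
      obtain ⟨b1, h1⟩ : ∃ b1, body.round w (b, relMem X) (Fin.append e y) =
          (b1, relMem fun z => X z ∨ P w X y ∧ z = y) := by
        simp only [Prog.round, body, Prog.eval, hψ, hcomp]
        by_cases h : P w X y
        · simp [h, Prog.eval_access, hcomp]
        · simp [h]
      obtain ⟨X', b', h2, h3, h4, h5⟩ := ih b1 fun z => X z ∨ P w X y ∧ z = y
      refine ⟨X', b', by rw [List.foldl_cons, h1, h2], fun z hz => h3 z (.inl hz), ?_, ?_⟩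
      · intro z hz hPz
        rcases List.mem_cons.1 hz with rfl | hz
        · exact h3 _ (.inr ⟨hPz, rfl⟩)
        · exact h4 z hz (hmono w _ _ (fun a ha => .inl ha) z hPz)
      · intro L hL hXL
        refine h5 L hL ?_
        rintro z (hz | ⟨hPy, rfl⟩)
        · exact hXL z hz
        · exact hL _ (hmono w _ _ hXL _ hPy)
  obtain ⟨X', b', h1, h2, h3, h4⟩ := key (tuples w.length r) false X
  exact ⟨X', b', by rw [Prog.eval_exs, h1], h2, fun y => h3 y (mem_tuples y), h4⟩

/-- As many passes as there are tuples turn the empty relation into the least fixed point. -/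
theorem exists_iterate (hP : Def (Fin r) P)
    (hmono : ∀ w (L L' : (Fin r → Fin w.length) → Prop), (∀ a, L a → L' a) →
      ∀ a, P w L a → P w L' a) :
    ∃ φ : Prog Γ 3 0, ∀ (w : List Γ) (e : Fin 0 → Fin w.length), ∃ b,
      φ.eval w e (relMem fun _ : Fin r → Fin w.length => False) =
        (b, relMem (lfp (P w))) := by
  classical
  obtain ⟨ψ, hψ⟩ := exists_pass hP hmono (0 + r)
  refine ⟨.exs r ψ, fun w e => ?_⟩
  have key : ∀ (T : List (Fin r → Fin w.length)) (b : Bool) (X : (Fin r → Fin w.length) → Prop),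
      (∀ y, X y → lfp (P w) y) →
      ∃ X' b', T.foldl (fun a y => ψ.round w a (Fin.append e y)) (b, relMem X) =
        (b', relMem X') ∧ (∀ y, X y → X' y) ∧ (∀ y, X' y → lfp (P w) y) ∧
        ((∀ y, P w X' y → X' y) ∨ {y | X y}.ncard + T.length ≤ {y | X' y}.ncard) := by
    intro T
    induction T with
    | nil => exact fun b X hX => ⟨X, b, rfl, fun _ h => h, hX, .inr (by simp)⟩
    | cons t T ih =>
      intro b X hX
      obtain ⟨X1, b1, h1, h2, h3, h4⟩ := hψ w (Fin.append e t) X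
      have h1' : ψ.round w (b, relMem X) (Fin.append e t) = (b || b1, relMem X1) := by
        simp [Prog.round, h1]
      have hX1 : ∀ y, X1 y → lfp (P w) y := h4 _ (fun y hy => lfp_closed (hmono w) hy) hX
      obtain ⟨X', b', h5, h6, h7, h8⟩ := ih (b || b1) X1 hX1
      refine ⟨X', b', by rw [List.foldl_cons, h1', h5], fun y hy => h6 y (h2 y hy), h7, ?_⟩
      by_cases hcl : ∀ y, P w X y → X y
      · -- a closed relation is not changed by further passes
        left
        have hX1X : X1 = X := by
          funext y
          exact propext ⟨h4 X hcl (fun _ h => h) y, h2 y⟩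
        subst hX1X
        rcases h8 with h8 | h8
        · exact h8
        · intro y hy
          have : lfp (P w) = X1 := by
            funext z
            exact propext ⟨lfp_le hcl, hX z⟩
          have hX'X : X' = X1 := by
            funext z
            exact propext ⟨fun hz => this ▸ h7 z hz, h6 z⟩
          rw [hX'X] at hy ⊢
          exact hcl y hy
      · refine h8.imp id fun h8 => ?_
        push Not at hcl
        obtain ⟨y, hy, hy'⟩ := hcl
        have : {y | X y}.ncard < {y | X1 y}.ncard := by
          refine Set.ncard_lt_ncard ⟨fun z hz => h2 z hz, fun hsub => hy' (hsub (h3 y hy))⟩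
            (Set.toFinite _)
        simp only [List.length_cons]
        omega
  obtain ⟨X', b', h1, -, h3, h4⟩ := key (tuples w.length r) false (fun _ => False) (by simp)
  have hcl : ∀ y, P w X' y → X' y := by
    rcases h4 with h4 | h4
    · exact h4
    · intro y _
      have huniv : {y | X' y} = Set.univ := by
        refine Set.eq_of_subset_of_ncard_le (Set.subset_univ _) ?_ (Set.toFinite _)
        rw [Set.ncard_univ, Nat.card_eq_fintype_card, Fintype.card_fun, Fintype.card_fin,
          Fintype.card_fin]
        rw [length_tuples] at h4
        omega
      have hy : y ∈ {y | X' y} := by rw [huniv]; trivial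
      exact hy
  have : X' = lfp (P w) := by
    funext y
    exact propext ⟨h3 y, lfp_le hcl⟩
  exact ⟨b', by rw [Prog.eval_exs, h1, this]⟩

/-- A definable predicate of the least fixed point of a definable monotone operator on relations
between positions is decidable in polynomial time.  The words are the encoded inputs behind a fixed
word `pre`. -/
theorem polyTime_of_lfp {α : Type} [Fintype Γ] [Inhabited Γ] (hP : Def (Fin r) P)
    (hmono : ∀ w (L L' : (Fin r → Fin w.length) → Prop), (∀ a, L a → L' a) →
      ∀ a, P w L a → P w L' a)
    {Q : (w : List Γ) → ((Fin r → Fin w.length) → Prop) → Prop}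
    (hQ : Def (Fin 0) fun w X _ => Q w X) (enc : α → List Γ) (f : α → Bool) (pre : List Γ)
    (hf : ∀ x, f x = true ↔ Q (pre ++ enc x) (lfp (P (pre ++ enc x)))) : PolyTime enc f := by
  classical
  obtain ⟨φ, hφ⟩ := exists_iterate hP hmono
  obtain ⟨ψ, hψ⟩ := hQ 0 id
  -- the stack is filled with the empty relation before, and emptied after, the computation
  have hinit : ∀ (w : List Γ) (e : Fin 0 → Fin w.length),
      (Prog.exs r (.push 0 false) : Prog Γ 3 0).eval w e (fun _ => []) =
        (false, relMem fun _ : Fin r → Fin w.length => False) := by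
    intro w e
    have key : ∀ (T : List (Fin r → Fin w.length)) (A : List Bool),
        T.foldl (fun a y => (Prog.push 0 false : Prog Γ 3 (0 + r)).round w a (Fin.append e y))
          (false, ![A, [], []]) = (false, ![List.replicate T.length false ++ A, [], []]) := by
      intro T
      induction T with
      | nil => intro A; simp
      | cons y T ih =>
        intro A
        have h1 : (Prog.push 0 false : Prog Γ 3 (0 + r)).round w (false, ![A, [], []])
            (Fin.append e y) = (false, ![false :: A, [], []]) := by
          simp [Prog.round, Prog.eval, Prog.update_zero]
        rw [List.foldl_cons, h1, ih]
        simp [List.replicate_succ', List.append_assoc]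
    have h0 : (fun _ => [] : Fin 3 → List Bool) = ![[], [], []] := by
      funext i; fin_cases i <;> rfl
    rw [h0, Prog.eval_exs, key, relMem]
    simp [List.map_const']
  have hclear : ∀ (w : List Γ) (e : Fin 0 → Fin w.length) (X : (Fin r → Fin w.length) → Prop),
      ((Prog.exs r (.pop 0) : Prog Γ 3 0).eval w e (relMem X)).2 = fun _ => [] := by
    intro w e X
    have key : ∀ (T : List (Fin r → Fin w.length)) (A : List Bool) (b : Bool),
        A.length = T.length →
        (T.foldl (fun a y => (Prog.pop 0 : Prog Γ 3 (0 + r)).round w a (Fin.append e y))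
          (b, ![A, [], []])).2 = fun _ => [] := by
      intro T
      induction T with
      | nil =>
        intro A b hA
        rw [List.length_nil, List.length_eq_zero_iff] at hA
        subst hA
        funext i; fin_cases i <;> rfl
      | cons y T ih =>
        intro A b hA
        have h1 : (Prog.pop 0 : Prog Γ 3 (0 + r)).round w (b, ![A, [], []])
            (Fin.append e y) = (b || A.head?.getD false, ![A.tail, [], []]) := by
          simp [Prog.round, Prog.eval, Prog.update_zero]
        rw [List.foldl_cons, h1]
        exact ih _ _ (by simp [hA])
    rw [Prog.eval_exs, relMem]
    exact key _ _ _ (by simp)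
  refine Prog.polyTime enc f pre
    (.ite (.exs r (.push 0 false)) (.const false)
      (.andThen (.ite φ ψ ψ) (.exs r (.pop 0)))) fun x => ?_
  obtain ⟨b, hb⟩ := hφ (pre ++ enc x) Fin.elim0
  rw [Prog.eval, hinit]
  simp only [Bool.false_eq_true, if_false, Prog.eval_andThen, Prog.eval, hb, hψ, ite_self, hclear]
  exact Prod.ext ((Bool.decide_congr (hf x).symm).trans (by simp)) rfl

end Iterate

end Definability

/-! ### The chase -/

section Chase

variable {A : Type}

/-- The rules for the equalities that a set of egds forces: `Op E a b` says that one of the egds,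
matched up to the equalities `E`, forces `a = b`. -/
def ChaseStep (Op : (A → A → Prop) → A → A → Prop) (E : A → A → Prop) (a b : A) : Prop :=
  a = b ∨ E b a ∨ (∃ c, E a c ∧ E c b) ∨ Op E a b

/-- Equality under a valuation. -/
abbrev Ker (val : A → Cons) (a b : A) : Prop := val a = val b

/-- The universality of the chase.  Let `E` be the least equivalence relation that is closed under
the egds.  If it merges no two constants and no denial is matched up to `E`, then a valuation that
merges nothing else satisfies all egds and denials; conversely, the kernel of every valuation that
satisfies the egds contains `E`, and egds and denials are monotone in the equalities. -/
theorem exists_valuation_iff [Fintype A] {Op : (A → A → Prop) → A → A → Prop}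
    {Den : (A → A → Prop) → Prop} {E : A → A → Prop} (cst : A → Option Cons)
    (hDen : ∀ L L' : A → A → Prop, (∀ a b, L a b → L' a b) → Den L → Den L')
    (hbase : ∀ L a b c, cst a = some c → cst b = some c → Op L a b)
    (hE : ∀ a b, ChaseStep Op E a b → E a b)
    (hmin : ∀ L : A → A → Prop, (∀ a b, ChaseStep Op L a b → L a b) → ∀ a b, E a b → L a b) :
    (∃ val : A → Cons, (∀ a c, cst a = some c → val a = c) ∧
        (∀ a b, Op (Ker val) a b → val a = val b) ∧ ¬ Den (Ker val)) ↔
      ¬ (Den E ∨ ∃ a b, E a b ∧ ∃ c c', cst a = some c ∧ cst b = some c' ∧ c ≠ c') := by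
  classical
  have hrefl : ∀ a, E a a := fun a => hE a a (.inl rfl)
  have hsymm : ∀ a b, E a b → E b a := fun a b h => hE b a (.inr (.inl h))
  have htrans : ∀ a b c, E a b → E b c → E a c := fun a b c h h' =>
    hE a c (.inr (.inr (.inl ⟨b, h, h'⟩)))
  constructor
  · rintro ⟨val, hcst, hop, hden⟩ hbad
    have hker : ∀ a b, E a b → val a = val b := hmin (Ker val) (by
      rintro a b (rfl | h | ⟨c, h, h'⟩ | h)
      · rfl
      · exact Eq.symm h
      · exact Eq.trans h h'
      · exact hop a b h)
    rcases hbad with h | ⟨a, b, h, c, c', hc, hc', hne⟩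
    · exact hden (hDen _ _ hker h)
    · apply hne
      rw [← hcst a c hc, ← hcst b c' hc', hker a b h]
  · intro hgood
    push Not at hgood
    obtain ⟨hden, hconst⟩ := hgood
    let s : Setoid A := ⟨E, hrefl, fun {a b} => hsymm a b, fun {a b c} => htrans a b c⟩
    obtain ⟨B, hB⟩ : ∃ B, ∀ a c, cst a = some c → c ≤ B :=
      ⟨Finset.univ.sup fun a => (cst a).getD 0, fun a c h => by
        have := Finset.le_sup (f := fun a => (cst a).getD 0) (Finset.mem_univ a)
        simpa [h] using this⟩
    let p : A → Cons → Prop := fun a c => ∃ b, E a b ∧ cst b = some c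
    -- a class with a constant gets this constant, the other classes get different fresh constants
    let val : A → Cons := fun a =>
      if h : ∃ c, p a c then h.choose else B + 1 + Fintype.equivFin A (Quotient.mk s a).out
    have hval : ∀ a b, E a b → val a = val b := by
      intro a b hab
      have hp : p a = p b := by
        funext c
        exact propext ⟨fun ⟨d, h, h'⟩ => ⟨d, htrans _ _ _ (hsymm _ _ hab) h, h'⟩,
          fun ⟨d, h, h'⟩ => ⟨d, htrans _ _ _ hab h, h'⟩⟩
      have hq : Quotient.mk s a = Quotient.mk s b := Quotient.sound hab
      simp only [val, hp, hq]
    have hval' : ∀ a b, val a = val b → E a b := by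
      intro a b hab
      by_cases ha : ∃ c, p a c <;> by_cases hb : ∃ c, p b c
      · simp only [val, dif_pos ha, dif_pos hb] at hab
        obtain ⟨a', haa', hca⟩ := ha.choose_spec
        obtain ⟨b', hbb', hcb⟩ := hb.choose_spec
        rw [← hab] at hcb
        exact htrans _ _ _ haa' (htrans _ _ _ (hE _ _ (.inr (.inr (.inr
          (hbase _ _ _ _ hca hcb))))) (hsymm _ _ hbb'))
      · simp only [val, dif_pos ha, dif_neg hb] at hab
        obtain ⟨a', -, hca⟩ := ha.choose_spec
        have hle := hB _ _ hca
        rw [hab] at hle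
        exact absurd hle (by simp only [not_le]; exact Nat.lt_add_right _ (Nat.lt_succ_self B))
      · simp only [val, dif_neg ha, dif_pos hb] at hab
        obtain ⟨b', -, hcb⟩ := hb.choose_spec
        have hle := hB _ _ hcb
        rw [← hab] at hle
        exact absurd hle (by simp only [not_le]; exact Nat.lt_add_right _ (Nat.lt_succ_self B))
      · simp only [val, dif_neg ha, dif_neg hb] at hab
        have h1 : (Quotient.mk s a).out = (Quotient.mk s b).out :=
          (Fintype.equivFin A).injective (Fin.ext (Nat.add_left_cancel hab))
        have h2 := congrArg (Quotient.mk s) h1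
        rw [Quotient.out_eq, Quotient.out_eq] at h2
        exact Quotient.exact h2
    have hker : Ker val = E := by
      funext a b
      exact propext ⟨hval' a b, hval a b⟩
    refine ⟨val, fun a c hc => ?_, fun a b h => ?_, ?_⟩
    · have ha : ∃ c, p a c := ⟨c, a, hrefl a, hc⟩
      obtain ⟨a', haa', hca⟩ := ha.choose_spec
      simp only [val, dif_pos ha]
      exact (hconst a a' haa' c _ hc hca).symm
    · rw [hker] at h
      exact hval a b (hE a b (.inr (.inr (.inr h))))
    · rw [hker]
      exact hden

end Chase

section PolyTime

variable {Γ : Type} [DecidableEq Γ] {m : ℕ}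

/-- A relation on `2m`-tuples as a binary relation on `m`-tuples. -/
abbrev asBinary {N : ℕ} (X : (Fin (m + m) → Fin N) → Prop) (a b : Fin m → Fin N) : Prop :=
  X (Fin.append a b)

theorem Def.asBinary {ι : Type} (a b : Fin m → ι) : Def (Γ := Γ) (r := m + m) ι fun w X e =>
    ABDExchange.asBinary X (fun j => e (a j)) fun j => e (b j) := by
  refine (Def.rel (Fin.append a b)).congr fun w X e => ?_
  have : (fun j => e (Fin.append a b j)) = Fin.append (fun j => e (a j)) (fun j => e (b j)) := by
    funext i
    refine Fin.addCases (fun j => ?_) (fun j => ?_) i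
    · simp only [Fin.append_left]
    · simp only [Fin.append_right]
  rw [this]

variable [Fintype Γ] [Inhabited Γ]

/-- Definable egds and denials on `m`-tuples of positions can be chased in polynomial time.  The
elements that carry a constant are given by `cst`; `Diff` holds of elements that carry distinct
constants, and `Op` forces elements with the same constant to be equal.  The function `f` is false on
the inputs for which some valuation satisfies all egds and denials. -/
theorem polyTime_of_chase {α : Type}
    {Op : (w : List Γ) → ((Fin m → Fin w.length) → (Fin m → Fin w.length) → Prop) →
      (Fin m → Fin w.length) → (Fin m → Fin w.length) → Prop}
    {Den : (w : List Γ) → ((Fin m → Fin w.length) → (Fin m → Fin w.length) → Prop) → Prop}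
    {Diff : (w : List Γ) → (Fin m → Fin w.length) → (Fin m → Fin w.length) → Prop}
    (hOpDef : Def (r := m + m) (Fin m ⊕ Fin m) fun w X e =>
      Op w (asBinary X) (fun j => e (.inl j)) fun j => e (.inr j))
    (hDenDef : Def (r := m + m) (Fin 0) fun w X _ => Den w (asBinary X))
    (hDiffDef : Def (r := m + m) (Fin m ⊕ Fin m) fun w _ e =>
      Diff w (fun j => e (.inl j)) fun j => e (.inr j))
    (hOp : ∀ (w : List Γ) (L L' : (Fin m → Fin w.length) → (Fin m → Fin w.length) → Prop),
      (∀ a b, L a b → L' a b) → ∀ a b, Op w L a b → Op w L' a b)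
    (hDen : ∀ (w : List Γ) (L L' : (Fin m → Fin w.length) → (Fin m → Fin w.length) → Prop),
      (∀ a b, L a b → L' a b) → Den w L → Den w L')
    (enc : α → List Γ) (f : α → Bool) (pre : List Γ)
    (cst : (x : α) → (Fin m → Fin (pre ++ enc x).length) → Option Cons)
    (hbase : ∀ x L a b c, cst x a = some c → cst x b = some c → Op (pre ++ enc x) L a b)
    (hDiff : ∀ x a b, Diff (pre ++ enc x) a b ↔
      ∃ c c', cst x a = some c ∧ cst x b = some c' ∧ c ≠ c')
    (hf : ∀ x, f x = false ↔ ∃ val : (Fin m → Fin (pre ++ enc x).length) → Cons,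
      (∀ a c, cst x a = some c → val a = c) ∧
        (∀ a b, Op (pre ++ enc x) (Ker val) a b → val a = val b) ∧
        ¬ Den (pre ++ enc x) (Ker val)) :
    PolyTime enc f := by
  let P : (w : List Γ) → ((Fin (m + m) → Fin w.length) → Prop) → (Fin (m + m) → Fin w.length) →
      Prop := fun w X y =>
    ChaseStep (Op w) (asBinary X) (fun j => y (Fin.castAdd m j)) fun j => y (Fin.natAdd m j)
  have happ : ∀ {N : ℕ} (y : Fin (m + m) → Fin N),
      Fin.append (fun j => y (Fin.castAdd m j)) (fun j => y (Fin.natAdd m j)) = y := by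
    intro N y
    funext i
    refine Fin.addCases (fun j => ?_) (fun j => ?_) i
    · exact Fin.append_left _ _ j
    · exact Fin.append_right _ _ j
  have hP : Def (Fin (m + m)) P := by
    have h1 : Def (Γ := Γ) (r := m + m) (Fin (m + m)) fun w X y =>
        (fun j => y (Fin.castAdd m j)) = fun j => y (Fin.natAdd m j) :=
      (Def.forall_fintype fun j => Def.eq (Fin.castAdd m j) (Fin.natAdd m j)).congr
        fun w X y => funext_iff.symm
    have h3 : Def (Γ := Γ) (r := m + m) (Fin (m + m)) fun w X y => ∃ c : Fin m → Fin w.length,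
        asBinary X (fun j => y (Fin.castAdd m j)) c ∧ asBinary X c fun j => y (Fin.natAdd m j) :=
      Def.ex ((Def.asBinary (fun j => Sum.inl (Fin.castAdd m j)) Sum.inr).and
        (Def.asBinary Sum.inr fun j => Sum.inl (Fin.natAdd m j)))
    exact h1.or ((Def.asBinary (Fin.natAdd m) (Fin.castAdd m)).or
      (h3.or (hOpDef.reindex (Sum.elim (Fin.castAdd m) (Fin.natAdd m)))))
  have hmono : ∀ w (L L' : (Fin (m + m) → Fin w.length) → Prop), (∀ a, L a → L' a) →
      ∀ a, P w L a → P w L' a := by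
    rintro w L L' h a (h1 | h1 | ⟨c, h1, h2⟩ | h1)
    · exact .inl h1
    · exact .inr (.inl (h _ h1))
    · exact .inr (.inr (.inl ⟨c, h _ h1, h _ h2⟩))
    · exact .inr (.inr (.inr (hOp w _ _ (fun _ _ => h _) _ _ h1)))
  have hQ : Def (Γ := Γ) (r := m + m) (Fin 0) fun w X _ => Den w (asBinary X) ∨
      ∃ a b : Fin m → Fin w.length, asBinary X a b ∧ Diff w a b :=
    hDenDef.or (Def.ex (Def.ex ((Def.asBinary (fun j => Sum.inl (Sum.inr j)) Sum.inr).and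
      (hDiffDef.reindex (Sum.elim (fun j => Sum.inl (Sum.inr j)) Sum.inr)))))
  refine polyTime_of_lfp hP hmono
    (Q := fun w X => Den w (asBinary X) ∨ ∃ a b : Fin m → Fin w.length,
      asBinary X a b ∧ Diff w a b) hQ enc f pre fun x => ?_
  have key := exists_valuation_iff (E := asBinary (lfp (P (pre ++ enc x)))) (cst x)
    (hDen (pre ++ enc x)) (hbase x)
    (fun a b h => lfp_closed (hmono _) (by
      simpa only [P, Fin.append_left, Fin.append_right] using h))
    (fun L hL a b hab => by
      have : ∀ y, P (pre ++ enc x) (fun y => L (fun j => y (Fin.castAdd m j))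
          fun j => y (Fin.natAdd m j)) y →
          L (fun j => y (Fin.castAdd m j)) fun j => y (Fin.natAdd m j) := by
        intro y hy
        refine hL _ _ ?_
        have hL' : asBinary (fun y => L (fun j => y (Fin.castAdd m j))
            fun j => y (Fin.natAdd m j)) = L := by
          funext a b
          simp only [asBinary, Fin.append_left, Fin.append_right]
        simpa only [P, hL'] using hy
      simpa only [Fin.append_left, Fin.append_right] using lfp_le this hab)
  rw [← Bool.not_eq_false, hf x, key, not_not]
  simp only [hDiff]

end PolyTime

/-! ### Matching queries up to an equivalence -/

section Pattern

variable {T : Schema} {A : Type} {V k : ℕ}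

/-- The element `a` is, up to `E`, the value of a term under the assignment `η` of elements to the
variables `0, …, V`.  `C c` holds of the elements that are the constant `c`. -/
def Term.Is (E : A → A → Prop) (C : Cons → A → Prop) (η : Fin (V + 1) → A) : Term → A → Prop
  | .var x, a => E (η (Fin.ofNat (V + 1) x)) a
  | .cst c, a => ∃ b, C c b ∧ E b a

/-- One of the facts in `F` is, up to `E`, the instance of `a` under `η`. -/
def Hit (E : A → A → Prop) (C : Cons → A → Prop) (F : RelAtom T A → Prop) (η : Fin (V + 1) → A)
    (a : RelAtom T Term) : Prop :=
  ∃ args : Fin (T.arity a.rel) → A, F ⟨a.rel, args⟩ ∧ ∀ p, (a.args p).Is E C η (args p)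

/-- Up to `E`, the assignment `η` maps the atoms of a query into `F` and its head to the elements
selected by `Ans`. -/
def CQNeq.Matches (d : CQNeq T k) (E : A → A → Prop) (C : Cons → A → Prop)
    (Ans : Fin k → A → Prop) (F : RelAtom T A → Prop) (η : Fin (V + 1) → A) : Prop :=
  (∀ a ∈ d.body, Hit E C F η a) ∧ ∀ p, ∃ e, Ans p e ∧ (d.head p).Is E C η e

/-- The equalities that have to hold lest a disjunct with an unequality returns the given tuple. -/
def UCQNeq.Forces (V : ℕ) (q : UCQNeq T k) (E : A → A → Prop) (C : Cons → A → Prop)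
    (Ans : Fin k → A → Prop) (F : RelAtom T A → Prop) (a b : A) : Prop :=
  ∃ d ∈ q, ∃ e ∈ d.neqs, ∃ η : Fin (V + 1) → A,
    d.Matches E C Ans F η ∧ e.1.Is E C η a ∧ e.2.Is E C η b

/-- A disjunct without unequalities returns the given tuple. -/
def UCQNeq.Returns (V : ℕ) (q : UCQNeq T k) (E : A → A → Prop) (C : Cons → A → Prop)
    (Ans : Fin k → A → Prop) (F : RelAtom T A → Prop) : Prop :=
  ∃ d ∈ q, d.neqs = [] ∧ ∃ η : Fin (V + 1) → A, d.Matches E C Ans F η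

variable {E E' : A → A → Prop} {C : Cons → A → Prop} {F : RelAtom T A → Prop}
  {Ans : Fin k → A → Prop} {η : Fin (V + 1) → A}

theorem Term.Is.mono (h : ∀ a b, E a b → E' a b) {u : Term} {a : A} (hu : u.Is E C η a) :
    u.Is E' C η a := by
  cases u with
  | var x => exact h _ _ hu
  | cst c =>
    obtain ⟨b, hb, hba⟩ := hu
    exact ⟨b, hb, h _ _ hba⟩

theorem Hit.mono (h : ∀ a b, E a b → E' a b) {a : RelAtom T Term} (ha : Hit E C F η a) :
    Hit E' C F η a :=
  let ⟨args, hF, hargs⟩ := ha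
  ⟨args, hF, fun p => (hargs p).mono h⟩

theorem CQNeq.Matches.mono (h : ∀ a b, E a b → E' a b) {d : CQNeq T k}
    (hd : d.Matches E C Ans F η) : d.Matches E' C Ans F η :=
  ⟨fun a ha => (hd.1 a ha).mono h, fun p =>
    let ⟨e, he, hp⟩ := hd.2 p
    ⟨e, he, hp.mono h⟩⟩

theorem UCQNeq.Forces.mono (h : ∀ a b, E a b → E' a b) {q : UCQNeq T k} {a b : A}
    (hq : q.Forces V E C Ans F a b) : q.Forces V E' C Ans F a b :=
  let ⟨d, hd, e, he, η, hm, h1, h2⟩ := hq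
  ⟨d, hd, e, he, η, hm.mono h, h1.mono h, h2.mono h⟩

theorem UCQNeq.Returns.mono (h : ∀ a b, E a b → E' a b) {q : UCQNeq T k}
    (hq : q.Returns V E C Ans F) : q.Returns V E' C Ans F :=
  let ⟨d, hd, he, η, hm⟩ := hq
  ⟨d, hd, he, η, hm.mono h⟩

theorem RelAtom.map_eq_iff {U W : Type} {g : U → W} {a : RelAtom T U} {b : RelAtom T W} :
    a.map g = b ↔ ∃ args : Fin (T.arity b.rel) → U, a = ⟨b.rel, args⟩ ∧
      ∀ p, g (args p) = b.args p := by
  constructor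
  · rintro rfl
    exact ⟨a.args, rfl, fun _ => rfl⟩
  · rintro ⟨args, rfl, h⟩
    obtain ⟨R, u⟩ := b
    simp only [RelAtom.map, RelAtom.mk.injEq, heq_eq_eq, true_and]
    exact funext h

/-- The assignment of constants that an assignment of elements induces. -/
abbrev assign (val : A → Cons) (η : Fin (V + 1) → A) (x : Var) : Cons :=
  val (η (Fin.ofNat (V + 1) x))

variable {val : A → Cons}

/-- Over the kernel of a valuation, symbolic values of terms are their actual values. -/
theorem Term.is_ker_iff (hval : ∀ c b, C c b → val b = c) {u : Term}
    (hu : ∀ c, u = .cst c → ∃ b, C c b) {a : A} :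
    u.Is (Ker val) C η a ↔ u.eval (assign val η) = val a := by
  cases u with
  | var x => rfl
  | cst c =>
    constructor
    · rintro ⟨b, hb, hba⟩
      rw [← hba]
      exact (hval _ _ hb).symm
    · intro h
      obtain ⟨b, hb⟩ := hu c rfl
      exact ⟨b, hb, (hval _ _ hb).trans h⟩

/-- Over the kernel of a valuation, an atom is hit if and only if the instance of the atom is one of
the facts under this valuation. -/
theorem hit_ker_iff (hval : ∀ c b, C c b → val b = c) {a : RelAtom T Term}
    (ha : ∀ c, Term.cst c ∈ a.vals → ∃ b, C c b) :
    Hit (Ker val) C F η a ↔ ∃ f, F f ∧ f.map val = a.map (Term.eval (assign val η)) := by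
  have hmem : ∀ p, a.args p ∈ a.vals := fun p => List.mem_ofFn.2 ⟨p, rfl⟩
  have key : ∀ p e, (a.args p).Is (Ker val) C η e ↔ (a.args p).eval (assign val η) = val e :=
    fun p e => Term.is_ker_iff hval fun c hc => ha c (hc ▸ hmem p)
  constructor
  · rintro ⟨args, hF, hargs⟩
    exact ⟨_, hF, RelAtom.map_eq_iff.2 ⟨args, rfl, fun p => ((key p _).1 (hargs p)).symm⟩⟩
  · rintro ⟨f, hF, hf⟩
    obtain ⟨args, rfl, hargs⟩ := RelAtom.map_eq_iff.1 hf
    exact ⟨args, hF, fun p => (key p _).2 (hargs p).symm⟩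

theorem Term.eval_congr {μ ν : Var → Cons} {u : Term} (h : ∀ x, u = .var x → μ x = ν x) :
    u.eval μ = u.eval ν := by
  cases u with
  | var x => exact h x rfl
  | cst c => rfl

theorem RelAtom.map_eval_congr {μ ν : Var → Cons} {a : RelAtom T Term}
    (h : ∀ x, Term.var x ∈ a.vals → μ x = ν x) :
    a.map (Term.eval μ) = a.map (Term.eval ν) := by
  obtain ⟨R, u⟩ := a
  simp only [RelAtom.map, RelAtom.mk.injEq, heq_eq_eq, true_and]
  funext p
  exact Term.eval_congr fun x hx => h x (hx ▸ List.mem_ofFn.2 ⟨p, rfl⟩)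

/-- An assignment of constants that maps atoms into a set of facts is induced by an assignment of
elements, as far as the variables of these atoms are concerned. -/
theorem exists_assign [Nonempty A] {l : List (RelAtom T Term)} {ν : Var → Cons}
    (hl : ∀ a ∈ l, ∃ f : RelAtom T A, f.map val = a.map (Term.eval ν))
    (hV : ∀ a ∈ l, ∀ x, Term.var x ∈ a.vals → x ≤ V) :
    ∃ η : Fin (V + 1) → A, ∀ a ∈ l, ∀ x, Term.var x ∈ a.vals → assign val η x = ν x := by
  classical
  refine ⟨fun x => if h : ∃ e, val e = ν x then h.choose else Classical.arbitrary A,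
    fun a ha x hx => ?_⟩
  have hx' : ((Fin.ofNat (V + 1) x : Fin (V + 1)) : ℕ) = x :=
    Nat.mod_eq_of_lt (Nat.lt_succ_of_le (hV a ha x hx))
  obtain ⟨f, hf⟩ := hl a ha
  obtain ⟨args, -, hargs⟩ := RelAtom.map_eq_iff.1 hf
  obtain ⟨p, hp⟩ := List.mem_ofFn.1 hx
  have h : ∃ e, val e = ν x := ⟨args p, (hargs p).trans (by simp only [RelAtom.map, hp, Term.eval])⟩
  simp only [assign, hx', dif_pos h]
  exact h.choose_spec

/-- All terms in a query. -/
def CQNeq.terms (d : CQNeq T k) : List Term :=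
  d.body.flatMap RelAtom.vals ++ (List.ofFn d.head ++ d.neqs.flatMap fun e => [e.1, e.2])

/-- A valuation keeps a tuple out of the answers of a union of conjunctive queries with at most one
unequality per disjunct if and only if it satisfies the egds into which the disjuncts with an
unequality turn, and none of the denials into which the other disjuncts turn is matched. -/
theorem UCQNeq.not_mem_answers_iff [Nonempty A] {q : UCQNeq T k} (hq : q.AtMostOneNeq)
    {t : Fin k → Cons} (hval : ∀ c b, C c b → val b = c)
    (hAns : ∀ p e, Ans p e → val e = t p) (hAns' : ∀ p, ∃ e, Ans p e)
    (hV : ∀ d ∈ q, ∀ x, Term.var x ∈ d.terms → x ≤ V)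
    (hC : ∀ d ∈ q, ∀ c, Term.cst c ∈ d.terms → ∃ b, C c b)
    {J : Instance T} (hJ : ∀ f, f ∈ J ↔ ∃ g, F g ∧ g.map val = f) :
    t ∉ q.answers J ↔ (∀ a b, q.Forces V (Ker val) C Ans F a b → val a = val b) ∧
      ¬ q.Returns V (Ker val) C Ans F := by
  have hbody : ∀ d ∈ q, ∀ (η : Fin (V + 1) → A), ∀ a ∈ d.body, (Hit (Ker val) C F η a ↔
      a.map (Term.eval (assign val η)) ∈ J) := by
    intro d hd η a ha
    rw [hJ, hit_ker_iff hval]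
    exact fun c hc => hC d hd c (List.mem_append_left _ (List.mem_flatMap.2 ⟨a, ha, hc⟩))
  have hhead : ∀ d ∈ q, ∀ (η : Fin (V + 1) → A) p e, ((d.head p).Is (Ker val) C η e ↔
      (d.head p).eval (assign val η) = val e) := by
    intro d hd η p e
    refine Term.is_ker_iff hval fun c hc => hC d hd c ?_
    exact List.mem_append_right _ (List.mem_append_left _ (List.mem_ofFn.2 ⟨p, hc⟩))
  have hneq : ∀ d ∈ q, ∀ e ∈ d.neqs, ∀ c, (e.1 = .cst c ∨ e.2 = .cst c) → ∃ b, C c b := by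
    rintro d hd e he c hc
    refine hC d hd c (List.mem_append_right _ (List.mem_append_right _
      (List.mem_flatMap.2 ⟨e, he, ?_⟩)))
    rcases hc with h | h <;> simp [h]
  have hmatch : ∀ d ∈ q, ∀ (η : Fin (V + 1) → A), (d.Matches (Ker val) C Ans F η ↔
      (∀ p, (d.head p).eval (assign val η) = t p) ∧
        ∀ a ∈ d.body, a.map (Term.eval (assign val η)) ∈ J) := by
    intro d hd η
    rw [CQNeq.Matches, and_comm]
    refine and_congr (forall_congr' fun p => ?_) (forall₂_congr (hbody d hd η))
    constructor
    · rintro ⟨e, he, h⟩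
      rw [← hAns p e he]
      exact (hhead d hd η p e).1 h
    · intro h
      obtain ⟨e, he⟩ := hAns' p
      exact ⟨e, he, (hhead d hd η p e).2 (h.trans (hAns p e he).symm)⟩
  constructor
  · intro ht
    constructor
    · rintro a b ⟨d, hd, e, he, η, hm, ha, hb⟩
      by_contra hab
      rw [Term.is_ker_iff hval fun c hc => hneq d hd e he c (.inl hc)] at ha
      rw [Term.is_ker_iff hval fun c hc => hneq d hd e he c (.inr hc)] at hb
      obtain ⟨h1, h2⟩ := (hmatch d hd η).1 hm
      refine ht ⟨d, hd, assign val η, h1, h2, fun e' he' => ?_⟩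
      have : e' = e := by
        have hlen := hq d hd
        match hn : d.neqs, he, he', hlen with
        | [x], he, he', _ => rw [List.mem_singleton.1 he, List.mem_singleton.1 he']
        | _ :: _ :: _, _, _, hlen => simp at hlen
      rw [this, ha, hb]
      exact hab
    · rintro ⟨d, hd, he, η, hm⟩
      obtain ⟨h1, h2⟩ := (hmatch d hd η).1 hm
      exact ht ⟨d, hd, assign val η, h1, h2, by simp [he]⟩
  · rintro ⟨hforce, hret⟩ ⟨d, hd, ν, h1, h2, h3⟩
    obtain ⟨η, hη⟩ := exists_assign (A := A) (V := V) (val := val) (l := d.body) (ν := ν)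
      (fun a ha => let ⟨f, _, hf⟩ := (hJ _).1 (h2 a ha); ⟨f, hf⟩)
      fun a ha x hx => hV d hd x (List.mem_append_left _ (List.mem_flatMap.2 ⟨a, ha, hx⟩))
    have hm : d.Matches (Ker val) C Ans F η := by
      refine (hmatch d hd η).2 ⟨fun p => ?_, fun a ha => ?_⟩
      · rw [← h1 p]
        refine Term.eval_congr fun x hx => ?_
        obtain ⟨a, ha, hxa⟩ := d.head_safe p x hx
        exact hη a ha x hxa
      · rw [RelAtom.map_eval_congr (hη a ha)]
        exact h2 a ha
    match hn : d.neqs with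
    | [] => exact hret ⟨d, hd, hn, η, hm⟩
    | e :: l =>
      have he : e ∈ d.neqs := by simp [hn]
      have hex : ∀ u : Term, (e.1 = u ∨ e.2 = u) →
          ∃ a, u.Is (Ker val) C η a ∧ val a = u.eval ν := by
        intro u hu
        cases u with
        | var x =>
          obtain ⟨a, ha, hxa⟩ := d.neqs_safe e he x hu
          exact ⟨_, rfl, hη a ha x hxa⟩
        | cst c =>
          obtain ⟨b, hb⟩ := hneq d hd e he c hu
          exact ⟨b, ⟨b, hb, rfl⟩, hval c b hb⟩
      obtain ⟨a, ha, hva⟩ := hex e.1 (.inl rfl)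
      obtain ⟨b, hb, hvb⟩ := hex e.2 (.inr rfl)
      refine h3 e he ?_
      rw [← hva, ← hvb]
      exact hforce a b ⟨d, hd, e, he, η, hm, ha, hb⟩

end Pattern

section Definable

variable {Γ : Type} [DecidableEq Γ] {T : Schema} {m k V : ℕ} {ι : Type}

/-- Quantification over families of `m`-tuples. -/
theorem Def.ex_tuples {r : ℕ} {κ : Type} [Fintype κ]
    {Q : (w : List Γ) → ((Fin r → Fin w.length) → Prop) →
      (ι → Fin w.length) → (κ → Fin m → Fin w.length) → Prop}
    (hQ : Def (ι ⊕ κ × Fin m) fun w X e =>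
      Q w X (fun i => e (.inl i)) fun x j => e (.inr (x, j))) :
    Def ι fun w X e => ∃ y : κ → Fin m → Fin w.length, Q w X e y :=
  (Def.ex (κ := κ × Fin m) (Q := fun w X e y => Q w X e fun x j => y (x, j)) hQ).congr
    fun w X e => ⟨fun ⟨y, hy⟩ => ⟨_, hy⟩, fun ⟨y, hy⟩ => ⟨fun z => y z.1 z.2, hy⟩⟩

variable {C : (w : List Γ) → Cons → (Fin m → Fin w.length) → Prop}
  {Ans : (w : List Γ) → Fin k → (Fin m → Fin w.length) → Prop}
  {F : (w : List Γ) → RelAtom T (Fin m → Fin w.length) → Prop}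

theorem Def.is (hC : ∀ c, Def (r := m + m) (Fin m) fun w _ e => C w c e) (u : Term)
    (η : Fin (V + 1) → Fin m → ι) (a : Fin m → ι) :
    Def (r := m + m) ι fun w X e =>
      u.Is (ABDExchange.asBinary X) (C w) (fun x j => e (η x j)) fun j => e (a j) := by
  cases u with
  | var x => exact Def.asBinary _ _
  | cst c =>
    refine Def.ex (Q := fun w X e b => C w c b ∧ ABDExchange.asBinary X b fun j => e (a j)) ?_
    exact ((hC c).reindex Sum.inr).and (Def.asBinary (a := Sum.inr) (b := fun j => Sum.inl (a j)))

theorem Def.hit (hC : ∀ c, Def (r := m + m) (Fin m) fun w _ e => C w c e)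
    (hF : ∀ R, Def (r := m + m) (Fin (T.arity R) × Fin m) fun w _ e =>
      F w ⟨R, fun p j => e (p, j)⟩) (a : RelAtom T Term) (η : Fin (V + 1) → Fin m → ι) :
    Def (r := m + m) ι fun w X e =>
      Hit (ABDExchange.asBinary X) (C w) (F w) (fun x j => e (η x j)) a := by
  refine Def.ex_tuples (Q := fun w X e args => F w ⟨a.rel, args⟩ ∧
    ∀ p, (a.args p).Is (ABDExchange.asBinary X) (C w) (fun x j => e (η x j)) (args p)) ?_
  exact ((hF a.rel).reindex Sum.inr).and (Def.forall_fintype fun p =>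
    Def.is hC (a.args p) (fun x j => Sum.inl (η x j)) fun j => Sum.inr (p, j))

theorem Def.queryMatches (hC : ∀ c, Def (r := m + m) (Fin m) fun w _ e => C w c e)
    (hF : ∀ R, Def (r := m + m) (Fin (T.arity R) × Fin m) fun w _ e =>
      F w ⟨R, fun p j => e (p, j)⟩)
    (hAns : ∀ p, Def (r := m + m) (Fin m) fun w _ e => Ans w p e)
    (d : CQNeq T k) (η : Fin (V + 1) → Fin m → ι) :
    Def (r := m + m) ι fun w X e =>
      d.Matches (ABDExchange.asBinary X) (C w) (Ans w) (F w) (fun x j => e (η x j)) := by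
  refine (Def.forall_mem d.body fun a _ => Def.hit hC hF a η).and (Def.forall_fintype fun p => ?_)
  refine Def.ex (Q := fun w X e b => Ans w p b ∧
    (d.head p).Is (ABDExchange.asBinary X) (C w) (fun x j => e (η x j)) b) ?_
  exact ((hAns p).reindex Sum.inr).and (Def.is hC _ (fun x j => Sum.inl (η x j)) Sum.inr)

theorem Def.forces (hC : ∀ c, Def (r := m + m) (Fin m) fun w _ e => C w c e)
    (hF : ∀ R, Def (r := m + m) (Fin (T.arity R) × Fin m) fun w _ e =>
      F w ⟨R, fun p j => e (p, j)⟩)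
    (hAns : ∀ p, Def (r := m + m) (Fin m) fun w _ e => Ans w p e) (q : UCQNeq T k) (V : ℕ) :
    Def (r := m + m) (Fin m ⊕ Fin m) fun w X e =>
      q.Forces V (ABDExchange.asBinary X) (C w) (Ans w) (F w) (fun j => e (Sum.inl j))
        fun j => e (Sum.inr j) := by
  refine Def.exists_mem q fun d _ => Def.exists_mem d.neqs fun e' _ => ?_
  refine Def.ex_tuples (Q := fun w X e η =>
    d.Matches (ABDExchange.asBinary X) (C w) (Ans w) (F w) η ∧
      e'.1.Is (ABDExchange.asBinary X) (C w) η (fun j => e (Sum.inl j)) ∧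
      e'.2.Is (ABDExchange.asBinary X) (C w) η fun j => e (Sum.inr j)) ?_
  let η : Fin (V + 1) → Fin m → (Fin m ⊕ Fin m) ⊕ Fin (V + 1) × Fin m :=
    fun x j => Sum.inr (x, j)
  exact (Def.queryMatches hC hF hAns d η).and
    ((Def.is hC e'.1 η fun j => Sum.inl (Sum.inl j)).and
      (Def.is hC e'.2 η fun j => Sum.inl (Sum.inr j)))

theorem Def.returns (hC : ∀ c, Def (r := m + m) (Fin m) fun w _ e => C w c e)
    (hF : ∀ R, Def (r := m + m) (Fin (T.arity R) × Fin m) fun w _ e =>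
      F w ⟨R, fun p j => e (p, j)⟩)
    (hAns : ∀ p, Def (r := m + m) (Fin m) fun w _ e => Ans w p e) (q : UCQNeq T k) (V : ℕ) :
    Def (r := m + m) (Fin 0) fun w X _ =>
      q.Returns V (ABDExchange.asBinary X) (C w) (Ans w) (F w) := by
  refine Def.exists_mem q fun d _ => (Def.const _).and ?_
  refine Def.ex_tuples (Q := fun w X _ η =>
    d.Matches (ABDExchange.asBinary X) (C w) (Ans w) (F w) η) ?_
  exact Def.queryMatches hC hF hAns d fun x j => Sum.inr (x, j)

end Definable

/-! ### Reading encoded inputs -/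

section Words

variable {n : ℕ}

noncomputable instance : DecidableEq (Sym n) := Classical.decEq _

instance : Inhabited (Sym n) := ⟨.cst⟩

instance : Finite (Sym n) := by
  let g : Sym n → Fin n ⊕ Bool ⊕ Fin 6 := fun s => match s with
    | .rel r => .inl r
    | .bit b => .inr (.inl b)
    | .cst => .inr (.inr 0)
    | .openNull => .inr (.inr 1)
    | .closedNull => .inr (.inr 2)
    | .clause => .inr (.inr 3)
    | .neq => .inr (.inr 4)
    | .answer => .inr (.inr 5)
  refine Finite.of_injective g fun a b h => ?_
  cases a <;> cases b <;> simp_all [g]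

noncomputable instance : Fintype (Sym n) := Fintype.ofFinite _

/-- The symbols for the digits of constants and nulls. -/
def Sym.isBit : Sym n → Bool
  | .bit _ => true
  | _ => false

/-- The symbols that introduce a constant or a null. -/
def Sym.isValue : Sym n → Bool
  | .cst => true
  | .openNull => true
  | .closedNull => true
  | _ => false

/-- The letter at a position together with the bits that follow it. -/
def token (w : List (Sym n)) (i : Fin w.length) : List (Sym n) :=
  w[i] :: (w.drop (i + 1)).takeWhile Sym.isBit

/-- The constant or null `v` is written at the position `i`. -/
def ValAt (w : List (Sym n)) (i : Fin w.length) (v : Val) : Prop :=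
  token w i = encodeVal v

theorem encodeVal_eq (v : Val) : ∃ s bs, encodeVal (n := n) v = s :: bs ∧ s.isValue = true ∧
    s.isBit = false ∧ ∀ x ∈ bs, x.isBit = true := by
  have h : ∀ l : List Bool, ∀ x ∈ l.map (Sym.bit (n := n)), x.isBit = true := by
    intro l x hx
    obtain ⟨b, -, rfl⟩ := List.mem_map.1 hx
    rfl
  cases v <;> exact ⟨_, _, rfl, rfl, rfl, h _⟩

theorem encodeVal_injective : Function.Injective (encodeVal (n := n)) := by
  have hbits : ∀ a b : ℕ, a.bits.map (Sym.bit (n := n)) = b.bits.map Sym.bit → a = b := by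
    intro a b h
    have h' : a.bits = b.bits := List.map_injective_iff.2 (fun x y hxy => by simpa using hxy) h
    rw [← Nat.digits_inj_iff (b := 2), Nat.digits_two_eq_bits, Nat.digits_two_eq_bits, h']
  intro u v h
  cases u <;> cases v <;> simp only [encodeVal, List.cons.injEq, reduceCtorEq, false_and] at h <;>
    rw [hbits _ _ h.2]

theorem ValAt.unique {w : List (Sym n)} {i : Fin w.length} {u v : Val} (hu : ValAt w i u)
    (hv : ValAt w i v) : u = v :=
  encodeVal_injective (hu.symm.trans hv)

/-- The word does not start with a bit. -/
def NoBit (l : List (Sym n)) : Prop := ∀ s ∈ l.head?, s.isBit = false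

theorem NoBit.encodeVal_append (v : Val) (l : List (Sym n)) : NoBit (encodeVal v ++ l) := by
  cases v <;> simp [NoBit, encodeVal, Sym.isBit]

theorem NoBit.cons {s : Sym n} (h : s.isBit = false) (l : List (Sym n)) : NoBit (s :: l) := by
  simpa [NoBit] using h

theorem NoBit.flatMap_append {β : Type} {f : β → List (Sym n)} (l : List β) {R : List (Sym n)}
    (hf : ∀ b ∈ l, ∀ L, NoBit (f b ++ L)) (hR : NoBit R) : NoBit (l.flatMap f ++ R) := by
  cases l with
  | nil => exact hR
  | cons b l =>
    rw [List.flatMap_cons, List.append_assoc]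
    exact hf b (by simp) _

theorem takeWhile_bits {bs rest : List (Sym n)} (hbs : ∀ x ∈ bs, x.isBit = true)
    (hrest : NoBit rest) : (bs ++ rest).takeWhile Sym.isBit = bs := by
  rw [List.takeWhile_append_of_pos hbs]
  cases rest with
  | nil => simp
  | cons s l =>
    have : s.isBit = false := hrest s (by simp)
    simp [List.takeWhile, this]

theorem drop_eq_cons {w : List (Sym n)} {i : Fin w.length} {s : Sym n} {l : List (Sym n)}
    (h : w.drop i = s :: l) : w[i] = s ∧ w.drop (i + 1) = l := by
  have h' := List.drop_eq_getElem_cons i.2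
  rw [h, List.cons.injEq] at h'
  exact ⟨h'.1.symm, h'.2.symm⟩

theorem drop_eq (w : List (Sym n)) (i : Fin w.length) : w.drop i = w[i] :: w.drop (i + 1) :=
  List.drop_eq_getElem_cons i.2

theorem token_of_drop {w : List (Sym n)} {i : Fin w.length} {s : Sym n} {bs rest : List (Sym n)}
    (h : w.drop i = s :: (bs ++ rest)) (hbs : ∀ x ∈ bs, x.isBit = true) (hrest : NoBit rest) :
    token w i = s :: bs := by
  obtain ⟨h1, h2⟩ := drop_eq_cons h
  rw [token, h1, h2, takeWhile_bits hbs hrest]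

theorem valAt_of_drop {w : List (Sym n)} {i : Fin w.length} {v : Val} {rest : List (Sym n)}
    (h : w.drop i = encodeVal v ++ rest) (hrest : NoBit rest) : ValAt w i v := by
  obtain ⟨s, bs, hv, -, -, hbs⟩ := encodeVal_eq (n := n) v
  rw [hv, List.cons_append] at h
  rw [ValAt, hv, token_of_drop h hbs hrest]

/-- `j` is the first position after `i` that does not hold a bit. -/
def Nxt (w : List (Sym n)) (i j : Fin w.length) : Prop :=
  i < j ∧ w[j].isBit = false ∧ ∀ y : Fin w.length, i < y ∧ y < j → w[y].isBit = true

/-- After a letter and its bits, `Nxt` leads to the rest of the word. -/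
theorem nxt_iff {w : List (Sym n)} {i j : Fin w.length} {s : Sym n} {bs rest : List (Sym n)}
    (h : w.drop i = s :: (bs ++ rest)) (hbs : ∀ x ∈ bs, x.isBit = true) (hrest : NoBit rest) :
    Nxt w i j ↔ w.drop j = rest := by
  have h2 := (drop_eq_cons h).2
  have hget : ∀ (y : Fin w.length) (z : ℕ), (y : ℕ) = i + 1 + z → (bs ++ rest)[z]? = some w[y] := by
    intro y z hz
    rw [← h2, List.getElem?_drop, ← hz]
    exact List.getElem?_eq_getElem y.2
  have hlen := congrArg List.length h2
  rw [List.length_drop, List.length_append] at hlen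
  have hi := i.2
  have hj := j.2
  have hbit : ∀ y : Fin w.length, i < y → (y : ℕ) < i + 1 + bs.length → w[y].isBit = true := by
    intro y h1 h3
    have hy := hget y (y - (i + 1)) (by have := Fin.lt_def.1 h1; omega)
    rw [List.getElem?_append_left (by have := Fin.lt_def.1 h1; omega)] at hy
    exact hbs _ (List.mem_of_getElem? hy)
  have hnb : ∀ y : Fin w.length, (y : ℕ) = i + 1 + bs.length → w[y].isBit = false := by
    intro y h1
    have hy := hget y bs.length h1
    rw [List.getElem?_append_right le_rfl, Nat.sub_self] at hy
    exact hrest _ (by rw [List.head?_eq_getElem?, hy]; rfl)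
  have hdrop : w.drop (i + 1 + bs.length) = rest := by
    rw [← List.drop_drop, h2, List.drop_left]
  constructor
  · rintro ⟨hij, hjb, hall⟩
    have : (j : ℕ) = i + 1 + bs.length := by
      have hij' := Fin.lt_def.1 hij
      rcases lt_trichotomy (j : ℕ) (i + 1 + bs.length) with h' | h' | h'
      · rw [hbit j hij h'] at hjb
        exact absurd hjb (by simp)
      · exact h'
      · have hy := hall ⟨i + 1 + bs.length, h'.trans j.2⟩
          ⟨Fin.lt_def.2 (by simp only []; omega), Fin.lt_def.2 h'⟩
        rw [hnb _ rfl] at hy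
        exact absurd hy (by simp)
    rw [this, hdrop]
  · intro hj'
    have hl := congrArg List.length hj'
    rw [List.length_drop] at hl
    have hjv : (j : ℕ) = i + 1 + bs.length := by omega
    refine ⟨Fin.lt_def.2 (by omega), hnb j hjv, fun y hy => hbit y hy.1 ?_⟩
    have := Fin.lt_def.1 hy.2
    omega

/-- `j` is the `k`-th position after `i` that does not hold a bit. -/
def Nth (w : List (Sym n)) : ℕ → Fin w.length → Fin w.length → Prop
  | 0, i, j => i = j
  | k + 1, i, j => ∃ i', Nxt w i i' ∧ Nth w k i' j

theorem exists_drop_eq {w l L : List (Sym n)} (hL : L ≠ []) (h : w = l ++ L) :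
    ∃ i : Fin w.length, (i : ℕ) = l.length ∧ w.drop i = L := by
  subst h
  refine ⟨⟨l.length, ?_⟩, rfl, List.drop_left⟩
  have := List.length_pos_iff.2 hL
  simpa using this

/-- The entries of a record: if the values `vs` follow the letter `s`, with bits `bs`, at `i`, then the
value with the number `k` is written at the `k + 1`-st position after `i` that holds no bit. -/
theorem nth_record {w : List (Sym n)} {rest : List (Sym n)} (hrest : NoBit rest) (vs : List Val) :
    ∀ (k : ℕ) (hk : k < vs.length) (i : Fin w.length) (s : Sym n) (bs : List (Sym n)),
      w.drop i = s :: (bs ++ (vs.flatMap encodeVal ++ rest)) → (∀ x ∈ bs, x.isBit = true) →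
      (∃ j, Nth w (k + 1) i j) ∧ ∀ j, Nth w (k + 1) i j → ValAt w j vs[k] := by
  induction vs with
  | nil => intro k hk; exact absurd hk (by simp)
  | cons v vs ih =>
    intro k hk i s bs h hbs
    have hnb : NoBit (vs.flatMap encodeVal ++ rest) :=
      NoBit.flatMap_append vs (fun b _ L => NoBit.encodeVal_append b L) hrest
    rw [List.flatMap_cons, List.append_assoc] at h
    have hnxt : ∀ j, Nxt w i j ↔ w.drop j = encodeVal v ++ (vs.flatMap encodeVal ++ rest) :=
      fun j => nxt_iff h hbs (NoBit.encodeVal_append v _)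
    obtain ⟨s', bs', hv, -, -, hbs'⟩ := encodeVal_eq (n := n) v
    obtain ⟨i', -, hi'⟩ := exists_drop_eq (w := w) (l := w.take i ++ s :: bs)
      (L := encodeVal v ++ (vs.flatMap encodeVal ++ rest)) (by simp [hv])
        ((List.take_append_drop (i : ℕ) w).symm.trans (by rw [h]; simp))
    cases k with
    | zero =>
      refine ⟨⟨i', i', (hnxt i').2 hi', rfl⟩, ?_⟩
      rintro j ⟨j', hj', rfl⟩
      exact valAt_of_drop ((hnxt _).1 hj') hnb
    | succ k =>
      have key : ∀ i', Nxt w i i' → _ := fun i' hi' => ih k (by simpa using hk) i' s' bs'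
        (by rw [(hnxt i').1 hi', hv, List.cons_append]) hbs'
      constructor
      · obtain ⟨j, hj⟩ := (key i' ((hnxt i').2 hi')).1
        exact ⟨j, i', (hnxt i').2 hi', hj⟩
      · rintro j ⟨i', hi', hj⟩
        exact (key i' hi').2 j hj

/-- A suffix that starts with a marked letter starts behind a prefix without marked letters. -/
theorem suffix_of_not_mem {p : Sym n → Prop} {s : Sym n} {rest X Y : List (Sym n)} (hs : p s)
    (hX : ∀ x ∈ X, ¬ p x) (h : s :: rest <:+ X ++ Y) : s :: rest <:+ Y := by
  induction X with
  | nil => exact h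
  | cons x X ih =>
    rw [List.cons_append, List.suffix_cons_iff] at h
    rcases h with h | h
    · rw [(List.cons.inj h).1] at hs
      exact absurd hs (hX x (by simp))
    · exact ih (fun y hy => hX y (by simp [hy])) h

/-- A suffix that starts with a letter which marks the beginnings of blocks starts at one of the
blocks. -/
theorem exists_block {β : Type} {f : β → List (Sym n)} {p : Sym n → Prop}
    (hf : ∀ b, ∃ s l, f b = s :: l ∧ ∀ x ∈ l, ¬ p x) {R : List (Sym n)}
    {s : Sym n} {rest : List (Sym n)} (hs : p s) (hR : ¬ s :: rest <:+ R) : ∀ (A : List β),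
    s :: rest <:+ A.flatMap f ++ R →
      ∃ A₁ b A₂, A = A₁ ++ b :: A₂ ∧ s :: rest = f b ++ (A₂.flatMap f ++ R) := by
  intro A
  induction A with
  | nil =>
    intro h
    exact absurd h hR
  | cons b A ih =>
    intro h
    obtain ⟨s', l, hb, hl⟩ := hf b
    rw [List.flatMap_cons, hb, List.append_assoc, List.cons_append, List.suffix_cons_iff] at h
    rcases h with h | h
    · exact ⟨[], b, A, rfl, by rw [h, hb, List.cons_append]⟩
    · obtain ⟨A₁, b', A₂, hA, hrest⟩ := ih (suffix_of_not_mem hs hl h)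
      exact ⟨b :: A₁, b', A₂, by rw [hA, List.cons_append], hrest⟩

end Words

section Records

variable {n : ℕ}

/-- `args` are the positions of the entries of a record for the relation symbol `r` at `i`. -/
def FactAt (w : List (Sym n)) (r : Fin n) {k : ℕ} (i : Fin w.length)
    (args : Fin k → Fin w.length) : Prop :=
  w[i] = Sym.rel r ∧ ∀ p : Fin k, Nth w (p + 1) i (args p)

/-- The `p`-th entry of an answer tuple is written at `j`. -/
def AnswerAt (w : List (Sym n)) (p : ℕ) (j : Fin w.length) : Prop :=
  ∃ i : Fin w.length, w[i] = Sym.answer ∧ Nth w (p + 1) i j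

theorem not_isValue_of_isBit {x : Sym n} (h : x.isBit = true) : x.isValue = false := by
  cases x <;> simp_all [Sym.isBit, Sym.isValue]

/-- The symbols in encoded values. -/
theorem mem_encodeVal {v : Val} {x : Sym n} (h : x ∈ encodeVal v) :
    x.isValue = true ∨ x.isBit = true := by
  obtain ⟨s, bs, hv, hs, -, hbs⟩ := encodeVal_eq (n := n) v
  rw [hv, List.mem_cons] at h
  rcases h with rfl | h
  · exact .inl hs
  · exact .inr (hbs x h)

theorem mem_flatMap_encodeVal {vs : List Val} {x : Sym n} (h : x ∈ vs.flatMap encodeVal) :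
    x.isValue = true ∨ x.isBit = true := by
  obtain ⟨v, -, hx⟩ := List.mem_flatMap.1 h
  exact mem_encodeVal hx

theorem encodeTuple_eq {k : ℕ} (t : Fin k → Cons) : encodeTuple (n := n) t =
    Sym.answer :: ((List.ofFn fun p => Val.cst (t p)).flatMap encodeVal ++ []) := by
  rw [encodeTuple, List.append_nil, List.cons.injEq]
  refine ⟨rfl, ?_⟩
  have : (List.ofFn fun p => Val.cst (t p)) = (List.ofFn t).map Val.cst := by
    rw [List.map_ofFn]; rfl
  rw [this, List.flatMap_map]

variable {k : ℕ} {t : Fin k → Cons} {w l : List (Sym n)}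

/-- If a tuple is written at the end of the word and `Sym.answer` occurs only there, then `AnswerAt`
finds nothing but the entries of the tuple. -/
theorem answerAt_sound (hw : w = l ++ encodeTuple t) (hl : ∀ x ∈ l, x ≠ Sym.answer) (p : Fin k)
    {j : Fin w.length} (h : AnswerAt w p j) : ValAt w j (.cst (t p)) := by
  obtain ⟨i, hi, hj⟩ := h
  have hsuf : w.drop i <:+ w := List.drop_suffix _ _
  rw [drop_eq, hi] at hsuf
  nth_rw 3 [hw] at hsuf
  have h1 := suffix_of_not_mem (p := fun x => x = Sym.answer) rfl hl hsuf
  rw [encodeTuple_eq, List.suffix_cons_iff] at h1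
  have h2 : w.drop i = Sym.answer ::
      ([] ++ ((List.ofFn fun p => Val.cst (t p)).flatMap encodeVal ++ [])) := by
    rcases h1 with h1 | h1
    · rw [drop_eq, hi, h1, List.nil_append]
    · rw [List.append_nil] at h1
      rcases mem_flatMap_encodeVal (h1.subset List.mem_cons_self) with h | h <;>
        simp [Sym.isBit, Sym.isValue] at h
  have h3 := (nth_record (by simp [NoBit]) _ p (by simp) i _ [] h2 (by simp)).2 j hj
  simpa using h3

theorem exists_answerAt (hw : w = l ++ encodeTuple t) (p : Fin k) :
    ∃ j : Fin w.length, AnswerAt w p j := by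
  rw [encodeTuple_eq] at hw
  obtain ⟨i, -, hi⟩ := exists_drop_eq (by simp) hw
  obtain ⟨j, hj⟩ := (nth_record (w := w) (rest := []) (by simp [NoBit])
    (List.ofFn fun p => Val.cst (t p)) p (by simp) i Sym.answer [] hi (by simp)).1
  exact ⟨j, i, (drop_eq_cons hi).1, hj⟩

variable {S : Schema} {w l R : List (Sym S.size)} {A : List (RelAtom S Val)}

theorem encodeAtom_block (a : RelAtom S Val) :
    ∃ s l, encodeAtom a = s :: l ∧ ∀ x ∈ l, ¬ ∃ r, x = Sym.rel r := by
  refine ⟨_, _, rfl, fun x hx => ?_⟩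
  rintro ⟨r, rfl⟩
  rcases mem_flatMap_encodeVal hx with h | h <;> simp [Sym.isBit, Sym.isValue] at h

theorem noBit_atoms (hR : NoBit R) : NoBit (A.flatMap encodeAtom ++ R) :=
  NoBit.flatMap_append A (fun _ _ _ => NoBit.cons rfl _) hR

/-- If all relation symbols of the word stand in the list of facts `A`, then `FactAt` finds nothing but
the facts in `A`. -/
theorem factAt_sound (hw : w = l ++ (A.flatMap encodeAtom ++ R)) (hl : ∀ x ∈ l, ∀ r, x ≠ Sym.rel r)
    (hR : ∀ x ∈ R, ∀ r, x ≠ Sym.rel r) (hR' : NoBit R) {r : Fin S.size} {i : Fin w.length}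
    {args : Fin (S.arity r) → Fin w.length} (h : FactAt w r i args) :
    ∃ u, (⟨r, u⟩ : RelAtom S Val) ∈ A ∧ ∀ p, ValAt w (args p) (u p) := by
  obtain ⟨hi, hargs⟩ := h
  have hsuf : w.drop i <:+ w := List.drop_suffix _ _
  rw [drop_eq, hi] at hsuf
  nth_rw 3 [hw] at hsuf
  have h1 := suffix_of_not_mem (p := fun x => ∃ r, x = Sym.rel r) ⟨r, rfl⟩
    (fun x hx ⟨r, h⟩ => hl x hx r h) hsuf
  obtain ⟨A₁, ⟨r', u⟩, A₂, hA, h2⟩ := exists_block encodeAtom_block ⟨r, rfl⟩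
    (fun h => hR _ (h.subset List.mem_cons_self) r rfl) A h1
  simp only [encodeAtom, List.cons_append, List.cons.injEq, Sym.rel.injEq] at h2
  obtain ⟨rfl, h2⟩ := h2
  refine ⟨u, by simp [hA], fun p => ?_⟩
  have h3 : w.drop i = Sym.rel r :: ([] ++ ((RelAtom.vals ⟨r, u⟩).flatMap encodeVal ++
      (A₂.flatMap encodeAtom ++ R))) := by rw [drop_eq, hi, h2, List.nil_append]
  have h4 := (nth_record (noBit_atoms hR') _ p (by simp [RelAtom.vals]) i _ [] h3 (by simp)).2 _
    (hargs p)
  simpa [RelAtom.vals] using h4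

theorem exists_factAt (hw : w = l ++ (A.flatMap encodeAtom ++ R)) (hR' : NoBit R)
    {a : RelAtom S Val} (ha : a ∈ A) :
    ∃ i args, FactAt w a.rel i args ∧ ∀ p, ValAt w (args p) (a.args p) := by
  obtain ⟨A₁, A₂, rfl⟩ := List.append_of_mem ha
  obtain ⟨i, -, hi⟩ := exists_drop_eq (w := w) (l := l ++ A₁.flatMap encodeAtom)
    (L := encodeAtom a ++ (A₂.flatMap encodeAtom ++ R)) (by simp [encodeAtom]) (by simp [hw])
  rw [encodeAtom, List.cons_append] at hi
  have key := fun p : Fin (S.arity a.rel) =>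
    nth_record (noBit_atoms hR') _ p (by simp [RelAtom.vals]) i _ [] hi (by simp)
  choose args hargs using fun p => (key p).1
  refine ⟨i, args, ⟨(drop_eq_cons hi).1, hargs⟩, fun p => ?_⟩
  have h := (key p).2 _ (hargs p)
  simpa [RelAtom.vals] using h

/-- Every symbol that introduces a value is followed by the canonical binary representation of a
number, and the word does not start with a bit. -/
def Valid (l : List (Sym n)) : Prop :=
  NoBit l ∧ ∀ s rest, s.isValue = true → s :: rest <:+ l →
    ∃ v rest', s :: rest = encodeVal v ++ rest' ∧ NoBit rest'

theorem Valid.nil : Valid (n := n) [] := ⟨by simp [NoBit], fun s rest _ h => by simp at h⟩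

theorem Valid.cons {s : Sym n} {l : List (Sym n)} (hs : s.isValue = false) (hs' : s.isBit = false)
    (h : Valid l) : Valid (s :: l) := by
  refine ⟨NoBit.cons hs' l, fun s' rest hs₁ h₁ => ?_⟩
  rw [List.suffix_cons_iff] at h₁
  rcases h₁ with h₁ | h₁
  · rw [(List.cons.inj h₁).1, hs] at hs₁
    exact absurd hs₁ (by simp)
  · exact h.2 s' rest hs₁ h₁

theorem Valid.encodeVal_append {l : List (Sym n)} (h : Valid l) (v : Val) :
    Valid (encodeVal v ++ l) := by
  refine ⟨NoBit.encodeVal_append v l, fun s' rest hs₁ h₁ => ?_⟩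
  obtain ⟨s, bs, hv, -, -, hbs⟩ := encodeVal_eq (n := n) v
  rw [hv, List.cons_append, List.suffix_cons_iff] at h₁
  rcases h₁ with h₁ | h₁
  · exact ⟨v, l, by rw [h₁, hv, List.cons_append], h.1⟩
  · refine h.2 s' rest hs₁ (suffix_of_not_mem (p := fun x => x.isValue = true) hs₁ ?_ h₁)
    intro x hx
    rw [not_isValue_of_isBit (hbs x hx)]
    simp

theorem Valid.flatMap_append {β : Type} {f : β → List (Sym n)} {l : List β} {R : List (Sym n)}
    (hf : ∀ b ∈ l, ∀ L, Valid L → Valid (f b ++ L)) (hR : Valid R) :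
    Valid (l.flatMap f ++ R) := by
  induction l with
  | nil => exact hR
  | cons b l ih =>
    rw [List.flatMap_cons, List.append_assoc]
    exact hf b (by simp) _ (ih fun b hb => hf b (by simp [hb]))

theorem Valid.values_append {l : List Val} {R : List (Sym n)} (hR : Valid R) :
    Valid (l.flatMap encodeVal ++ R) :=
  Valid.flatMap_append (fun v _ _ h => h.encodeVal_append v) hR

theorem Valid.encodeTuple (t : Fin k → Cons) : Valid (n := n) (encodeTuple t) := by
  rw [encodeTuple_eq]
  exact Valid.cons rfl rfl (Valid.values_append Valid.nil)

theorem Valid.atoms_append (hR : Valid R) : Valid (A.flatMap encodeAtom ++ R) :=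
  Valid.flatMap_append (fun _ _ _ h => by
    rw [encodeAtom, List.cons_append]
    exact Valid.cons rfl rfl (Valid.values_append h)) hR

theorem Valid.exists_valAt {w : List (Sym n)} (h : Valid w) {i : Fin w.length}
    (hi : w[i].isValue = true) : ∃ v, ValAt w i v := by
  obtain ⟨v, rest, hv, hrest⟩ := h.2 w[i] (w.drop (i + 1)) hi (by
    rw [← drop_eq]
    exact List.drop_suffix _ _)
  exact ⟨v, valAt_of_drop (by rw [drop_eq, hv]) hrest⟩

theorem exists_valAt {l R : List (Sym n)} {vs : List Val} {w : List (Sym n)}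
    (hw : w = l ++ (vs.flatMap encodeVal ++ R)) (hR : NoBit R) {v : Val} (hv : v ∈ vs) :
    ∃ i, ValAt w i v := by
  obtain ⟨A₁, A₂, rfl⟩ := List.append_of_mem hv
  have hne : encodeVal (n := n) v ≠ [] := by cases v <;> simp [encodeVal]
  obtain ⟨i, -, hi⟩ := exists_drop_eq (w := w) (l := l ++ A₁.flatMap encodeVal)
    (L := encodeVal v ++ (A₂.flatMap encodeVal ++ R)) (by simp [hne]) (by simp [hw])
  exact ⟨i, valAt_of_drop hi
    (NoBit.flatMap_append A₂ (fun b _ L => NoBit.encodeVal_append b L) hR)⟩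

end Records

/-! ### Definability of the encoding -/

section Definable

variable {n r : ℕ} {ι : Type}

theorem Def.isBit (i : ι) : Def (Γ := Sym n) (r := r) ι fun w _ e => w[e i].isBit = true :=
  Def.letter Sym.isBit i

theorem Def.symbol (s : Sym n) (i : ι) : Def (r := r) ι fun w _ e => w[e i] = s :=
  (Def.letter (fun s' => decide (s' = s)) i).congr fun w _ e => by simp

/-- Values are compared digit by digit; this is what `Prog.same` is for. -/
theorem Def.token_eq (i j : ι) :
    Def (Γ := Sym n) (r := r) ι fun w _ e => token w (e i) = token w (e j) :=
  ((Def.forall_fintype fun s : Sym n => (Def.symbol s i).iff (Def.symbol s j)).and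
    (Def.same Sym.isBit i j)).congr fun w X e => by
      rw [token, token, List.cons.injEq]
      refine and_congr_left fun _ => ⟨fun h => ((h _).1 rfl).symm, fun h s => by rw [h]⟩

theorem Def.nxt (i j : ι) : Def (Γ := Sym n) (r := r) ι fun w _ e => Nxt w (e i) (e j) :=
  (Def.lt i j).and ((((Def.isBit j).not).congr fun w X e => by simp).and
    (Def.all₁ (Q := fun w _ e y => e i < y ∧ y < e j → Sym.isBit w[y] = true)
      (((Def.lt (Sum.inl i) (Sum.inr ())).and (Def.lt (Sum.inr ()) (Sum.inl j))).imp
        (Def.isBit (Sum.inr ())))))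

theorem Def.nth (k : ℕ) : ∀ {ι : Type} (i j : ι),
    Def (Γ := Sym n) (r := r) ι fun w _ e => Nth w k (e i) (e j) := by
  induction k with
  | zero => exact fun i j => Def.eq i j
  | succ k ih =>
    exact fun i j => Def.ex₁ (Q := fun w _ e y => Nxt w (e i) y ∧ Nth w k y (e j))
      ((Def.nxt (Sum.inl i) (Sum.inr ())).and (ih (Sum.inr ()) (Sum.inl j)))

theorem Def.factAt (s : Fin n) {k : ℕ} (i : ι) (args : Fin k → ι) :
    Def (r := r) ι fun w _ e => FactAt w s (e i) fun p => e (args p) :=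
  (Def.symbol (Sym.rel s) i).and (Def.forall_fintype fun p => Def.nth _ i (args p))

theorem Def.answerAt (p : ℕ) (j : ι) :
    Def (Γ := Sym n) (r := r) ι fun w _ e => AnswerAt w p (e j) :=
  Def.ex₁ (Q := fun w _ e i => w[i] = Sym.answer ∧ Nth w (p + 1) i (e j))
    ((Def.symbol Sym.answer (Sum.inr ())).and (Def.nth _ (Sum.inr ()) (Sum.inl j)))

/-- A fixed bit string can be recognized, by walking through it position by position. -/
theorem Def.bits (bs : List Bool) : ∀ {ι : Type} (i : ι), Def (Γ := Sym n) (r := r) ι fun w _ e =>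
    (w.drop (e i + 1)).takeWhile Sym.isBit = bs.map Sym.bit := by
  have hsucc : ∀ {ι : Type} (i j : ι),
      Def (Γ := Sym n) (r := r) ι fun w _ e => (e j : ℕ) = e i + 1 := by
    intro ι i j
    refine ((Def.lt i j).and (Def.all₁ (Q := fun w _ e y => ¬ (e i < y ∧ y < e j))
      ((Def.lt (Sum.inl i) (Sum.inr ())).and (Def.lt (Sum.inr ()) (Sum.inl j))).not)).congr
      fun w X e => ?_
    simp only [Fin.lt_def]
    constructor
    · rintro ⟨h1, h2⟩
      by_contra h3
      exact h2 ⟨e i + 1, by have := (e j).2; omega⟩ ⟨by simp only []; omega, by simp only []; omega⟩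
    · intro h
      exact ⟨by omega, fun y hy => by omega⟩
  induction bs with
  | nil =>
    intro ι i
    refine (Def.all₁ (Q := fun w _ e y => (y : ℕ) = e i + 1 → ¬ Sym.isBit w[y] = true)
      ((hsucc (Sum.inl i) (Sum.inr ())).imp (Def.isBit (Sum.inr ())).not)).congr fun w X e => ?_
    rw [List.map_nil, List.takeWhile_eq_nil_iff]
    constructor
    · intro h hl
      rw [List.get_eq_getElem, List.getElem_drop]
      exact h ⟨e i + 1, by rw [List.length_drop] at hl; omega⟩ rfl
    · intro h y hy
      have hl : 0 < (w.drop (e i + 1)).length := by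
        rw [List.length_drop]
        have := y.2
        omega
      have h' := h hl
      rw [List.get_eq_getElem, List.getElem_drop] at h'
      convert h' using 3
      simp [hy]
  | cons b bs ih =>
    intro ι i
    refine (Def.ex₁ (Q := fun w _ e y => (y : ℕ) = e i + 1 ∧ w[y] = Sym.bit b ∧
        (w.drop (y + 1)).takeWhile Sym.isBit = bs.map Sym.bit)
      ((hsucc (Sum.inl i) (Sum.inr ())).and
        ((Def.symbol (Sym.bit b) (Sum.inr ())).and (ih (Sum.inr ()))))).congr fun w X e => ?_
    constructor
    · rintro ⟨y, hy, hb, h⟩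
      rw [← hy, drop_eq w y, hb, List.takeWhile_cons_of_pos rfl, h, List.map_cons]
    · intro h
      have hl : (e i : ℕ) + 1 < w.length := by
        by_contra hl
        rw [List.drop_eq_nil_of_le (by omega)] at h
        simp at h
      let y : Fin w.length := ⟨e i + 1, hl⟩
      have h' : (w.drop y).takeWhile Sym.isBit = (b :: bs).map Sym.bit := h
      rw [drop_eq, List.takeWhile_cons, List.map_cons] at h'
      split_ifs at h' with hb
      · rw [List.cons.injEq] at h'
        exact ⟨y, rfl, h'⟩

theorem Def.valAt (v : Val) (i : ι) : Def (Γ := Sym n) (r := r) ι fun w _ e => ValAt w (e i) v := by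
  have key : ∀ (s : Sym n) (bs : List Bool), Def (r := r) ι fun w _ e =>
      token w (e i) = s :: bs.map Sym.bit := fun s bs =>
    ((Def.symbol s i).and (Def.bits bs i)).congr fun w X e => by rw [token, List.cons.injEq]
  cases v <;> exact key _ _

end Definable

/-! ### Constants of the input and of the query -/

section Elements

variable {n m : ℕ}

/-- The first coordinate of the element `a`, a tuple of positions, is written as the constant `c`. -/
def IsCst (w : List (Sym n)) (c : Cons) (a : Fin (m + 1) → Fin w.length) : Prop :=
  ValAt w (a 0) (.cst c)

open Classical in
/-- The constant that is written at the first coordinate. -/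
noncomputable def cstOf (w : List (Sym n)) (a : Fin (m + 1) → Fin w.length) : Option Cons :=
  if h : ∃ c, IsCst w c a then some h.choose else none

theorem cstOf_eq_some {w : List (Sym n)} {a : Fin (m + 1) → Fin w.length} {c : Cons} :
    cstOf w a = some c ↔ IsCst w c a := by
  constructor
  · intro h
    rw [cstOf] at h
    split_ifs at h with h'
    · rw [← Option.some.inj h]
      exact h'.choose_spec
  · intro h
    have h' : ∃ c, IsCst w c a := ⟨c, h⟩
    rw [cstOf, dif_pos h']
    exact congrArg some (Val.cst.inj (h'.choose_spec.unique h))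

/-- The first coordinates hold distinct constants. -/
def Differ (w : List (Sym n)) (a b : Fin (m + 1) → Fin w.length) : Prop :=
  w[a 0] = Sym.cst ∧ w[b 0] = Sym.cst ∧ ¬ token w (a 0) = token w (b 0)

theorem ValAt.symbol_eq {w : List (Sym n)} {i : Fin w.length} {v : Val} (h : ValAt w i v) :
    w[i] = (match v with
      | .cst _ => Sym.cst
      | .openNull _ => Sym.openNull
      | .closedNull _ => Sym.closedNull) := by
  rw [ValAt, token] at h
  cases v <;> exact (List.cons.inj h).1

theorem Valid.exists_cst {w : List (Sym n)} (hw : Valid w) {i : Fin w.length}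
    (h : w[i] = Sym.cst) : ∃ c, ValAt w i (.cst c) := by
  obtain ⟨v, hv⟩ := hw.exists_valAt (i := i) (by rw [h]; rfl)
  have h' := hv.symbol_eq
  rw [h] at h'
  cases v with
  | cst c => exact ⟨c, hv⟩
  | openNull => simp at h'
  | closedNull => simp at h'

theorem differ_iff {w : List (Sym n)} (hw : Valid w) (a b : Fin (m + 1) → Fin w.length) :
    Differ w a b ↔ ∃ c c', cstOf w a = some c ∧ cstOf w b = some c' ∧ c ≠ c' := by
  simp only [cstOf_eq_some]
  constructor
  · rintro ⟨ha, hb, hab⟩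
    obtain ⟨c, hc⟩ := hw.exists_cst ha
    obtain ⟨c', hc'⟩ := hw.exists_cst hb
    exact ⟨c, c', hc, hc', fun h => hab (hc.trans (h ▸ hc'.symm))⟩
  · rintro ⟨c, c', hc, hc', hne⟩
    refine ⟨hc.symbol_eq, hc'.symbol_eq, fun h => hne ?_⟩
    exact Val.cst.inj (encodeVal_injective (hc.symm.trans (h.trans hc')))

theorem Def.isCst {r : ℕ} (c : Cons) :
    Def (Γ := Sym n) (r := r) (Fin (m + 1)) fun w _ e => IsCst w c e :=
  Def.valAt _ 0

theorem Def.differ {r : ℕ} : Def (Γ := Sym n) (r := r) (Fin (m + 1) ⊕ Fin (m + 1)) fun w _ e =>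
    Differ w (fun j => e (Sum.inl j)) fun j => e (Sum.inr j) :=
  (Def.symbol _ (Sum.inl 0)).and ((Def.symbol _ (Sum.inr 0)).and
    (Def.token_eq (Sum.inl 0) (Sum.inr 0)).not)

end Elements

/-- The constants in a list of terms. -/
def termConstants (l : List Term) : List Val :=
  l.flatMap fun u => match u with
    | .var _ => []
    | .cst c => [Val.cst c]

theorem mem_termConstants {l : List Term} {c : Cons} (h : Term.cst c ∈ l) :
    Val.cst c ∈ termConstants l :=
  List.mem_flatMap.2 ⟨_, h, by simp⟩

theorem exists_var_bound (l : List Term) : ∃ V, ∀ x, Term.var x ∈ l → x ≤ V := by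
  induction l with
  | nil => exact ⟨0, by simp⟩
  | cons u l ih =>
    obtain ⟨V, hV⟩ := ih
    cases u with
    | var y =>
      refine ⟨max V y, fun x hx => ?_⟩
      rcases List.mem_cons.1 hx with h | h
      · rw [Term.var.inj h]
        exact le_max_right _ _
      · exact (hV x h).trans (le_max_left _ _)
    | cst c => exact ⟨V, fun x hx => hV x (by simpa using hx)⟩

/-- Queries with unequalities are monotone, because the unequalities compare values and do not refer
to the instance. -/
theorem UCQNeq.answers_mono {T : Schema} {k : ℕ} {q : UCQNeq T k} {J J' : Instance T}
    (h : ∀ f ∈ J, f ∈ J') {t : Fin k → Cons} (ht : t ∈ q.answers J) : t ∈ q.answers J' := by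
  obtain ⟨d, hd, ν, h1, h2, h3⟩ := ht
  exact ⟨d, hd, ν, h1, fun a ha => h _ (h2 a ha), h3⟩

theorem mem_certainOver {T : Schema} {k : ℕ} {q : UCQNeq T k} {W : Set (Instance T)}
    {t : Fin k → Cons} : t ∈ certainOver q W ↔ ∀ J ∈ W, t ∈ q.answers J := by
  simp [certainOver]

/-! ### Global conditions -/

section Clauses

variable {n : ℕ}

/-- The encoding of an unequality. -/
def encodeNeq (e : Val × Val) : List (Sym n) :=
  Sym.neq :: (encodeVal e.1 ++ encodeVal e.2)

/-- The encoding of a disjunction of unequalities. -/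
def encodeClause (δ : List (Val × Val)) : List (Sym n) :=
  Sym.clause :: δ.flatMap encodeNeq

/-- The unequality at `z` belongs to the clause at `c`. -/
def InClause (w : List (Sym n)) (c z : Fin w.length) : Prop :=
  c < z ∧ (∀ y, c < y ∧ y < z → ¬ w[y] = Sym.clause) ∧ w[z] = Sym.neq

/-- All unequalities of some clause are violated, because their sides are related by `E`. -/
def Blocked (w : List (Sym n)) (E : Fin w.length → Fin w.length → Prop) : Prop :=
  ∃ c, w[c] = Sym.clause ∧ ∀ z, InClause w c z → ∃ i j, Nth w 1 z i ∧ Nth w 2 z j ∧ E i j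

theorem Blocked.mono {w : List (Sym n)} {E E' : Fin w.length → Fin w.length → Prop}
    (h : ∀ i j, E i j → E' i j) (hE : Blocked w E) : Blocked w E' :=
  let ⟨c, hc, hz⟩ := hE
  ⟨c, hc, fun z hcz =>
    let ⟨i, j, hi, hj, hij⟩ := hz z hcz
    ⟨i, j, hi, hj, h i j hij⟩⟩

theorem mem_encodeNeq {e : Val × Val} {x : Sym n} (h : x ∈ encodeVal e.1 ++ encodeVal e.2) :
    x.isValue = true ∨ x.isBit = true := by
  rcases List.mem_append.1 h with h | h <;> exact mem_encodeVal h

theorem mem_clause {δ : List (Val × Val)} {x : Sym n} (h : x ∈ δ.flatMap encodeNeq) :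
    x = Sym.neq ∨ x.isValue = true ∨ x.isBit = true := by
  obtain ⟨e, -, hx⟩ := List.mem_flatMap.1 h
  rcases List.mem_cons.1 hx with h | h
  · exact .inl h
  · exact .inr (mem_encodeNeq h)

theorem encodeNeq_record {e : Val × Val} {L rest : List (Sym n)} (h : L = encodeNeq e ++ rest) :
    L = Sym.neq :: ([] ++ ([e.1, e.2].flatMap encodeVal ++ rest)) := by
  simp [h, encodeNeq]

variable {w l R : List (Sym n)} {φ : List (List (Val × Val))}

theorem noBit_clauses (hR : NoBit R) : NoBit (φ.flatMap encodeClause ++ R) :=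
  NoBit.flatMap_append φ (fun _ _ _ => NoBit.cons rfl _) hR

theorem noBit_neqs {δ : List (Val × Val)} (hR : NoBit R) : NoBit (δ.flatMap encodeNeq ++ R) :=
  NoBit.flatMap_append δ (fun _ _ _ => NoBit.cons rfl _) hR

theorem drop_of_suffix {c z : Fin w.length} (h : c < z) : w.drop z <:+ w.drop (c + 1) := by
  have : (z : ℕ) = (c + 1) + (z - (c + 1)) := by
    have := Fin.lt_def.1 h
    omega
  rw [this, ← List.drop_drop]
  exact List.drop_suffix _ _

/-- The unequalities that belong to a clause in the sense of `InClause` are written in it. -/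
theorem inClause_sound (hR : ∀ x ∈ R, x ≠ Sym.neq) {c z : Fin w.length} {δ : List (Val × Val)}
    (hc : w.drop c = encodeClause δ ++ (φ.flatMap encodeClause ++ R)) (hz : InClause w c z) :
    ∃ e ∈ δ, ∃ δ', w.drop z = encodeNeq e ++ (δ' ++ (φ.flatMap encodeClause ++ R)) ∧
      (∀ L, NoBit L → NoBit (δ' ++ L)) := by
  obtain ⟨hcz, hbetween, hneq⟩ := hz
  rw [encodeClause, List.cons_append] at hc
  have hsuf := drop_of_suffix hcz
  rw [(drop_eq_cons hc).2, drop_eq, hneq] at hsuf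
  obtain ⟨δ₁, e, δ₂, rfl, h⟩ := exists_block (p := fun x => x = Sym.neq) (f := encodeNeq)
    (fun e => ⟨_, _, rfl, fun x hx => by
      rintro rfl
      rcases mem_encodeNeq hx with h | h <;> simp [Sym.isBit, Sym.isValue] at h⟩) rfl (by
    -- otherwise the clause marker that follows would stand between `c` and `z`
    intro h
    cases φ with
    | nil => exact hR _ (h.subset List.mem_cons_self) rfl
    | cons δ' φ =>
      obtain ⟨y, hy, hy'⟩ := exists_drop_eq (w := w) (l := w.take (c + 1) ++ δ.flatMap encodeNeq)
        (L := (δ' :: φ).flatMap encodeClause ++ R) (by simp [encodeClause])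
        ((List.take_append_drop (c + 1 : ℕ) w).symm.trans (by
          rw [(drop_eq_cons hc).2, List.append_assoc]))
      have hyc : w[y] = Sym.clause := by
        rw [List.flatMap_cons, encodeClause, List.cons_append, List.cons_append] at hy'
        exact (drop_eq_cons hy').1
      rw [← hneq, ← drop_eq, ← hy'] at h
      have hlen := h.length_le
      rw [List.length_drop, List.length_drop] at hlen
      have hcl := c.2
      have hzl := z.2
      have hyl := y.2
      have hcy : (c : ℕ) < y := by
        rw [hy, List.length_append, List.length_take]
        omega
      have hyz : y ≠ z := fun h => by
        subst h
        exact absurd (hyc.symm.trans hneq) (by simp)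
      have hyz' : (y : ℕ) ≠ z := fun h => hyz (Fin.ext h)
      exact hbetween y ⟨hcy, Fin.lt_def.2 (by omega)⟩ hyc) δ hsuf
  refine ⟨e, by simp, _, by rw [drop_eq, hneq, h], fun L hL => noBit_neqs hL⟩

/-- Every unequality of a clause belongs to it in the sense of `InClause`. -/
theorem exists_inClause (hR : NoBit R) {c : Fin w.length} {δ : List (Val × Val)}
    (hc : w.drop c = encodeClause δ ++ (φ.flatMap encodeClause ++ R)) {e : Val × Val}
    (he : e ∈ δ) : ∃ z, InClause w c z ∧ ∃ rest, w.drop z = encodeNeq e ++ rest ∧ NoBit rest := by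
  obtain ⟨δ₁, δ₂, rfl⟩ := List.append_of_mem he
  rw [encodeClause, List.cons_append] at hc
  have hc' := (drop_eq_cons hc).2
  rw [List.flatMap_append, List.flatMap_cons, List.append_assoc, List.append_assoc] at hc'
  have htake := (List.take_append_drop (c + 1 : ℕ) w).symm
  rw [hc'] at htake
  obtain ⟨z, hz, hz'⟩ := exists_drop_eq (w := w) (l := w.take (c + 1) ++ δ₁.flatMap encodeNeq)
    (L := encodeNeq e ++ (δ₂.flatMap encodeNeq ++ (φ.flatMap encodeClause ++ R)))
    (by simp [encodeNeq]) (htake.trans (by rw [List.append_assoc]))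
  have hcl := c.2
  rw [List.length_append, List.length_take, min_eq_left (by omega)] at hz
  refine ⟨z, ⟨Fin.lt_def.2 (by omega), fun y hy hyc => ?_, ?_⟩, _, hz',
    noBit_neqs (noBit_clauses hR)⟩
  · obtain ⟨hy1, hy2⟩ := hy
    rw [Fin.lt_def] at hy1 hy2
    have h1 : (w.drop (c + 1))[y - (c + 1 : ℕ)]? = some w[y] := by
      rw [List.getElem?_drop, Nat.add_sub_cancel' (by omega)]
      exact List.getElem?_eq_getElem y.2
    rw [hc', List.getElem?_append_left (by omega), hyc] at h1
    rcases mem_clause (List.mem_of_getElem? h1) with h | h | h <;>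
      simp [Sym.isBit, Sym.isValue] at h
  · rw [encodeNeq, List.cons_append] at hz'
    exact (drop_eq_cons hz').1

/-- Under a valuation, `Blocked` says that the global condition is violated. -/
theorem blocked_iff (hw : w = l ++ (φ.flatMap encodeClause ++ R)) (hl : ∀ x ∈ l, x ≠ Sym.clause)
    (hR : ∀ x ∈ R, x ≠ Sym.clause ∧ x ≠ Sym.neq) (hR' : NoBit R) {val : Fin w.length → Cons}
    {u : Val → Cons} (hval : ∀ i v, ValAt w i v → val i = u v) :
    Blocked w (fun i j => val i = val j) ↔ ∃ δ ∈ φ, ∀ e ∈ δ, u e.1 = u e.2 := by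
  have hrec : ∀ (e : Val × Val) (z : Fin w.length) (rest : List (Sym n)), NoBit rest →
      w.drop z = encodeNeq e ++ rest → ((∃ i, Nth w 1 z i) ∧ ∀ i, Nth w 1 z i → val i = u e.1) ∧
        (∃ i, Nth w 2 z i) ∧ ∀ i, Nth w 2 z i → val i = u e.2 := by
    intro e z rest hrest hz
    have h := encodeNeq_record hz
    have h1 := nth_record hrest _ 0 (by simp) z _ [] h (by simp)
    have h2 := nth_record hrest _ 1 (by simp) z _ [] h (by simp)
    exact ⟨⟨h1.1, fun i hi => hval i _ (h1.2 i hi)⟩, h2.1, fun i hi => hval i _ (h2.2 i hi)⟩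
  constructor
  · rintro ⟨c, hc, hz⟩
    have hsuf : w.drop c <:+ w := List.drop_suffix _ _
    rw [drop_eq, hc] at hsuf
    nth_rw 3 [hw] at hsuf
    obtain ⟨φ₁, δ, φ₂, rfl, h⟩ := exists_block (p := fun x => x = Sym.clause) (f := encodeClause)
      (fun δ => ⟨_, _, rfl, fun x hx => by
        rintro rfl
        rcases mem_clause hx with h | h | h <;> simp [Sym.isBit, Sym.isValue] at h⟩) rfl
      (fun h => (hR _ (h.subset List.mem_cons_self)).1 rfl) φ
      (suffix_of_not_mem (p := fun x => x = Sym.clause) rfl hl hsuf)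
    rw [← hc, ← drop_eq] at h
    refine ⟨δ, by simp, fun e he => ?_⟩
    obtain ⟨z, hcz, rest, hz', hrest⟩ := exists_inClause hR' h he
    obtain ⟨i, j, hi, hj, hij⟩ := hz z hcz
    obtain ⟨⟨-, h1⟩, -, h2⟩ := hrec e z rest hrest hz'
    rw [← h1 i hi, ← h2 j hj, hij]
  · rintro ⟨δ, hδ, h⟩
    obtain ⟨φ₁, φ₂, rfl⟩ := List.append_of_mem hδ
    obtain ⟨c, -, hc⟩ := exists_drop_eq (w := w) (l := l ++ φ₁.flatMap encodeClause)
      (L := encodeClause δ ++ (φ₂.flatMap encodeClause ++ R)) (by simp [encodeClause])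
      (by simp [hw])
    refine ⟨c, ?_, fun z hz => ?_⟩
    · rw [encodeClause, List.cons_append] at hc
      exact (drop_eq_cons hc).1
    · obtain ⟨e, he, δ', hz', hδ'⟩ := inClause_sound (fun x hx => (hR x hx).2) hc hz
      obtain ⟨⟨⟨i, hi⟩, h1⟩, ⟨j, hj⟩, h2⟩ := hrec e z _ (hδ' _ (noBit_clauses hR')) hz'
      exact ⟨i, j, hi, hj, (h1 i hi).trans ((h e he).trans (h2 j hj).symm)⟩

theorem Def.blocked : Def (Γ := Sym n) (r := 1 + 1) (Fin 0) fun w X _ =>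
    Blocked w fun i j => ABDExchange.asBinary X (fun _ => i) fun _ => j := by
  refine Def.ex₁ (Q := fun w X _ c => w[c] = Sym.clause ∧ ∀ z, InClause w c z →
    ∃ i j, Nth w 1 z i ∧ Nth w 2 z j ∧ ABDExchange.asBinary X (fun _ => i) fun _ => j) ?_
  refine (Def.symbol _ (Sum.inr ())).and (Def.all₁ (Q := fun w X e z =>
    InClause w (e (Sum.inr ())) z → ∃ i j, Nth w 1 z i ∧ Nth w 2 z j ∧
      ABDExchange.asBinary X (fun _ => i) fun _ => j) (Def.imp ?_ ?_))
  · refine (Def.lt (Sum.inl (Sum.inr ())) (Sum.inr ())).and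
      ((Def.all₁ (Q := fun w X e y => e (Sum.inl (Sum.inr ())) < y ∧ y < e (Sum.inr ()) →
        ¬ w[y] = Sym.clause) ?_).and (Def.symbol _ (Sum.inr ())))
    exact ((Def.lt (Sum.inl (Sum.inl (Sum.inr ()))) (Sum.inr ())).and
      (Def.lt (Sum.inr ()) (Sum.inl (Sum.inr ())))).imp (Def.symbol _ (Sum.inr ())).not
  · refine Def.ex₁ (Q := fun w X e i => ∃ j, Nth w 1 (e (Sum.inr ())) i ∧
      Nth w 2 (e (Sum.inr ())) j ∧ ABDExchange.asBinary X (fun _ => i) fun _ => j) (Def.ex₁ (Q := fun w X e j =>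
        Nth w 1 (e (Sum.inl (Sum.inr ()))) (e (Sum.inr ())) ∧
        Nth w 2 (e (Sum.inl (Sum.inr ()))) j ∧
        ABDExchange.asBinary X (fun _ => e (Sum.inr ())) fun _ => j) ?_)
    exact (Def.nth 1 (Sum.inl (Sum.inl (Sum.inr ()))) (Sum.inl (Sum.inr ()))).and
      ((Def.nth 2 (Sum.inl (Sum.inl (Sum.inr ()))) (Sum.inr ())).and
        (Def.asBinary (fun _ => Sum.inl (Sum.inr ())) fun _ => Sum.inr ()))

end Clauses

/-! ### Certain answers over tables -/

section Tables

variable {T : Schema} {k m V : ℕ}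

/-- The facts of a table, with tuples of positions as entries, of which only the first coordinate
matters. -/
def TableFact (w : List (Sym T.size)) (f : RelAtom T (Fin (m + 1) → Fin w.length)) : Prop :=
  ∃ i, FactAt w f.rel i fun p => f.args p 0

/-- The elements that are an entry of the answer tuple. -/
def IsAnswer {n : ℕ} (w : List (Sym n)) (p : Fin k) (a : Fin (m + 1) → Fin w.length) : Prop :=
  AnswerAt w p (a 0)

theorem Def.isAnswer {n r : ℕ} (p : Fin k) :
    Def (Γ := Sym n) (r := r) (Fin (m + 1)) fun w _ e => IsAnswer w p e :=
  Def.answerAt _ 0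

theorem Def.tableFact {r : ℕ} (R : Fin T.size) :
    Def (r := r) (Fin (T.arity R) × Fin (m + 1)) fun w _ e =>
      TableFact w (⟨R, fun p j => e (p, j)⟩ : RelAtom T (Fin (m + 1) → Fin w.length)) :=
  Def.ex₁ (Q := fun w _ e i => FactAt w R i fun p => e (p, 0))
    (Def.factAt R (Sum.inr ()) fun p => Sum.inl (p, 0))

/-- The instance that a single valuation of the nulls makes of a table. -/
noncomputable def CondTable.instantiate (D : CondTable T) (u : Val → Cons) : Instance T :=
  (D.table.map fun a => a.map u).toFinset

/-- A tuple is missed by some represented instance if and only if it is missed under a single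
valuation: of the valuations of the open nulls all but one can be dropped, which makes the instance
smaller and the global condition weaker. -/
theorem CondTable.exists_rep_iff {D : CondTable T} {q : UCQNeq T k} {t : Fin k → Cons} :
    (∃ J ∈ D.Rep, t ∉ q.answers J) ↔ ∃ v w : ℕ → Cons,
      t ∉ q.answers (D.instantiate (Val.eval v w)) ∧
        ∀ δ ∈ D.cond, ∃ e ∈ δ, e.1.eval v w ≠ e.2.eval v w := by
  constructor
  · rintro ⟨J, ⟨N, hN, v, vs, hcond, hJ⟩, ht⟩
    let i : Fin N := ⟨0, hN⟩
    refine ⟨v, vs i, fun h => ht (UCQNeq.answers_mono ?_ h), fun δ hδ => ?_⟩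
    · intro f hf
      simp only [CondTable.instantiate, List.mem_toFinset, List.mem_map] at hf
      exact (hJ f).2 ⟨i, hf⟩
    · obtain ⟨e, he, hs⟩ := hcond δ hδ
      exact ⟨e, he, hs i i⟩
  · rintro ⟨v, w, ht, hcond⟩
    refine ⟨_, ⟨1, le_rfl, v, fun _ => w, fun δ hδ => ?_, fun f => ?_⟩, ht⟩
    · obtain ⟨e, he, hs⟩ := hcond δ hδ
      exact ⟨e, he, fun _ _ => hs⟩
    · simp [CondTable.instantiate]

theorem encodeCond_eq {n : ℕ} (φ : List (List (Val × Val))) :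
    encodeCond (n := n) φ = φ.flatMap encodeClause := rfl

theorem mem_encodeTuple {n : ℕ} {t : Fin k → Cons} {x : Sym n} (h : x ∈ encodeTuple t) :
    x = Sym.answer ∨ x.isValue = true ∨ x.isBit = true := by
  rw [encodeTuple_eq, List.append_nil] at h
  rcases List.mem_cons.1 h with h | h
  · exact .inl h
  · exact .inr (mem_flatMap_encodeVal h)

theorem mem_encodeCond {n : ℕ} {φ : List (List (Val × Val))} {x : Sym n} (h : x ∈ encodeCond φ) :
    x = Sym.clause ∨ x = Sym.neq ∨ x.isValue = true ∨ x.isBit = true := by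
  obtain ⟨δ, -, hx⟩ := List.mem_flatMap.1 h
  rcases List.mem_cons.1 hx with h | h
  · exact .inl h
  · exact .inr (mem_clause h)

theorem mem_encodeAtoms {S : Schema} {A : List (RelAtom S Val)} {x : Sym S.size}
    (h : x ∈ A.flatMap encodeAtom) :
    (∃ r, x = Sym.rel r) ∨ x.isValue = true ∨ x.isBit = true := by
  obtain ⟨a, -, hx⟩ := List.mem_flatMap.1 h
  rcases List.mem_cons.1 hx with h | h
  · exact .inl ⟨_, h⟩
  · exact .inr (mem_flatMap_encodeVal h)

variable (vs : List Val) (D : CondTable T) (t : Fin k → Cons)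

/-- The encoding of a table and a tuple behind some values. -/
abbrev tableWord : List (Sym T.size) := vs.flatMap encodeVal ++ encodeTableInput (D, t)

theorem tableWord_valid : Valid (tableWord vs D t) := by
  rw [tableWord, encodeTableInput, List.append_assoc]
  refine Valid.values_append (Valid.atoms_append (Valid.flatMap_append (fun δ _ L hL => ?_)
    (Valid.encodeTuple t)))
  rw [List.cons_append]
  refine Valid.cons rfl rfl (Valid.flatMap_append (fun e _ L hL => ?_) hL)
  rw [List.cons_append, List.append_assoc]
  exact Valid.cons rfl rfl ((hL.encodeVal_append _).encodeVal_append _)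

theorem noBit_encodeTuple {n : ℕ} : NoBit (n := n) (encodeTuple t) := (Valid.encodeTuple t).1

/-- A valuation of the elements that comes from a valuation of the nulls satisfies the egds and denials
of the query and of the global condition if and only if the instance avoids the tuple and the global
condition holds. -/
theorem table_conditions_iff {q : UCQNeq T k} (hq : q.AtMostOneNeq)
    (hV : ∀ d ∈ q, ∀ x, Term.var x ∈ d.terms → x ≤ V)
    (hC : ∀ d ∈ q, ∀ c, Term.cst c ∈ d.terms → Val.cst c ∈ vs)
    {val : (Fin (0 + 1) → Fin (tableWord vs D t).length) → Cons} {v v' : ℕ → Cons}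
    (hval : ∀ a u, ValAt (tableWord vs D t) (a 0) u → val a = u.eval v v') :
    ((∀ a b, q.Forces V (Ker val) (IsCst _) (IsAnswer _) (TableFact _) a b → val a = val b) ∧
      ¬ (q.Returns V (Ker val) (IsCst _) (IsAnswer _) (TableFact _) ∨
        Blocked (tableWord vs D t) fun i j => Ker val (fun _ => i) fun _ => j)) ↔
    t ∉ q.answers (D.instantiate (Val.eval v v')) ∧
      ∀ δ ∈ D.cond, ∃ e ∈ δ, e.1.eval v v' ≠ e.2.eval v v' := by
  generalize hw : tableWord vs D t = w at *
  have hw1 : w = vs.flatMap encodeVal ++ (D.table.flatMap encodeAtom ++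
      (encodeCond D.cond ++ encodeTuple t)) := by
    rw [← hw, tableWord, encodeTableInput, List.append_assoc]
  have hR : NoBit (n := T.size) (encodeCond D.cond ++ encodeTuple t) :=
    noBit_clauses (noBit_encodeTuple t)
  have hw2 : w = (vs.flatMap encodeVal ++ D.table.flatMap encodeAtom) ++
      (D.cond.flatMap encodeClause ++ encodeTuple t) := by
    rw [hw1, List.append_assoc, encodeCond_eq]
  have hw3 : w = (vs.flatMap encodeVal ++ (D.table.flatMap encodeAtom ++ encodeCond D.cond)) ++
      encodeTuple t := by
    rw [hw1]
    simp only [List.append_assoc]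
  have hl3 : ∀ x ∈ vs.flatMap encodeVal ++ (D.table.flatMap encodeAtom ++ encodeCond D.cond),
      x ≠ Sym.answer := by
    rintro x hx rfl
    rcases List.mem_append.1 hx with h | h
    · have := mem_flatMap_encodeVal h
      simp [Sym.isBit, Sym.isValue] at this
    · rcases List.mem_append.1 h with h | h
      · have := mem_encodeAtoms h
        simp [Sym.isBit, Sym.isValue] at this
      · have := mem_encodeCond h
        simp [Sym.isBit, Sym.isValue] at this
  have hAns : ∀ (p : Fin k) (e : Fin (0 + 1) → Fin w.length), IsAnswer w p e → val e = t p :=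
    fun p e he => hval e _ (answerAt_sound hw3 hl3 p he)
  have hAns' : ∀ p : Fin k, ∃ e : Fin (0 + 1) → Fin w.length, IsAnswer w p e := fun p =>
    let ⟨j, hj⟩ := exists_answerAt hw3 p
    ⟨fun _ => j, hj⟩
  have hC' : ∀ d ∈ q, ∀ c, Term.cst c ∈ d.terms → ∃ b : Fin (0 + 1) → Fin w.length, IsCst w c b :=
    fun d hd c hc =>
      let ⟨i, hi⟩ := exists_valAt (l := []) hw1 (noBit_atoms hR) (hC d hd c hc)
      ⟨fun _ => i, hi⟩
  have hJ : ∀ f, f ∈ D.instantiate (Val.eval v v') ↔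
      ∃ g : RelAtom T (Fin (0 + 1) → Fin w.length), TableFact w g ∧ g.map val = f := by
    intro f
    simp only [CondTable.instantiate, List.mem_toFinset, List.mem_map]
    constructor
    · rintro ⟨a, ha, rfl⟩
      obtain ⟨i, args, hi, hargs⟩ := exists_factAt hw1 hR ha
      refine ⟨⟨a.rel, fun p _ => args p⟩, ⟨i, hi⟩, ?_⟩
      simp only [RelAtom.map, RelAtom.mk.injEq, heq_eq_eq, true_and]
      exact funext fun p => hval _ _ (hargs p)
    · rintro ⟨⟨r, args⟩, ⟨i, hi⟩, rfl⟩
      obtain ⟨u, hu, hargs⟩ := factAt_sound hw1 (fun x hx r hr => by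
          have := mem_flatMap_encodeVal hx
          simp [hr, Sym.isBit, Sym.isValue] at this) (fun x hx r hr => by
          rcases List.mem_append.1 hx with h | h
          · have := mem_encodeCond h
            simp [hr, Sym.isBit, Sym.isValue] at this
          · have := mem_encodeTuple h
            simp [hr, Sym.isBit, Sym.isValue] at this) hR hi
      refine ⟨_, hu, ?_⟩
      simp only [RelAtom.map, RelAtom.mk.injEq, heq_eq_eq, true_and]
      exact funext fun p => (hval _ _ (hargs p)).symm
  have hne : Nonempty (Fin (0 + 1) → Fin w.length) := by
    have : 0 < w.length := by
      rw [hw3, encodeTuple]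
      simp
    exact ⟨fun _ => ⟨0, this⟩⟩
  have hblock : Blocked w (fun i j => Ker val (fun _ => i) fun _ => j) ↔
      ∃ δ ∈ D.cond, ∀ e ∈ δ, e.1.eval v v' = e.2.eval v v' := by
    refine blocked_iff (val := fun i => val fun _ => i) (u := Val.eval v v') hw2 ?_ ?_
      (noBit_encodeTuple t) (fun i u hu => hval _ _ hu)
    · rintro x hx rfl
      rcases List.mem_append.1 hx with h | h
      · have := mem_flatMap_encodeVal h
        simp [Sym.isBit, Sym.isValue] at this
      · have := mem_encodeAtoms h
        simp [Sym.isBit, Sym.isValue] at this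
    · intro x hx
      have := mem_encodeTuple hx
      constructor <;> rintro rfl <;> simp [Sym.isBit, Sym.isValue] at this
  rw [not_or, ← and_assoc, hblock,
    UCQNeq.not_mem_answers_iff hq (fun c b h => hval b _ h) hAns hAns' hV hC' hJ]
  push Not
  rfl

open Classical in
/-- The certain answers over a table are computed in polynomial time, by a chase whose elements are the
positions of the input, with positions of the same value merged.  The constants of the query are
written in front of the input, so that they are elements, too. -/
theorem polyTime_table {q : UCQNeq T k} (hq : q.AtMostOneNeq)
    (g : CondTable T × (Fin k → Cons) → Bool)
    (hg : ∀ x, g x = true ↔ x.2 ∈ certainOver q x.1.Rep) : PolyTime encodeTableInput g := by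
  obtain ⟨V, hV⟩ := exists_var_bound (q.flatMap CQNeq.terms)
  have hV' : ∀ d ∈ q, ∀ x, Term.var x ∈ d.terms → x ≤ V := fun d hd x hx =>
    hV x (List.mem_flatMap.2 ⟨d, hd, hx⟩)
  let vs := termConstants (q.flatMap CQNeq.terms)
  have hC : ∀ d ∈ q, ∀ c, Term.cst c ∈ d.terms → Val.cst c ∈ vs := fun d hd c hc =>
    mem_termConstants (List.mem_flatMap.2 ⟨d, hd, hc⟩)
  refine polyTime_of_chase (m := 0 + 1)
    (Op := fun w E a b => token w (a 0) = token w (b 0) ∨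
      q.Forces V E (IsCst w) (IsAnswer w) (TableFact w) a b)
    (Den := fun w E => q.Returns V E (IsCst w) (IsAnswer w) (TableFact w) ∨
      Blocked w fun i j => E (fun _ => i) fun _ => j)
    (Diff := Differ)
    ((Def.token_eq (Sum.inl 0) (Sum.inr 0)).or
      (Def.forces Def.isCst Def.tableFact Def.isAnswer q V))
    ((Def.returns Def.isCst Def.tableFact Def.isAnswer q V).or Def.blocked) Def.differ
    (fun w L L' h a b => Or.imp_right (UCQNeq.Forces.mono h))
    (fun w L L' h => Or.imp (UCQNeq.Returns.mono h) (Blocked.mono fun i j => h _ _))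
    encodeTableInput g (vs.flatMap encodeVal) (fun x => cstOf _)
    (fun x L a b c ha hb => .inl ((cstOf_eq_some.1 ha).trans (cstOf_eq_some.1 hb).symm))
    (fun x a b => differ_iff (tableWord_valid vs x.1 x.2) a b) ?_
  rintro ⟨D, t⟩
  have hmem : g (D, t) = false ↔ ∃ J ∈ D.Rep, t ∉ q.answers J := by
    rw [← Bool.not_eq_true, hg, mem_certainOver]
    push Not
    rfl
  rw [hmem, CondTable.exists_rep_iff]
  constructor
  · rintro ⟨v, v', h⟩
    let val : (Fin (0 + 1) → Fin (tableWord vs D t).length) → Cons := fun a =>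
      if h : ∃ u, ValAt (tableWord vs D t) (a 0) u then h.choose.eval v v' else 0
    have hval : ∀ a u, ValAt (tableWord vs D t) (a 0) u → val a = u.eval v v' := by
      intro a u hu
      have h : ∃ u, ValAt (tableWord vs D t) (a 0) u := ⟨u, hu⟩
      simp only [val, dif_pos h]
      rw [h.choose_spec.unique hu]
    obtain ⟨h1, h2⟩ := (table_conditions_iff vs D t hq hV' hC hval).2 h
    refine ⟨val, fun a c hc => hval a _ (cstOf_eq_some.1 hc), ?_, h2⟩
    rintro a b (hab | hab)
    · by_cases ha : ∃ u, ValAt (tableWord vs D t) (a 0) u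
      · obtain ⟨u, hu⟩ := ha
        rw [hval a u hu, hval b u (hab.symm.trans hu)]
      · have hb : ¬ ∃ u, ValAt (tableWord vs D t) (b 0) u := fun ⟨u, hu⟩ => ha ⟨u, hab.trans hu⟩
        simp only [val, dif_neg ha, dif_neg hb]
    · exact h1 a b hab
  · rintro ⟨val, hcst, hop, hden⟩
    obtain ⟨pick, hpick⟩ : ∃ pick : Val → Cons,
        ∀ a u, ValAt (tableWord vs D t) (a 0) u → val a = pick u := by
      refine ⟨fun u => if h : ∃ a : Fin (0 + 1) → Fin (tableWord vs D t).length,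
        ValAt (tableWord vs D t) (a 0) u then val h.choose else 0, fun a u hu => ?_⟩
      have h : ∃ a : Fin (0 + 1) → Fin (tableWord vs D t).length,
        ValAt (tableWord vs D t) (a 0) u := ⟨a, hu⟩
      simp only [dif_pos h]
      exact hop _ _ (.inl (hu.trans h.choose_spec.symm))
    have hval : ∀ a u, ValAt (tableWord vs D t) (a 0) u →
        val a = u.eval (fun N => pick (.closedNull N)) fun N => pick (.openNull N) := by
      rintro a (c | N | N) hu
      · exact hcst a c (cstOf_eq_some.2 hu)
      · exact hpick a _ hu
      · exact hpick a _ hu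
    exact ⟨_, _, (table_conditions_iff vs D t hq hV' hC hval).1
      ⟨fun a b h => hop a b (.inr h), hden⟩⟩

end Tables

/-! ### The canonical target facts -/

/-- If a value occurs at most once in the image of a list, then it has at most one preimage there. -/
theorem eq_of_count_map_le_one {α β : Type} [BEq β] [LawfulBEq β] {g : α → β} {l : List α} {b : β}
    (h : (l.map g).count b ≤ 1) {x y : α} (hx : x ∈ l) (hy : y ∈ l) (hgx : g x = b)
    (hgy : g y = b) : x = y := by
  induction l with
  | nil => simp at hx
  | cons z l ih =>
    have hmem : ∀ x ∈ l, g x = b → 1 ≤ (l.map g).count b := fun x hx hgx =>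
      List.one_le_count_iff.2 (List.mem_map.2 ⟨x, hx, hgx⟩)
    rw [List.map_cons, List.count_cons] at h
    rcases List.mem_cons.1 hx with hxz | hx' <;> rcases List.mem_cons.1 hy with hyz | hy'
    · rw [hxz, hyz]
    · rw [if_pos (by rw [← hxz, hgx]; simp)] at h
      have := hmem y hy' hgy
      omega
    · rw [if_pos (by rw [← hyz, hgy]; simp)] at h
      have := hmem x hx' hgx
      omega
    · exact ih (by omega) hx' hy'

/-- Under annotation density one, the annotated relation symbol of a head atom determines the abd
and the atom. -/
theorem Mapping.head_unique {S T : Schema} {M : Mapping S T} (hM : M.density = 1) {ξ ξ' : ABD S T}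
    (hξ : ξ ∈ M.abds) (hξ' : ξ' ∈ M.abds) {a a' : AnnAtom T Var} (ha : a ∈ ξ.head)
    (ha' : a' ∈ ξ'.head) (hrel : a'.1.rel = a.1.rel) (hann : a'.2 = a.2) : ξ' = ξ ∧ a' = a := by
  have hcount : M.annOccurrences.count (a.1.rel, a.2) ≤ 1 := by
    have h1 : M.relDensity a.1.rel ≤ M.density :=
      Finset.le_sup (f := M.relDensity) (Finset.mem_univ _)
    have h2 : M.annOccurrences.count (a.1.rel, a.2) ≤ M.relDensity a.1.rel := by
      refine Finset.le_sup (f := fun i => M.annOccurrences.count (a.1.rel, i)) ?_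
      rw [List.mem_toFinset, List.mem_map]
      exact ⟨(a.1.rel, a.2), List.mem_flatMap.2 ⟨ξ, hξ, List.mem_map.2 ⟨a, ha, rfl⟩⟩, rfl⟩
    omega
  have hocc : M.annOccurrences = (M.abds.flatMap fun ξ => ξ.head.map fun a => (ξ, a)).map
      fun x => (x.2.1.rel, x.2.2) := by
    rw [Mapping.annOccurrences, List.map_flatMap]
    simp only [List.map_map, Function.comp_def]
  rw [hocc] at hcount
  have key : ∀ {ξ : ABD S T} {a : AnnAtom T Var}, ξ ∈ M.abds → a ∈ ξ.head →
      (ξ, a) ∈ M.abds.flatMap fun ξ => ξ.head.map fun a => (ξ, a) := fun hξ ha =>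
    List.mem_flatMap.2 ⟨_, hξ, List.mem_map.2 ⟨_, ha, rfl⟩⟩
  have h := eq_of_count_map_le_one hcount (key hξ' ha') (key hξ ha)
    (by simp only [hrel, hann]) rfl
  exact ⟨congrArg Prod.fst h, congrArg Prod.snd h⟩

section Canonical

variable {S T : Schema} {U : ℕ}

/-- An atom over the source schema is a fact of the encoded instance, under the assignment `μ` of
positions to variables. -/
def SrcHolds (w : List (Sym S.size)) (μ : Fin (U + 1) → Fin w.length) (b : RelAtom S Var) : Prop :=
  ∃ i, ∃ args : Fin (S.arity b.rel) → Fin w.length, FactAt w b.rel i args ∧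
    ∀ p, token w (args p) = token w (μ (Fin.ofNat (U + 1) (b.args p)))

/-- The variables shared by body and head, as a list. -/
def ABD.shared (ξ : ABD S T) : List Var := ξ.bodyVars.filter (· ∈ ξ.headVars)

theorem ABD.mem_shared {ξ : ABD S T} {x : Var} : x ∈ ξ.shared ↔ ξ.IsShared x := by
  simp [ABD.shared, ABD.IsShared]

/-- The name of the null that witnesses the variable `z` in the abd with the number `idx`. -/
def nullTag (idx : ℕ) (z : Var) : Val := .openNull (Nat.pair idx z)

/-- The element `a` is the value of the head variable `x` if the body of the abd `ξ` with the number
`idx` is mapped to the positions `μ`: this is a constant if `x` occurs in the body; otherwise it is a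
null, whose first coordinate holds its name and whose other coordinates hold the values of the
shared variables. -/
def Entry (w : List (Sym S.size)) (ξ : ABD S T) (idx : ℕ) (μ : Fin (U + 1) → Fin w.length) (x : Var)
    (a : Fin (U + 1 + 1) → Fin w.length) : Prop :=
  (x ∈ ξ.bodyVars ∧ a 0 = μ (Fin.ofNat (U + 1) x)) ∨
  (x ∉ ξ.bodyVars ∧ ValAt w (a 0) (nullTag idx x) ∧
    ∀ y ∈ ξ.shared, a (Fin.ofNat (U + 1) y).succ = μ (Fin.ofNat (U + 1) y))

/-- The facts, with an annotation in `P`, that result from firing the abds from left to right. -/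
def TargetFact (M : Mapping S T) (P : ℤ → Prop) (w : List (Sym S.size))
    (f : RelAtom T (Fin (U + 1 + 1) → Fin w.length)) : Prop :=
  ∃ x ∈ M.abds.zipIdx, ∃ a ∈ x.1.head, P a.2 ∧ ∃ μ : Fin (U + 1) → Fin w.length,
    (∀ b ∈ x.1.body, SrcHolds w μ b) ∧ ∃ args, f = ⟨a.1.rel, args⟩ ∧
      ∀ p, Entry w x.1 x.2 μ (a.1.args p) (args p)

/-- The aegds, matched up to `E` in the canonical facts, force `a = b`. -/
def Mapping.Forces (M : Mapping S T) (U : ℕ) (w : List (Sym S.size))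
    (E : (Fin (U + 1 + 1) → Fin w.length) → (Fin (U + 1 + 1) → Fin w.length) → Prop)
    (a b : Fin (U + 1 + 1) → Fin w.length) : Prop :=
  ∃ ξ ∈ M.aegds, ∃ η : Fin (U + 1) → Fin (U + 1 + 1) → Fin w.length,
    (∀ c ∈ ξ.body, Hit E (IsCst w) (TargetFact M (· = c.2) w) η (c.1.map Term.var)) ∧
      E (η (Fin.ofNat (U + 1) ξ.lhs)) a ∧ E (η (Fin.ofNat (U + 1) ξ.rhs)) b

/-- Up to `E`, the head of some abd is matched in the canonical facts, but the body is not matched in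
the source instance; the constants that are the values of the shared variables stand at the
positions `u`. -/
def Mapping.Violates (M : Mapping S T) (U : ℕ) (w : List (Sym S.size))
    (E : (Fin (U + 1 + 1) → Fin w.length) → (Fin (U + 1 + 1) → Fin w.length) → Prop) : Prop :=
  ∃ ξ ∈ M.abds, ∃ η : Fin (U + 1) → Fin (U + 1 + 1) → Fin w.length,
    (∀ c ∈ ξ.head, Hit E (IsCst w) (TargetFact M (· = c.2) w) η (c.1.map Term.var)) ∧
      ∃ u : Fin (U + 1) → Fin w.length,
        (∀ x ∈ ξ.shared, w[u (Fin.ofNat (U + 1) x)] = Sym.cst ∧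
          E (fun _ => u (Fin.ofNat (U + 1) x)) (η (Fin.ofNat (U + 1) x))) ∧
        ¬ ∃ μ : Fin (U + 1) → Fin w.length, (∀ b ∈ ξ.body, SrcHolds w μ b) ∧
          ∀ x ∈ ξ.shared,
            token w (μ (Fin.ofNat (U + 1) x)) = token w (u (Fin.ofNat (U + 1) x))

variable {M : Mapping S T}

theorem Mapping.Forces.mono {w : List (Sym S.size)}
    {E E' : (Fin (U + 1 + 1) → Fin w.length) → (Fin (U + 1 + 1) → Fin w.length) → Prop}
    (h : ∀ a b, E a b → E' a b) {a b : Fin (U + 1 + 1) → Fin w.length} (hE : M.Forces U w E a b) :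
    M.Forces U w E' a b :=
  let ⟨ξ, hξ, η, hη, h1, h2⟩ := hE
  ⟨ξ, hξ, η, fun c hc => (hη c hc).mono h, h _ _ h1, h _ _ h2⟩

theorem Mapping.Violates.mono {w : List (Sym S.size)}
    {E E' : (Fin (U + 1 + 1) → Fin w.length) → (Fin (U + 1 + 1) → Fin w.length) → Prop}
    (h : ∀ a b, E a b → E' a b) (hE : M.Violates U w E) : M.Violates U w E' :=
  let ⟨ξ, hξ, η, hη, u, hu, hμ⟩ := hE
  ⟨ξ, hξ, η, fun c hc => (hη c hc).mono h, u, fun x hx => ⟨(hu x hx).1, h _ _ (hu x hx).2⟩, hμ⟩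

theorem Def.srcHolds {r : ℕ} {ι : Type} (b : RelAtom S Var) (μ : Fin (U + 1) → ι) :
    Def (r := r) ι fun w _ e => SrcHolds w (fun x => e (μ x)) b := by
  refine Def.ex₁ (Q := fun w _ e i => ∃ args : Fin (S.arity b.rel) → Fin w.length,
    FactAt w b.rel i args ∧
      ∀ p, token w (args p) = token w (e (μ (Fin.ofNat (U + 1) (b.args p))))) ?_
  refine Def.ex (Q := fun w _ e args => FactAt w b.rel (e (Sum.inr ())) args ∧
      ∀ p, token w (args p) = token w (e (Sum.inl (μ (Fin.ofNat (U + 1) (b.args p)))))) ?_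
  exact (Def.factAt b.rel (Sum.inl (Sum.inr ())) Sum.inr).and (Def.forall_fintype fun p =>
    Def.token_eq (Sum.inr p) (Sum.inl (Sum.inl (μ (Fin.ofNat (U + 1) (b.args p))))))

theorem Def.entry {r : ℕ} {ι : Type} (ξ : ABD S T) (idx : ℕ) (μ : Fin (U + 1) → ι) (x : Var)
    (a : Fin (U + 1 + 1) → ι) :
    Def (r := r) ι fun w _ e => Entry w ξ idx (fun y => e (μ y)) x fun j => e (a j) :=
  ((Def.const _).and (Def.eq (a 0) (μ (Fin.ofNat (U + 1) x)))).or ((Def.const _).and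
    ((Def.valAt _ (a 0)).and (Def.forall_mem ξ.shared fun y _ =>
      Def.eq (a (Fin.ofNat (U + 1) y).succ) (μ (Fin.ofNat (U + 1) y)))))

theorem Def.targetFact {r : ℕ} (P : ℤ → Prop) (R : Fin T.size) :
    Def (r := r) (Fin (T.arity R) × Fin (U + 1 + 1)) fun w _ e =>
      TargetFact M P w (⟨R, fun p j => e (p, j)⟩ : RelAtom T (Fin (U + 1 + 1) → Fin w.length)) := by
  refine Def.exists_mem M.abds.zipIdx fun x _ => Def.exists_mem x.1.head fun a _ =>
    (Def.const _).and ?_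
  obtain ⟨⟨R', v⟩, i⟩ := a
  by_cases hR : R = R'
  · subst hR
    refine Def.ex (Q := fun w _ e μ => (∀ b ∈ x.1.body, SrcHolds w μ b) ∧
      ∃ args, (⟨R, fun p j => e (p, j)⟩ : RelAtom T (Fin (U + 1 + 1) → Fin w.length)) = ⟨R, args⟩ ∧
        ∀ p, Entry w x.1 x.2 μ (v p) (args p)) ?_
    refine (Def.forall_mem x.1.body fun b _ => Def.srcHolds b Sum.inr).and
      ((Def.forall_fintype fun p => Def.entry x.1 x.2 Sum.inr (v p)
        fun j => Sum.inl (p, j)).congr fun w X e => ?_)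
    constructor
    · intro h
      exact ⟨_, rfl, h⟩
    · rintro ⟨args, h1, h2⟩
      simp only [RelAtom.mk.injEq, heq_eq_eq, true_and] at h1
      subst h1
      exact h2
  · refine (Def.const False).congr fun w X e => ?_
    constructor
    · exact False.elim
    · rintro ⟨μ, -, args, h, -⟩
      exact hR (congrArg RelAtom.rel h)

theorem Def.mappingForces : Def (r := U + 1 + 1 + (U + 1 + 1)) (Fin (U + 1 + 1) ⊕ Fin (U + 1 + 1))
    fun w X e => M.Forces U w (ABDExchange.asBinary X) (fun j => e (Sum.inl j))
      fun j => e (Sum.inr j) := by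
  refine Def.exists_mem M.aegds fun ξ _ => ?_
  refine Def.ex_tuples (Q := fun w X e η => (∀ c ∈ ξ.body, Hit (ABDExchange.asBinary X) (IsCst w)
      (TargetFact M (· = c.2) w) η (c.1.map Term.var)) ∧
    ABDExchange.asBinary X (η (Fin.ofNat (U + 1) ξ.lhs)) (fun j => e (Sum.inl j)) ∧
    ABDExchange.asBinary X (η (Fin.ofNat (U + 1) ξ.rhs)) fun j => e (Sum.inr j)) ?_
  exact (Def.forall_mem ξ.body fun c _ => Def.hit Def.isCst (Def.targetFact _) _
    fun x j => Sum.inr (x, j)).and ((Def.asBinary (fun j => Sum.inr (Fin.ofNat (U + 1) ξ.lhs, j))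
      fun j => Sum.inl (Sum.inl j)).and
        (Def.asBinary (fun j => Sum.inr (Fin.ofNat (U + 1) ξ.rhs, j))
          fun j => Sum.inl (Sum.inr j)))

theorem Def.mappingViolates : Def (r := U + 1 + 1 + (U + 1 + 1)) (Fin 0)
    fun w X _ => M.Violates U w (ABDExchange.asBinary X) := by
  refine Def.exists_mem M.abds fun ξ _ => ?_
  refine Def.ex_tuples (Q := fun w X _ η => (∀ c ∈ ξ.head, Hit (ABDExchange.asBinary X) (IsCst w)
      (TargetFact M (· = c.2) w) η (c.1.map Term.var)) ∧
    ∃ u : Fin (U + 1) → Fin w.length,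
      (∀ x ∈ ξ.shared, w[u (Fin.ofNat (U + 1) x)] = Sym.cst ∧
        ABDExchange.asBinary X (fun _ => u (Fin.ofNat (U + 1) x)) (η (Fin.ofNat (U + 1) x))) ∧
      ¬ ∃ μ : Fin (U + 1) → Fin w.length, (∀ b ∈ ξ.body, SrcHolds w μ b) ∧
        ∀ x ∈ ξ.shared,
          token w (μ (Fin.ofNat (U + 1) x)) = token w (u (Fin.ofNat (U + 1) x))) ?_
  refine (Def.forall_mem ξ.head fun c _ => Def.hit Def.isCst (Def.targetFact _) _
    fun x j => Sum.inr (x, j)).and ?_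
  refine Def.ex (Q := fun w X e u =>
      (∀ x ∈ ξ.shared, w[u (Fin.ofNat (U + 1) x)] = Sym.cst ∧
        ABDExchange.asBinary X (fun _ => u (Fin.ofNat (U + 1) x))
          fun j => e (Sum.inr (Fin.ofNat (U + 1) x, j))) ∧
      ¬ ∃ μ : Fin (U + 1) → Fin w.length, (∀ b ∈ ξ.body, SrcHolds w μ b) ∧
        ∀ x ∈ ξ.shared,
          token w (μ (Fin.ofNat (U + 1) x)) = token w (u (Fin.ofNat (U + 1) x))) ?_
  refine (Def.forall_mem ξ.shared fun x _ => (Def.symbol _ (Sum.inr _)).and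
    (Def.asBinary (fun _ => Sum.inr _) fun j => Sum.inl (Sum.inr (_, j)))).and (Def.not ?_)
  refine Def.ex (Q := fun w _ e μ => (∀ b ∈ ξ.body, SrcHolds w μ b) ∧
        ∀ x ∈ ξ.shared, token w (μ (Fin.ofNat (U + 1) x)) =
          token w (e (Sum.inr (Fin.ofNat (U + 1) x)))) ?_
  exact (Def.forall_mem ξ.body fun b _ => Def.srcHolds b Sum.inr).and
    (Def.forall_mem ξ.shared fun x _ => Def.token_eq (Sum.inr _) (Sum.inl (Sum.inr _)))

end Canonical

/-! ### Canonical solutions -/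

section Solutions

variable {S T : Schema} {M : Mapping S T} {U : ℕ} {w : List (Sym S.size)}
  {I : List (RelAtom S Cons)}

/-- The word `w` lists the facts of `I` and the names of all nulls, and `U` bounds the variables
of the dependencies. -/
structure Describes (w : List (Sym S.size)) (I : List (RelAtom S Cons)) (M : Mapping S T) (U : ℕ) :
    Prop where
  valid : Valid w
  nonempty : Nonempty (Fin w.length)
  sound : ∀ {r i} {args : Fin (S.arity r) → Fin w.length}, FactAt w r i args →
    ∃ u, (⟨r, u⟩ : RelAtom S Cons) ∈ I ∧ ∀ p, ValAt w (args p) (.cst (u p))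
  complete : ∀ a ∈ I, ∃ i args, FactAt w a.rel i args ∧ ∀ p, ValAt w (args p) (.cst (a.args p))
  tag : ∀ x ∈ M.abds.zipIdx, ∀ z ∈ x.1.headVars, ∃ i, ValAt w i (nullTag x.2 z)
  body_le : ∀ ξ ∈ M.abds, ∀ x ∈ ξ.bodyVars, x ≤ U
  head_le : ∀ ξ ∈ M.abds, ∀ x ∈ ξ.headVars, x ≤ U
  aegd_le : ∀ ξ ∈ M.aegds, ∀ x ∈ ξ.bodyVars, x ≤ U

/-- The constant at a position. -/
noncomputable def constAt (w : List (Sym S.size)) (i : Fin w.length) : Cons :=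
  (cstOf (m := 0) w fun _ => i).getD 0

theorem ValAt.constAt_eq {i : Fin w.length} {c : Cons} (h : ValAt w i (.cst c)) :
    constAt w i = c := by
  rw [constAt, cstOf_eq_some.2 (show IsCst w c fun _ : Fin (0 + 1) => i from h)]
  rfl

theorem Valid.valAt_constAt (hw : Valid w) {i : Fin w.length} (h : w[i] = Sym.cst) :
    ValAt w i (.cst (constAt w i)) := by
  obtain ⟨c, hc⟩ := hw.exists_cst h
  rwa [hc.constAt_eq]

theorem RelAtom.map_congr {S : Schema} {X Y : Type} {f g : X → Y} {a : RelAtom S X}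
    (h : ∀ x ∈ a.vals, f x = g x) : a.map f = a.map g := by
  obtain ⟨R, u⟩ := a
  simp only [RelAtom.map, RelAtom.mk.injEq, heq_eq_eq, true_and]
  exact funext fun p => h _ (List.mem_ofFn.2 ⟨p, rfl⟩)

theorem ofNat_val {x : ℕ} (h : x ≤ U) : ((Fin.ofNat (U + 1) x : Fin (U + 1)) : ℕ) = x :=
  Nat.mod_eq_of_lt (Nat.lt_succ_of_le h)

/-- The assignment of constants that an assignment of positions induces. -/
noncomputable abbrev constants (w : List (Sym S.size)) (μ : Fin (U + 1) → Fin w.length) (x : Var) :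
    Cons :=
  constAt w (μ (Fin.ofNat (U + 1) x))

theorem Describes.srcHolds_iff (h : Describes w I M U) {μ : Fin (U + 1) → Fin w.length}
    {b : RelAtom S Var} : SrcHolds w μ b ↔
      (∀ x ∈ b.vals, w[μ (Fin.ofNat (U + 1) x)] = Sym.cst) ∧ b.map (constants w μ) ∈ I := by
  constructor
  · rintro ⟨i, args, hfact, htok⟩
    obtain ⟨u, hu, hargs⟩ := h.sound hfact
    have hval : ∀ p, ValAt w (μ (Fin.ofNat (U + 1) (b.args p))) (.cst (u p)) := fun p =>
      (htok p).symm.trans (hargs p)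
    constructor
    · intro x hx
      obtain ⟨p, rfl⟩ := List.mem_ofFn.1 hx
      exact (hval p).symbol_eq
    · have : b.map (constants w μ) = ⟨b.rel, u⟩ := by
        simp only [RelAtom.map, RelAtom.mk.injEq, heq_eq_eq, true_and]
        exact funext fun p => (hval p).constAt_eq
      rwa [this]
  · rintro ⟨hcst, hb⟩
    obtain ⟨i, args, hfact, hargs⟩ := h.complete _ hb
    refine ⟨i, args, hfact, fun p => ?_⟩
    exact (hargs p).trans (h.valid.valAt_constAt (hcst _ (List.mem_ofFn.2 ⟨p, rfl⟩))).symm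

/-- A match of atoms in the source instance is a match at positions of the word. -/
theorem Describes.exists_positions (h : Describes w I M U) {l : List (RelAtom S Var)}
    {ν : Var → Cons} (hl : ∀ b ∈ l, b.map ν ∈ I) (hU : ∀ x ∈ l.flatMap RelAtom.vals, x ≤ U) :
    ∃ μ : Fin (U + 1) → Fin w.length,
      (∀ x ∈ l.flatMap RelAtom.vals, ValAt w (μ (Fin.ofNat (U + 1) x)) (.cst (ν x))) ∧
        ∀ b ∈ l, SrcHolds w μ b := by
  classical
  obtain ⟨i₀⟩ := h.nonempty
  let μ : Fin (U + 1) → Fin w.length := fun j =>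
    if h : ∃ i, ValAt w i (.cst (ν j)) then h.choose else i₀
  have hμ : ∀ x ∈ l.flatMap RelAtom.vals, ValAt w (μ (Fin.ofNat (U + 1) x)) (.cst (ν x)) := by
    intro x hx
    obtain ⟨b, hb, hxb⟩ := List.mem_flatMap.1 hx
    obtain ⟨p, hp⟩ := List.mem_ofFn.1 hxb
    obtain ⟨i, args, -, hargs⟩ := h.complete _ (hl b hb)
    have hex : ∃ i, ValAt w i (.cst (ν x)) := ⟨args p, by
      have h' := hargs p
      simp only [RelAtom.map, hp] at h'
      exact h'⟩
    simp only [μ, ofNat_val (hU x hx), dif_pos hex]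
    exact hex.choose_spec
  refine ⟨μ, hμ, fun b hb => ?_⟩
  have hmem : ∀ x ∈ b.vals, x ∈ l.flatMap RelAtom.vals := fun x hx =>
    List.mem_flatMap.2 ⟨b, hb, hx⟩
  refine h.srcHolds_iff.2 ⟨fun x hx => (hμ x (hmem x hx)).symbol_eq, ?_⟩
  rw [RelAtom.map_congr (g := ν) fun x hx => (hμ x (hmem x hx)).constAt_eq]
  exact hl b hb

/-- The canonical annotated instance under a valuation of the elements. -/
def Fired (M : Mapping S T) (U : ℕ) (w : List (Sym S.size))
    (val : (Fin (U + 1 + 1) → Fin w.length) → Cons) : Set (AnnAtom T Cons) :=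
  {x | ∃ f : RelAtom T (Fin (U + 1 + 1) → Fin w.length),
    TargetFact M (· = x.2) w f ∧ f.map val = x.1}

variable {val : (Fin (U + 1 + 1) → Fin w.length) → Cons}

theorem var_mem_vals {a : RelAtom T Var} {x : Var} :
    Term.var x ∈ (a.map Term.var).vals ↔ x ∈ a.vals := by
  simp only [RelAtom.vals, List.mem_ofFn, RelAtom.map, Term.var.injEq]

theorem hit_fired_iff (hval : ∀ c a, IsCst w c a → val a = c) {a : RelAtom T Var} {i : ℤ}
    {η : Fin (U + 1) → Fin (U + 1 + 1) → Fin w.length} :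
    Hit (Ker val) (IsCst w) (TargetFact M (· = i) w) η (a.map Term.var) ↔
      (a.map (assign val η), i) ∈ Fired M U w val := by
  refine hit_ker_iff hval fun c hc => ?_
  obtain ⟨p, hp⟩ := List.mem_ofFn.1 hc
  simp [RelAtom.map] at hp

/-- A match of annotated atoms in the canonical instance is induced by an assignment of elements. -/
theorem exists_assign_fired (hw : Nonempty (Fin w.length)) {l : List (AnnAtom T Var)}
    {ν : Var → Cons}
    (hl : ∀ a ∈ l, (a.1.map ν, a.2) ∈ Fired M U w val)
    (hU : ∀ x ∈ l.flatMap fun a => a.1.vals, x ≤ U) :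
    ∃ η : Fin (U + 1) → Fin (U + 1 + 1) → Fin w.length,
      (∀ x ∈ l.flatMap fun a => a.1.vals, assign val η x = ν x) ∧
        ∀ a ∈ l, (a.1.map (assign val η), a.2) ∈ Fired M U w val := by
  obtain ⟨η, hη⟩ := exists_assign (V := U) (val := val) (ν := ν)
    (l := l.map fun a => a.1.map Term.var) (by
      intro a ha
      obtain ⟨a', ha', rfl⟩ := List.mem_map.1 ha
      obtain ⟨f, -, hf⟩ := hl a' ha'
      exact ⟨f, hf⟩) (by
      intro a ha x hx
      obtain ⟨a', ha', rfl⟩ := List.mem_map.1 ha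
      exact hU x (List.mem_flatMap.2 ⟨a', ha', var_mem_vals.1 hx⟩))
  have hη' : ∀ x ∈ l.flatMap fun a => a.1.vals, assign val η x = ν x := by
    intro x hx
    obtain ⟨a, ha, hxa⟩ := List.mem_flatMap.1 hx
    exact hη _ (List.mem_map.2 ⟨a, ha, rfl⟩) x (var_mem_vals.2 hxa)
  refine ⟨η, hη', fun a ha => ?_⟩
  rw [RelAtom.map_congr fun x hx => hη' x (List.mem_flatMap.2 ⟨a, ha, hx⟩)]
  exact hl a ha

theorem mem_vars_of_mem {l : List (AnnAtom T Var)} {a : AnnAtom T Var} (ha : a ∈ l)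
    (p : Fin (T.arity a.1.rel)) : a.1.args p ∈ l.flatMap fun a => a.1.vals :=
  List.mem_flatMap.2 ⟨a, ha, List.mem_ofFn.2 ⟨p, rfl⟩⟩

/-- If a valuation satisfies the aegds and no abd is violated from right to left, then the canonical
instance is a model.  Annotation density one is needed because `Mapping.Violates` considers only
matches of heads that give constants of the source instance to the shared variables. -/
theorem Describes.models_fired (h : Describes w I M U) (hM : M.density = 1)
    (hval : ∀ c a, IsCst w c a → val a = c)
    (hforce : ∀ a b, M.Forces U w (Ker val) a b → val a = val b)
    (hviol : ¬ M.Violates U w (Ker val)) : M.Models {f | f ∈ I} (Fired M U w val) := by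
  classical
  refine ⟨fun ξ hξ ν => ⟨?_, ?_⟩, fun ξ hξ ν hν => ?_⟩
  · rintro ⟨μc, hshared, hbody⟩
    obtain ⟨μ, hμ, hsrc⟩ := h.exists_positions hbody (h.body_le ξ hξ)
    obtain ⟨idx, hidx⟩ := List.getElem?_of_mem hξ
    have hmem : (ξ, idx) ∈ M.abds.zipIdx := List.mem_zipIdx_iff_getElem?.2 hidx
    have := h.nonempty
    choose! tagAt htagAt using h.tag _ hmem
    let el : Var → Fin (U + 1 + 1) → Fin w.length := fun x =>
      if x ∈ ξ.bodyVars then fun _ => μ (Fin.ofNat (U + 1) x) else Fin.cons (tagAt x) μ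
    refine ⟨fun x => val (el x), fun x hx => ?_, fun a ha => ?_⟩
    · rw [← hshared x hx]
      simp only [el, if_pos hx.1]
      exact hval _ _ (hμ x hx.1)
    · refine ⟨⟨a.1.rel, fun p => el (a.1.args p)⟩, ⟨(ξ, idx), hmem, a, ha, rfl, μ, hsrc, _, rfl,
        fun p => ?_⟩, rfl⟩
      by_cases hp : a.1.args p ∈ ξ.bodyVars
      · exact .inl ⟨hp, by simp only [el, if_pos hp]⟩
      · refine .inr ⟨hp, ?_, fun y _ => ?_⟩
        · simp only [el, if_neg hp, Fin.cons_zero]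
          exact htagAt _ (mem_vars_of_mem ha p)
        · simp only [el, if_neg hp, Fin.cons_succ]
  · rintro ⟨μc, hshared, hhead⟩
    obtain ⟨η, hη, hη'⟩ := exists_assign_fired h.nonempty hhead (h.head_le ξ hξ)
    have hpos : ∀ x ∈ ξ.shared, ∃ i : Fin w.length, ValAt w i (.cst (μc x)) := by
      intro x hx
      obtain ⟨hx1, hx2⟩ := ABD.mem_shared.1 hx
      obtain ⟨a, ha, hxa⟩ := List.mem_flatMap.1 hx2
      obtain ⟨p, hp⟩ := List.mem_ofFn.1 hxa
      obtain ⟨f, ⟨⟨ξ', idx⟩, hmem, a', ha', hann, μ, hsrc, args, rfl, hargs⟩, hf⟩ := hhead a ha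
      -- annotation density one: the fact has been produced by the matched atom itself
      have hrel := congrArg RelAtom.rel hf
      obtain ⟨rfl, rfl⟩ := M.head_unique hM hξ (List.mem_of_getElem?
        (List.mem_zipIdx_iff_getElem?.1 hmem)) ha ha' hrel hann
      have hval' : val (args p) = μc x := by
        have h1 : (fun p => val (args p)) = fun p => μc (a'.1.args p) := by
          simpa only [RelAtom.map, RelAtom.mk.injEq, heq_eq_eq, true_and] using hf
        rw [← hp]
        exact congrFun h1 p
      rcases hargs p with ⟨-, h0⟩ | ⟨hn, -⟩
      · obtain ⟨b, hb, hxb⟩ := List.mem_flatMap.1 hx1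
        have h2 := h.valid.valAt_constAt ((h.srcHolds_iff.1 (hsrc b hb)).1 x hxb)
        rw [hp] at h0
        have h3 : IsCst w (constAt w (μ (Fin.ofNat (U + 1) x))) (args p) := by
          rw [IsCst, h0]
          exact h2
        refine ⟨_, h2.trans ?_⟩
        rw [← hval', hval _ _ h3]
      · exact absurd (hp ▸ hx1) hn
    obtain ⟨i₀⟩ := h.nonempty
    let u : Fin (U + 1) → Fin w.length := fun j =>
      if h : ∃ i : Fin w.length, ValAt w i (.cst (μc j)) then h.choose else i₀
    have hu : ∀ x ∈ ξ.shared, ValAt w (u (Fin.ofNat (U + 1) x)) (.cst (μc x)) := by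
      intro x hx
      have hx' := hpos x hx
      simp only [u, ofNat_val (h.head_le ξ hξ x (ABD.mem_shared.1 hx).2), dif_pos hx']
      exact hx'.choose_spec
    by_contra hno
    refine hviol ⟨ξ, hξ, η, fun c hc => (hit_fired_iff hval).2 (hη' c hc), u, fun x hx =>
      ⟨(hu x hx).symbol_eq, ?_⟩, ?_⟩
    · exact (hval _ (fun _ => u (Fin.ofNat (U + 1) x)) (hu x hx)).trans
        (hη x (ABD.mem_shared.1 hx).2).symm
    · rintro ⟨μ, hμ, htok⟩
      refine hno ⟨constants w μ, fun x hx => ?_, fun b hb => (h.srcHolds_iff.1 (hμ b hb)).2⟩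
      have hx' := ABD.mem_shared.2 hx
      have h1 : ValAt w (μ (Fin.ofNat (U + 1) x)) (.cst (μc x)) := (htok x hx').trans (hu x hx')
      rw [← hshared x hx]
      exact h1.constAt_eq
  · obtain ⟨η, hη, hη'⟩ := exists_assign_fired h.nonempty hν (h.aegd_le ξ hξ)
    rw [← hη _ ξ.lhs_mem, ← hη _ ξ.rhs_mem]
    exact hforce _ _ ⟨ξ, hξ, η, fun c hc => (hit_fired_iff hval).2 (hη' c hc), rfl, rfl⟩

/-- Every model contains the canonical instance under some valuation, which satisfies the aegds and
does not violate any abd from right to left. -/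
theorem Describes.exists_fired_subset (h : Describes w I M U) {K : Set (AnnAtom T Cons)}
    (hK : M.Models {f | f ∈ I} K) : ∃ val : (Fin (U + 1 + 1) → Fin w.length) → Cons,
      (∀ c a, IsCst w c a → val a = c) ∧ Fired M U w val ⊆ K ∧
      (∀ a b, M.Forces U w (Ker val) a b → val a = val b) ∧ ¬ M.Violates U w (Ker val) := by
  classical
  -- witnesses for the variables of the head, which depend on the shared variables only
  have hwit : ∀ (ξ : ABD S T) (ν : Var → Cons), ∃ μ : Var → Cons,
      (∃ μ : Var → Cons, (∀ x, ξ.IsShared x → μ x = ν x) ∧ ∀ a ∈ ξ.head, (a.1.map μ, a.2) ∈ K) →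
        (∀ x, ξ.IsShared x → μ x = ν x) ∧ ∀ a ∈ ξ.head, (a.1.map μ, a.2) ∈ K := by
    intro ξ ν
    by_cases hex : ∃ μ : Var → Cons, (∀ x, ξ.IsShared x → μ x = ν x) ∧
        ∀ a ∈ ξ.head, (a.1.map μ, a.2) ∈ K
    · exact ⟨hex.choose, fun _ => hex.choose_spec⟩
    · exact ⟨ν, fun h => absurd h hex⟩
  choose W hW using hwit
  let restrict : ABD S T → (Var → Cons) → Var → Cons := fun ξ ν x =>
    if ξ.IsShared x then ν x else 0
  have hrestrict : ∀ ξ ν ν', (∀ x, ξ.IsShared x → ν x = ν' x) → restrict ξ ν = restrict ξ ν' := by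
    intro ξ ν ν' hνν
    funext x
    by_cases hx : ξ.IsShared x
    · simp only [restrict, if_pos hx, hνν x hx]
    · simp only [restrict, if_neg hx]
  -- an element that names a null is sent to the witness chosen for its shared values
  have hvalex : ∀ a : Fin (U + 1 + 1) → Fin w.length, ∃ v : Cons,
      (∀ c, IsCst w c a → v = c) ∧ ∀ ξ idx z, M.abds[idx]? = some ξ → ValAt w (a 0) (nullTag idx z) →
        v = W ξ (restrict ξ (constants w fun j => a j.succ)) z := by
    intro a
    by_cases hc : ∃ c, IsCst w c a
    · obtain ⟨c, hc⟩ := hc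
      refine ⟨c, fun c' hc' => Val.cst.inj (hc.unique hc'), fun ξ idx z _ hz => ?_⟩
      exact absurd (hc.unique hz) (by simp [nullTag])
    · by_cases hz : ∃ ξ idx z, M.abds[idx]? = some ξ ∧ ValAt w (a 0) (nullTag idx z)
      · obtain ⟨ξ, idx, z, hξ, hz⟩ := hz
        refine ⟨W ξ (restrict ξ (constants w fun j => a j.succ)) z,
          fun c hc' => absurd ⟨c, hc'⟩ hc, fun ξ' idx' z' hξ' hz' => ?_⟩
        have h1 := hz.unique hz'
        simp only [nullTag, Val.openNull.injEq, Nat.pair_eq_pair] at h1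
        obtain ⟨rfl, rfl⟩ := h1
        rw [hξ] at hξ'
        rw [Option.some.inj hξ']
      · exact ⟨0, fun c hc' => absurd ⟨c, hc'⟩ hc, fun ξ idx z h1 h2 =>
          absurd ⟨ξ, idx, z, h1, h2⟩ hz⟩
  choose val hval hnull using hvalex
  have hval' : ∀ c a, IsCst w c a → val a = c := fun c a => hval a c
  have hsub : Fired M U w val ⊆ K := by
    rintro ⟨f', i⟩ ⟨f, ⟨⟨ξ, idx⟩, hmem, a, ha, rfl, μ, hsrc, args, rfl, hargs⟩, rfl⟩
    have hidx := List.mem_zipIdx_iff_getElem?.1 hmem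
    have hξ := List.mem_of_getElem? hidx
    have hfact := hW ξ (restrict ξ (constants w μ)) (((hK.1 ξ hξ) _).1 ⟨constants w μ,
      fun x hx => by simp only [restrict, if_pos hx],
      fun b hb => (h.srcHolds_iff.1 (hsrc b hb)).2⟩)
    convert hfact.2 a ha using 2
    simp only [RelAtom.map, RelAtom.mk.injEq, heq_eq_eq, true_and]
    funext p
    rcases hargs p with ⟨hp, h0⟩ | ⟨hp, h0, hcoord⟩
    · have hshared : ξ.IsShared (a.1.args p) := ⟨hp, mem_vars_of_mem ha p⟩
      obtain ⟨b, hb, hxb⟩ := List.mem_flatMap.1 hp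
      have h2 := h.valid.valAt_constAt ((h.srcHolds_iff.1 (hsrc b hb)).1 _ hxb)
      rw [hfact.1 _ hshared]
      simp only [restrict, if_pos hshared]
      refine hval _ _ ?_
      rw [IsCst, h0]
      exact h2
    · rw [hnull _ ξ idx _ hidx h0, hrestrict ξ _ (constants w μ)]
      intro x hx
      simp only [constants, hcoord x (ABD.mem_shared.2 hx)]
  refine ⟨val, hval', hsub, ?_, ?_⟩
  · rintro a b ⟨ξ, hξ, η, hη, ha, hb⟩
    rw [← ha, ← hb]
    exact hK.2 ξ hξ (assign val η) fun c hc => hsub ((hit_fired_iff hval').1 (hη c hc))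
  · rintro ⟨ξ, hξ, η, hη, u, hu, hno⟩
    obtain ⟨μc, hμc, hbody⟩ := ((hK.1 ξ hξ) (assign val η)).2
      ⟨_, fun _ _ => rfl, fun c hc => hsub ((hit_fired_iff hval').1 (hη c hc))⟩
    obtain ⟨μ, hμ, hsrc⟩ := h.exists_positions hbody (h.body_le ξ hξ)
    refine hno ⟨μ, hsrc, fun x hx => ?_⟩
    obtain ⟨hux, hux'⟩ := hu x hx
    have h1 := h.valid.valAt_constAt hux
    have h2 : μc x = constAt w (u (Fin.ofNat (U + 1) x)) := by
      rw [hμc x (ABD.mem_shared.1 hx), ← hval' _ (fun _ => u (Fin.ofNat (U + 1) x)) h1]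
      exact hux'.symm
    refine (hμ x (ABD.mem_shared.1 hx).1).trans ?_
    rw [h2]
    exact h1.symm

end Solutions

section SolutionsOfModels

variable {S T : Schema} {M : Mapping S T} {U : ℕ} {w : List (Sym S.size)}
  {I : List (RelAtom S Cons)}

theorem exists_instance {A : Type} [Finite A] (F : RelAtom T A → Prop) (val : A → Cons) :
    ∃ J : Instance T, ∀ f, f ∈ J ↔ ∃ g, F g ∧ g.map val = f := by
  have hfin : {f | ∃ g, F g ∧ g.map val = f}.Finite := by
    refine (Set.finite_iUnion fun R : Fin T.size => Set.finite_range
      fun args : Fin (T.arity R) → A => (⟨R, args⟩ : RelAtom T A).map val).subset ?_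
    rintro f ⟨⟨R, args⟩, -, rfl⟩
    exact Set.mem_iUnion.2 ⟨R, args, rfl⟩
  exact ⟨hfin.toFinset, fun f => by simp⟩

/-- Some solution avoids a tuple if and only if the canonical facts do so under a valuation that
satisfies the aegds and violates no abd from right to left.  A solution contains the canonical facts
under a suitable valuation, and answers of queries with unequalities are preserved when an instance
grows.  Conversely, under such a valuation the canonical facts are a finite model, and a minimal
model inside it is a solution. -/
theorem Describes.exists_sol_iff (h : Describes w I M U) (hM : M.density = 1) {k : ℕ}
    {q : UCQNeq T k} {t : Fin k → Cons} :
    (∃ J ∈ M.Sol I.toFinset, t ∉ q.answers J) ↔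
      ∃ val : (Fin (U + 1 + 1) → Fin w.length) → Cons, (∀ c a, IsCst w c a → val a = c) ∧
        (∀ a b, M.Forces U w (Ker val) a b → val a = val b) ∧ ¬ M.Violates U w (Ker val) ∧
        ∃ J : Instance T, (∀ f, f ∈ J ↔ ∃ g, TargetFact M (fun _ => True) w g ∧ g.map val = f) ∧
          t ∉ q.answers J := by
  classical
  have hI : ((I.toFinset : Instance S) : Set (RelAtom S Cons)) = {f | f ∈ I} := by
    ext f
    simp
  have hfired : ∀ (val : (Fin (U + 1 + 1) → Fin w.length) → Cons) f,
      (∃ g, TargetFact M (fun _ => True) w g ∧ g.map val = f) ↔ ∃ i, (f, i) ∈ Fired M U w val := by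
    intro val f
    constructor
    · rintro ⟨g, ⟨x, hx, a, ha, -, hμ⟩, hg⟩
      exact ⟨a.2, g, ⟨x, hx, a, ha, rfl, hμ⟩, hg⟩
    · rintro ⟨i, g, ⟨x, hx, a, ha, -, hμ⟩, hg⟩
      exact ⟨g, ⟨x, hx, a, ha, trivial, hμ⟩, hg⟩
  constructor
  · rintro ⟨J, ⟨l, -, hmodels, -⟩, ht⟩
    rw [hI] at hmodels
    obtain ⟨val, hval, hsub, hforce, hviol⟩ := h.exists_fired_subset hmodels
    obtain ⟨J', hJ'⟩ := exists_instance (TargetFact M (fun _ => True) w) val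
    refine ⟨val, hval, hforce, hviol, J', hJ', fun h => ht (UCQNeq.answers_mono (fun f hf => ?_) h)⟩
    obtain ⟨i, hi⟩ := (hfired val f).1 ((hJ' f).1 hf)
    exact (hsub hi).1
  · rintro ⟨val, hval, hforce, hviol, J, hJ, ht⟩
    have hmodels := h.models_fired hM hval hforce hviol
    have hfin : (Fired M U w val).Finite := by
      refine (J.finite_toSet.prod ((M.abds.flatMap ABD.head).toFinset.finite_toSet.image
        Prod.snd)).subset ?_
      rintro ⟨f, i⟩ hf
      refine ⟨(hJ f).2 ((hfired val f).2 ⟨i, hf⟩), ?_⟩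
      obtain ⟨g, ⟨x, hx, a, ha, hi, -⟩, -⟩ := hf
      refine ⟨a, ?_, hi⟩
      rw [Finset.mem_coe, List.mem_toFinset, List.mem_flatMap]
      exact ⟨x.1, List.mem_of_getElem? (List.mem_zipIdx_iff_getElem?.1 hx), ha⟩
    have hfin' : {K | K ⊆ Fired M U w val ∧ M.Models {f | f ∈ I} K}.Finite :=
      hfin.powerset.subset fun K hK => hK.1
    obtain ⟨K, ⟨hKsub, hK⟩, hKmin⟩ := hfin'.exists_minimal ⟨_, subset_rfl, hmodels⟩
    let J' : Instance T := ((hfin.subset hKsub).image Prod.fst).toFinset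
    have hJ' : ∀ f, f ∈ J' ↔ ∃ i, (f, i) ∈ K := fun f => by simp [J']
    have hlab : labelled J' (fun f => {i | (f, i) ∈ K}) = K := by
      ext ⟨f, i⟩
      exact ⟨fun h => h.2, fun h => ⟨(hJ' f).2 ⟨i, h⟩, h⟩⟩
    refine ⟨J', ⟨fun f => {i | (f, i) ∈ K}, fun f hf => (hJ' f).1 hf, ?_⟩, fun h =>
      ht (UCQNeq.answers_mono (fun f hf => ?_) h)⟩
    · rw [Mapping.Inferred, hlab, hI]
      refine ⟨hK, fun f _ i hi => ⟨_, subset_rfl, K, subset_rfl, hi, hK, fun K' hK' hm => ?_⟩⟩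
      exact hK'.not_subset (hKmin ⟨hK'.subset.trans hKsub, hm⟩ hK'.subset)
    · obtain ⟨i, hi⟩ := (hJ' f).1 hf
      exact (hJ f).2 ((hfired val f).2 ⟨i, hKsub hi⟩)

end SolutionsOfModels

/-! ### Certain answers over source instances -/

section Source

variable {S T : Schema} {k : ℕ}

/-- The names of all nulls. -/
def Mapping.nullTags (M : Mapping S T) : List Val :=
  M.abds.zipIdx.flatMap fun x => x.1.headVars.map (nullTag x.2)

theorem Mapping.exists_bound (M : Mapping S T) : ∃ U, (∀ ξ ∈ M.abds, ∀ x ∈ ξ.bodyVars, x ≤ U) ∧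
    (∀ ξ ∈ M.abds, ∀ x ∈ ξ.headVars, x ≤ U) ∧ ∀ ξ ∈ M.aegds, ∀ x ∈ ξ.bodyVars, x ≤ U := by
  obtain ⟨U, hU⟩ := exists_var_bound ((M.abds.flatMap ABD.bodyVars ++
    (M.abds.flatMap ABD.headVars ++ M.aegds.flatMap AEGD.bodyVars)).map Term.var)
  refine ⟨U, fun ξ hξ x hx => ?_, fun ξ hξ x hx => ?_, fun ξ hξ x hx => ?_⟩ <;>
    refine hU x (List.mem_map.2 ⟨x, ?_, rfl⟩)
  · exact List.mem_append_left _ (List.mem_flatMap.2 ⟨ξ, hξ, hx⟩)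
  · exact List.mem_append_right _ (List.mem_append_left _ (List.mem_flatMap.2 ⟨ξ, hξ, hx⟩))
  · exact List.mem_append_right _ (List.mem_append_right _ (List.mem_flatMap.2 ⟨ξ, hξ, hx⟩))

variable (vs : List Val) (I : List (RelAtom S Cons)) (t : Fin k → Cons)

/-- The encoding of a source instance and a tuple behind some values. -/
abbrev sourceWord : List (Sym S.size) := vs.flatMap encodeVal ++ encodeSourceInput (I, t)

theorem sourceWord_eq : sourceWord vs I t = vs.flatMap encodeVal ++
    ((I.map fun a => a.map Val.cst).flatMap encodeAtom ++ encodeTuple t) := by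
  rw [sourceWord, encodeSourceInput, List.flatMap_map]

theorem sourceWord_valid : Valid (sourceWord vs I t) := by
  rw [sourceWord_eq]
  exact Valid.values_append (Valid.atoms_append (Valid.encodeTuple t))

theorem sourceWord_describes {M : Mapping S T} {U : ℕ}
    (hU : (∀ ξ ∈ M.abds, ∀ x ∈ ξ.bodyVars, x ≤ U) ∧
      (∀ ξ ∈ M.abds, ∀ x ∈ ξ.headVars, x ≤ U) ∧ ∀ ξ ∈ M.aegds, ∀ x ∈ ξ.bodyVars, x ≤ U)
    (hvs : ∀ v ∈ M.nullTags, v ∈ vs) : Describes (sourceWord vs I t) I M U where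
  valid := sourceWord_valid vs I t
  nonempty := by
    have : 0 < (sourceWord vs I t).length := by
      rw [sourceWord_eq, encodeTuple]
      simp
    exact ⟨⟨0, this⟩⟩
  sound := by
    intro r i args hfact
    obtain ⟨u, hu, hargs⟩ := factAt_sound (sourceWord_eq vs I t) (fun x hx r hr => by
        have := mem_flatMap_encodeVal hx
        simp [hr, Sym.isBit, Sym.isValue] at this) (fun x hx r hr => by
        have := mem_encodeTuple hx
        simp [hr, Sym.isBit, Sym.isValue] at this) (noBit_encodeTuple t) hfact
    obtain ⟨⟨r', u'⟩, ha, heq⟩ := List.mem_map.1 hu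
    simp only [RelAtom.map, RelAtom.mk.injEq] at heq
    obtain ⟨rfl, heq⟩ := heq
    obtain rfl := eq_of_heq heq
    exact ⟨u', ha, hargs⟩
  complete := fun a ha => exists_factAt (sourceWord_eq vs I t) (noBit_encodeTuple t)
    (List.mem_map.2 ⟨a, ha, rfl⟩)
  tag := fun x hx z hz => exists_valAt (l := []) (sourceWord_eq vs I t)
    (noBit_atoms (noBit_encodeTuple t))
    (hvs _ (List.mem_flatMap.2 ⟨x, hx, List.mem_map.2 ⟨z, hz, rfl⟩⟩))
  body_le := hU.1
  head_le := hU.2.1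
  aegd_le := hU.2.2

/-- The certain answers under the ABD-semantics are computed in polynomial time, by a chase whose
elements are tuples of positions.  The constants of the query and the names of the nulls are written
in front of the input. -/
theorem polyTime_source {M : Mapping S T} (hM : M.density = 1) {q : UCQNeq T k}
    (hq : q.AtMostOneNeq) (f : List (RelAtom S Cons) × (Fin k → Cons) → Bool)
    (hf : ∀ x, f x = true ↔ x.2 ∈ certainOver q (M.Sol x.1.toFinset)) :
    PolyTime encodeSourceInput f := by
  obtain ⟨V, hV⟩ := exists_var_bound (q.flatMap CQNeq.terms)
  have hV' : ∀ d ∈ q, ∀ x, Term.var x ∈ d.terms → x ≤ V := fun d hd x hx =>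
    hV x (List.mem_flatMap.2 ⟨d, hd, hx⟩)
  obtain ⟨U, hU⟩ := M.exists_bound
  obtain ⟨vs, hvs⟩ : ∃ vs, vs = termConstants (q.flatMap CQNeq.terms) ++ M.nullTags := ⟨_, rfl⟩
  have hC : ∀ d ∈ q, ∀ c, Term.cst c ∈ d.terms → Val.cst c ∈ vs := fun d hd c hc => hvs ▸
    List.mem_append_left _ (mem_termConstants (List.mem_flatMap.2 ⟨d, hd, hc⟩))
  refine polyTime_of_chase (m := U + 1 + 1)
    (Op := fun w E a b => (w[a 0] = Sym.cst ∧ token w (a 0) = token w (b 0)) ∨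
      M.Forces U w E a b ∨
      q.Forces V E (IsCst w) (IsAnswer w) (TargetFact M (fun _ => True) w) a b)
    (Den := fun w E => M.Violates U w E ∨
      q.Returns V E (IsCst w) (IsAnswer w) (TargetFact M (fun _ => True) w))
    (Diff := Differ)
    (((Def.symbol _ (Sum.inl 0)).and (Def.token_eq (Sum.inl 0) (Sum.inr 0))).or
      (Def.mappingForces.or (Def.forces Def.isCst (Def.targetFact _) Def.isAnswer q V)))
    (Def.mappingViolates.or (Def.returns Def.isCst (Def.targetFact _) Def.isAnswer q V))
    Def.differ
    (fun w L L' h a b => Or.imp_right (Or.imp (Mapping.Forces.mono h) (UCQNeq.Forces.mono h)))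
    (fun w L L' h => Or.imp (Mapping.Violates.mono h) (UCQNeq.Returns.mono h))
    encodeSourceInput f (vs.flatMap encodeVal) (fun x => cstOf _)
    (fun x L a b c ha hb => .inl ⟨(cstOf_eq_some.1 ha).symbol_eq,
      (cstOf_eq_some.1 ha).trans (cstOf_eq_some.1 hb).symm⟩)
    (fun x a b => differ_iff (sourceWord_valid vs x.1 x.2) a b) ?_
  rintro ⟨I, t⟩
  have hdesc : Describes (sourceWord vs I t) I M U :=
    sourceWord_describes vs I t hU fun v hv => hvs ▸ List.mem_append_right _ hv
  have hmem : f (I, t) = false ↔ ∃ J ∈ M.Sol I.toFinset, t ∉ q.answers J := by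
    rw [← Bool.not_eq_true, hf, mem_certainOver]
    push Not
    rfl
  rw [hmem, hdesc.exists_sol_iff hM]
  change _ ↔ ∃ val : (Fin (U + 1 + 1) → Fin (sourceWord vs I t).length) → Cons,
    (∀ a c, cstOf (sourceWord vs I t) a = some c → val a = c) ∧ _
  refine exists_congr fun val => ?_
  have hcst : (∀ c a, IsCst (sourceWord vs I t) c a → val a = c) ↔
      ∀ a c, cstOf (sourceWord vs I t) a = some c → val a = c := by
    simp only [cstOf_eq_some]
    exact forall_comm
  rw [hcst]
  refine and_congr_right fun hval => ?_
  replace hval := hcst.2 hval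
  have hw : sourceWord vs I t = (vs.flatMap encodeVal ++
      (I.map fun a => a.map Val.cst).flatMap encodeAtom) ++ encodeTuple t := by
    rw [sourceWord_eq, List.append_assoc]
  have hquery : ∀ J : Instance T, (∀ f, f ∈ J ↔ ∃ g,
      TargetFact M (fun _ => True) (sourceWord vs I t) g ∧ g.map val = f) → (t ∉ q.answers J ↔
      (∀ a b, q.Forces V (Ker val) (IsCst _) (IsAnswer _)
        (TargetFact M (fun _ => True) (sourceWord vs I t)) a b → val a = val b) ∧
      ¬ q.Returns V (Ker val) (IsCst _) (IsAnswer _)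
        (TargetFact M (fun _ => True) (sourceWord vs I t))) := by
    intro J hJ
    have hne : Nonempty (Fin (U + 1 + 1) → Fin (sourceWord vs I t).length) :=
      let ⟨i⟩ := hdesc.nonempty
      ⟨fun _ => i⟩
    refine UCQNeq.not_mem_answers_iff hq (fun c b h => hval c b h) (fun p e he => ?_)
      (fun p => ?_) hV' (fun d hd c hc => ?_) hJ
    · refine hval _ _ (answerAt_sound hw ?_ p he)
      rintro x hx rfl
      rcases List.mem_append.1 hx with h | h
      · have := mem_flatMap_encodeVal h
        simp [Sym.isBit, Sym.isValue] at this
      · have := mem_encodeAtoms h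
        simp [Sym.isBit, Sym.isValue] at this
    · obtain ⟨j, hj⟩ := exists_answerAt hw p
      exact ⟨fun _ => j, hj⟩
    · obtain ⟨i, hi⟩ := exists_valAt (l := []) (sourceWord_eq vs I t)
        (noBit_atoms (noBit_encodeTuple t)) (hC d hd c hc)
      exact ⟨fun _ => i, hi⟩
  constructor
  · rintro ⟨hforce, hviol, J, hJ, ht⟩
    obtain ⟨h1, h2⟩ := (hquery J hJ).1 ht
    refine ⟨?_, not_or.2 ⟨hviol, h2⟩⟩
    rintro a b (⟨hcst, hab⟩ | hab | hab)
    · obtain ⟨c, hc⟩ := hdesc.valid.exists_cst hcst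
      rw [hval c a hc, hval c b (hab.symm.trans hc)]
    · exact hforce a b hab
    · exact h1 a b hab
  · rintro ⟨hop, hden⟩
    obtain ⟨hviol, hret⟩ := not_or.1 hden
    obtain ⟨J, hJ⟩ := exists_instance (TargetFact M (fun _ => True) (sourceWord vs I t)) val
    exact ⟨fun a b h => hop a b (.inr (.inl h)), hviol, J, hJ, (hquery J hJ).2
      ⟨fun a b h => hop a b (.inr (.inr h)), hret⟩⟩

end Source

end ABDExchange

theorem theorem8 (S T : ABDExchange.Schema) (M : ABDExchange.Mapping S T)
    (hsafe : M.Safe) (hdens : M.density = 1)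
    (k : ℕ) (q : ABDExchange.UCQNeq T k) (hq : ABDExchange.UCQNeq.AtMostOneNeq q) :
    (∃ f : List (ABDExchange.RelAtom S ABDExchange.Cons) × (Fin k → ABDExchange.Cons) → Bool,
      ABDExchange.PolyTime ABDExchange.encodeSourceInput f ∧
      ∀ (I : List (ABDExchange.RelAtom S ABDExchange.Cons)) (t : Fin k → ABDExchange.Cons),
        f (I, t) = true ↔ t ∈ ABDExchange.certainOver q (M.Sol I.toFinset)) ∧
    (∃ g : ABDExchange.CondTable T × (Fin k → ABDExchange.Cons) → Bool,
      ABDExchange.PolyTime ABDExchange.encodeTableInput g ∧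
      (∀ (D : ABDExchange.CondTable T) (t : Fin k → ABDExchange.Cons),
        g (D, t) = true ↔ t ∈ ABDExchange.certainOver q D.Rep) ∧
      ∀ (I : ABDExchange.Instance S) (D : ABDExchange.CondTable T)
        (t : Fin k → ABDExchange.Cons), D.IsUniversalRepresentative M I →
        (g (D, t) = true ↔ t ∈ ABDExchange.certainOver q (M.Sol I))) := by
  classical
  have hg : ∀ x : ABDExchange.CondTable T × (Fin k → ABDExchange.Cons),
      decide (x.2 ∈ ABDExchange.certainOver q x.1.Rep) = true ↔
        x.2 ∈ ABDExchange.certainOver q x.1.Rep := fun x => decide_eq_true_iff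
  refine ⟨⟨fun x => decide (x.2 ∈ ABDExchange.certainOver q (M.Sol x.1.toFinset)),
    ABDExchange.polyTime_source hdens hq _ fun x => decide_eq_true_iff,
    fun I t => decide_eq_true_iff⟩, ⟨_, ABDExchange.polyTime_table hq _ hg,
    fun D t => hg (D, t), fun I D t hD => ?_⟩⟩
  rw [← hD]
  exact hg (D, t)
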